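/- Let $\mathbb F$ be a field of characteristic zero, let $\mathfrak k$ be a differential graded Lie algebra over $\mathbb F$ (differential $d$ of degree $-1$) concentrated in degrees $-1$ and $-2$, and let $(\nabla\colon \mathrm H(\mathfrak k)\to\mathfrak k,\ \pi\colon \mathfrak k\to \mathrm H(\mathfrak k),\ h)$ be a contraction of the chain complex $\mathfrak k$ onto its homology (with zero differential): $\nabla,\pi$ are chain maps, $h$ has degree $1$, $\pi\nabla=\mathrm{Id}$, $dh+hd=\mathrm{Id}-\nabla\pi$, $\pi h=0$, $h\nabla=0$, $hh=0$. Write $V=s\mathfrak k$ and $\mathbf v=s\mathrm H(\mathfrak k)$ for the suspensions and $\mathrm S^{\mathrm c}[\,\cdot\,]$ for the graded symmetric coalgebra. For a differential graded Lie algebra $\mathfrak g$ with differential $d$, let $\tau_{\mathfrak g}\colon \mathrm S^{\mathrm c}[s\mathfrak g]\to s\mathfrak g\to\mathfrak g$ be the cogenerating projection followed by the desuspension, and let $\mathcal C[\mathfrak g]$ be the classifying (Cartan–Chevalley–Eilenberg) coalgebra, i.e. $\mathrm S^{\mathrm c}[s\mathfrak g]$ with the coderivation $D$ determined by $\tau_{\mathfrak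 g}D=-d\tau_{\mathfrak g}+\tfrac12[\tau_{\mathfrak g},\tau_{\mathfrak g}]$; here and below, the bracket of linear maps $a,b$ of degree $-1$ on a coalgebra is $[a,b]=[\,\cdot\,,\cdot\,]\circ(a\otimes b)\circ\Delta$. Let $\mathfrak k_{\mathrm a}$ be the differential graded Lie algebra with the same underlying chain complex as $\mathfrak k$ and with bracket $[x,y]_{\mathrm a}=dh[x,y]=[x,y]-\nabla\pi[x,y]$. Define $\tau=\tau^1+\tau^2+\cdots\colon \mathrm S^{\mathrm c}[\mathbf v]\to\mathfrak k_{\mathrm a}$ by $\tau^1=\nabla\tau_{\mathrm H(\mathfrak k)}$ and $\tau^\ell=\tfrac12 h\sum_{j=1}^{\ell-1}[\tau^j,\tau^{\ell-j}]_{\mathrm a}\colon\mathrm S^{\mathrm c}_\ell[\mathbf v]\to\mathfrak k_{\mathrm a}$ for $\ell\ge2$, let $\overline\tau\colon \mathrm S^{\mathrm c}[\mathbf v]\to \mathrm S^{\mathrm c}[V]$ be the morphism of coaugmented graded coalgebras cogenerated by $s\tau$, and let $\mathrm S^{\mathrm c}[\pi]\colon \mathrm S^{\mathrm c}[V]\to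 \mathrm S^{\mathrm c}[\mathbf v]$ be induced by $\pi$. Finally, let $\mathcal D=\mathcal D^1+\mathcal D^2+\cdots$ be the operator on $\mathrm S^{\mathrm c}[\mathbf v]$ where $\mathcal D^{\ell-1}$ $(\ell\ge2)$ is the coderivation determined by $\tau_{\mathrm H(\mathfrak k)}\mathcal D^{\ell-1}=\tfrac12\pi\sum_{j=1}^{\ell-1}[\sigma^j,\sigma^{\ell-j}]$ on $\mathrm S^{\mathrm c}_\ell[\mathbf v]$ (and zero on the other word lengths), the $\sigma^j$ being defined by the same recursion as the $\tau^j$ but with the bracket of $\mathfrak k$ in place of that of $\mathfrak k_{\mathrm a}$. Then: 1. $\mathfrak k_{\mathrm a}$ is formal, i.e. $L_\infty$-equivalent to its homology Lie algebra $\mathrm H(\mathfrak k_{\mathrm a})$: there are morphisms of coaugmented differential graded coalgebras $\mathcal C[\mathfrak k_{\mathrm a}]\to\mathcal C[\mathrm H(\mathfrak k_{\mathrm a})]$ and $\mathcal C[\mathrm H(\mathfrak k_{\mathrm a})]\to\mathcal C[\mathfrak k_{\mathrm a}]$ whose linear parts are quasi-isomorphisms. 2. With the zero differential on $\mathrm S^{\mathrm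 c}[\mathbf v]$, both $\overline\tau\colon \mathrm S^{\mathrm c}[\mathbf v]\to\mathcal C[\mathfrak k_{\mathrm a}]$ and $\mathrm S^{\mathrm c}[\pi]\colon\mathcal C[\mathfrak k_{\mathrm a}]\to \mathrm S^{\mathrm c}[\mathbf v]$ are morphisms of coaugmented differential graded coalgebras inducing isomorphisms on homology, and $\mathrm S^{\mathrm c}[\pi]\circ\overline\tau=\mathrm{Id}$. Moreover there is a homotopy $H$ on $\mathcal C[\mathfrak k_{\mathrm a}]$ such that $(\overline\tau,\mathrm S^{\mathrm c}[\pi],H)$ is a contraction of $\mathcal C[\mathfrak k_{\mathrm a}]$ onto $\mathrm S^{\mathrm c}[\mathbf v]$. 3. $\mathcal D$ is a coalgebra differential on $\mathrm S^{\mathrm c}[\mathbf v]$, and $\overline\tau$ is also a morphism of coaugmented differential graded coalgebras $\mathrm S^{\mathrm c}_{\mathcal D}[\mathbf v]=(\mathrm S^{\mathrm c}[\mathbf v],\mathcal D)\to\mathcal C[\mathfrak k]$. -/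

import Mathlib

open scoped TensorProduct DirectSum

noncomputable section

namespace DGL

/-! ## Graded vector spaces

A `ℤ`-graded vector space is a vector space `V` with a family `𝒱 : ℤ → Submodule F V` of
subspaces and an instance `DirectSum.Decomposition 𝒱`. -/

section Graded

variable {F : Type*} [Field F] {V : Type*} [AddCommGroup V] [Module F V]

/-- The linear map that is given by `f i` on the constituent of degree `i`. -/
def ofDegree (𝒱 : ℤ → Submodule F V) [DirectSum.Decomposition 𝒱] {W : Type*} [AddCommGroup W]
    [Module F W] (f : ℤ → V →ₗ[F] W) : V →ₗ[F] W :=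
  (DirectSum.toModule F ℤ W fun i => f i ∘ₗ (𝒱 i).subtype) ∘ₗ
    (DirectSum.decomposeLinearEquiv 𝒱).toLinearMap

theorem ofDegree_of_mem {𝒱 : ℤ → Submodule F V} [DirectSum.Decomposition 𝒱] {W : Type*}
    [AddCommGroup W] [Module F W] (f : ℤ → V →ₗ[F] W) {i : ℤ} {x : V} (hx : x ∈ 𝒱 i) :
    ofDegree 𝒱 f x = f i x := by
  rw [ofDegree, LinearMap.comp_apply, LinearEquiv.coe_coe, DirectSum.decomposeLinearEquiv_apply,
    DirectSum.decompose_of_mem 𝒱 hx, ← DirectSum.lof_eq_of F, DirectSum.toModule_lof]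
  rfl

/-- The linear map with `x ↦ (-1) ^ i • x` for `x` of degree `i`. -/
def sgn (𝒱 : ℤ → Submodule F V) [DirectSum.Decomposition 𝒱] : V →ₗ[F] V :=
  ofDegree 𝒱 fun i => ((-1 : F) ^ i) • LinearMap.id

theorem sgn_of_mem {𝒱 : ℤ → Submodule F V} [DirectSum.Decomposition 𝒱] {i : ℤ} {x : V}
    (hx : x ∈ 𝒱 i) : sgn 𝒱 x = ((-1 : F) ^ i) • x := by
  simp [sgn, ofDegree_of_mem _ hx]

/-- The projection of `V` onto its constituent of degree `i`. -/
def comp (𝒱 : ℤ → Submodule F V) [DirectSum.Decomposition 𝒱] (i : ℤ) : V →ₗ[F] V :=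
  ofDegree 𝒱 fun j => if j = i then LinearMap.id else 0

theorem comp_of_mem {𝒱 : ℤ → Submodule F V} [DirectSum.Decomposition 𝒱] {i : ℤ} {x : V}
    (hx : x ∈ 𝒱 i) : comp 𝒱 i x = x := by
  simp [comp, ofDegree_of_mem _ hx]

theorem comp_of_mem_ne {𝒱 : ℤ → Submodule F V} [DirectSum.Decomposition 𝒱] {i j : ℤ} {x : V}
    (hx : x ∈ 𝒱 j) (h : j ≠ i) : comp 𝒱 i x = 0 := by
  simp [comp, ofDegree_of_mem _ hx, h]

theorem comp_eq_decompose (𝒱 : ℤ → Submodule F V) [DirectSum.Decomposition 𝒱] (i : ℤ) (x : V) :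
    comp 𝒱 i x = DirectSum.decompose 𝒱 x i := by
  induction x using DirectSum.Decomposition.inductionOn 𝒱 with
  | zero => simp
  | @homogeneous j y =>
    by_cases h : j = i
    · subst h
      rw [comp_of_mem y.2, DirectSum.decompose_of_mem_same 𝒱 y.2]
    · rw [comp_of_mem_ne y.2 h, DirectSum.decompose_of_mem_ne 𝒱 y.2 h]
  | add y z hy hz => rw [map_add, hy, hz, DirectSum.decompose_add]; rfl

/-- Two linear maps that agree on homogeneous elements are equal. -/
theorem hom_ext (𝒱 : ℤ → Submodule F V) [DirectSum.Decomposition 𝒱] {W : Type*}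
    [AddCommGroup W] [Module F W] {f g : V →ₗ[F] W}
    (h : ∀ i, ∀ x ∈ 𝒱 i, f x = g x) : f = g :=
  DirectSum.decompose_lhom_ext 𝒱 fun i => LinearMap.ext fun x => h i x x.2

/-- A family of subspaces that spans and admits projections is a grading. -/
theorem isInternal_of_proj {𝒱 : ℤ → Submodule F V} (p : ℤ → V →ₗ[F] V)
    (h1 : ∀ i, ∀ x ∈ 𝒱 i, p i x = x) (h2 : ∀ i j, j ≠ i → ∀ x ∈ 𝒱 j, p i x = 0)
    (hs : ⨆ i, 𝒱 i = ⊤) : DirectSum.IsInternal 𝒱 := by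
  rw [DirectSum.isInternal_submodule_iff_iSupIndep_and_iSup_eq_top]
  refine ⟨fun i => ?_, hs⟩
  rw [Submodule.disjoint_def]
  intro x hx hx'
  have : (⨆ j, ⨆ (_ : j ≠ i), 𝒱 j) ≤ LinearMap.ker (p i) :=
    iSup₂_le fun j hj y hy => h2 i j hj y hy
  rw [← h1 i x hx]
  exact this hx'

/-- The grading of the suspension: `(sV)_i = V_{i-1}`. The suspension `s` itself is the
identity map of the underlying vector space, regarded as a map of degree `1`; accordingly the
differential of the suspension of `(V, d)` is `-d`. -/
def shift (𝒱 : ℤ → Submodule F V) : ℤ → Submodule F V := fun i => 𝒱 (i - 1)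

instance shiftDecomposition (𝒱 : ℤ → Submodule F V) [DirectSum.Decomposition 𝒱] :
    DirectSum.Decomposition (shift 𝒱) :=
  DirectSum.IsInternal.chooseDecomposition _ <| by
    refine isInternal_of_proj (fun i => comp 𝒱 (i - 1)) (fun i x hx => comp_of_mem hx)
      (fun i j hj x hx => comp_of_mem_ne (i := i - 1) (j := j - 1) hx (by omega)) ?_
    have h := (DirectSum.Decomposition.isInternal 𝒱).submodule_iSup_eq_top
    rw [← h]
    exact (Equiv.subRight (1 : ℤ)).iSup_comp (g := 𝒱)

/-- The homology `ker d / im d`. -/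
abbrev Homology (d : V →ₗ[F] V) : Type _ :=
  LinearMap.ker d ⧸ (LinearMap.range d).submoduleOf (LinearMap.ker d)

/-- The map induced on homology by a map commuting with the differentials. -/
def homologyMap {W : Type*} [AddCommGroup W] [Module F W] {dV : V →ₗ[F] V} {dW : W →ₗ[F] W}
    (f : V →ₗ[F] W) (h : f ∘ₗ dV = dW ∘ₗ f) : Homology dV →ₗ[F] Homology dW :=
  Submodule.mapQ _ _
    (f.restrict (p := LinearMap.ker dV) (q := LinearMap.ker dW) fun x hx => by
      have := LinearMap.congr_fun h x
      simp only [LinearMap.mem_ker, LinearMap.comp_apply] at hx this ⊢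
      rw [← this, hx, map_zero]) <| by
    rintro ⟨x, hx⟩ ⟨w, hw⟩
    have hw' : dV w = x := hw
    exact ⟨f w, (LinearMap.congr_fun h w).symm.trans (congrArg f hw')⟩

/-- `f : (V, dV) → (W, dW)` is a chain map inducing an isomorphism on homology. -/
def IsQuasiIso {W : Type*} [AddCommGroup W] [Module F W] (dV : V →ₗ[F] V) (dW : W →ₗ[F] W)
    (f : V →ₗ[F] W) : Prop :=
  ∃ h : f ∘ₗ dV = dW ∘ₗ f, Function.Bijective (homologyMap f h)

/-- A contraction of the chain complex `(N, d)` onto the chain complex `(M, dM)`: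
chain maps `incl : M → N` and `proj : N → M` and a homotopy `h` of degree `1` on `N` with
`proj ∘ incl = Id` and `d h + h d = Id - incl ∘ proj`, subject to the side conditions
`proj ∘ h = 0`, `h ∘ incl = 0`, `h ∘ h = 0`. -/
structure Contraction {M N : Type*} [AddCommGroup M] [Module F M] [AddCommGroup N] [Module F N]
    (𝓜 : ℤ → Submodule F M) (dM : M →ₗ[F] M) (𝓝 : ℤ → Submodule F N) (d : N →ₗ[F] N) where
  incl : M →ₗ[F] N
  proj : N →ₗ[F] M
  h : N →ₗ[F] N
  incl_mem : ∀ i, ∀ x ∈ 𝓜 i, incl x ∈ 𝓝 i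
  proj_mem : ∀ i, ∀ x ∈ 𝓝 i, proj x ∈ 𝓜 i
  h_mem : ∀ i, ∀ x ∈ 𝓝 i, h x ∈ 𝓝 (i + 1)
  incl_comm : ∀ x, incl (dM x) = d (incl x)
  proj_comm : ∀ x, proj (d x) = dM (proj x)
  proj_incl : ∀ x, proj (incl x) = x
  homotopy : ∀ x, d (h x) + h (d x) = x - incl (proj x)
  proj_h : ∀ x, proj (h x) = 0
  h_incl : ∀ x, h (incl x) = 0
  h_h : ∀ x, h (h x) = 0

end Graded

/-! ## The graded symmetric coalgebra

In characteristic zero the graded symmetric coalgebra `S^c[V]` is canonically isomorphic, as a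
Hopf algebra, to the graded symmetric algebra `S[V]` with the diagonal map for which the elements
of `V` are primitive. It is realized here in this way. -/

section Sym

variable {F : Type*} [Field F] {V : Type*} [AddCommGroup V] [Module F V]

/-- Graded commutativity: `x y = (-1)^{|x||y|} y x`. -/
inductive GSymRel (𝒱 : ℤ → Submodule F V) : TensorAlgebra F V → TensorAlgebra F V → Prop
  | swap {i j : ℤ} {x y : V} (hx : x ∈ 𝒱 i) (hy : y ∈ 𝒱 j) :
      GSymRel 𝒱 (TensorAlgebra.ι F x * TensorAlgebra.ι F y)
        (((-1 : F) ^ (i * j)) • (TensorAlgebra.ι F y * TensorAlgebra.ι F x))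

/-- The underlying space of the graded symmetric (co)algebra on the graded vector space `V`. -/
def GSym (𝒱 : ℤ → Submodule F V) : Type _ := RingQuot (GSymRel 𝒱)

namespace GSym

variable (𝒱 : ℤ → Submodule F V)

instance : Ring (GSym 𝒱) := inferInstanceAs (Ring (RingQuot (GSymRel 𝒱)))

instance : Algebra F (GSym 𝒱) := inferInstanceAs (Algebra F (RingQuot (GSymRel 𝒱)))

/-- The inclusion of `V` as the constituent of word length one. -/
def ι : V →ₗ[F] GSym 𝒱 :=
  (RingQuot.mkAlgHom F (GSymRel 𝒱)).toLinearMap ∘ₗ TensorAlgebra.ι F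

variable {𝒱}

theorem ι_mul_ι {i j : ℤ} {x y : V} (hx : x ∈ 𝒱 i) (hy : y ∈ 𝒱 j) :
    ι 𝒱 x * ι 𝒱 y = ((-1 : F) ^ (i * j)) • (ι 𝒱 y * ι 𝒱 x) := by
  have h := RingQuot.mkAlgHom_rel F (GSymRel.swap (F := F) hx hy)
  rw [map_mul, map_smul, map_mul] at h
  exact h

/-- The universal property of the graded symmetric algebra. -/
def lift {A : Type*} [Ring A] [Algebra F A] (f : V →ₗ[F] A)
    (hf : ∀ i j, ∀ x ∈ 𝒱 i, ∀ y ∈ 𝒱 j, f x * f y = ((-1 : F) ^ (i * j)) • (f y * f x)) :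
    GSym 𝒱 →ₐ[F] A :=
  RingQuot.liftAlgHom F ⟨TensorAlgebra.lift F f, by
    rintro _ _ ⟨hx, hy⟩
    simpa using hf _ _ _ hx _ hy⟩

@[simp]
theorem lift_ι {A : Type*} [Ring A] [Algebra F A] (f : V →ₗ[F] A)
    (hf : ∀ i j, ∀ x ∈ 𝒱 i, ∀ y ∈ 𝒱 j, f x * f y = ((-1 : F) ^ (i * j)) • (f y * f x)) (x : V) :
    lift f hf (ι 𝒱 x) = f x := by
  exact (RingQuot.liftAlgHom_mkAlgHom_apply F _ _ _).trans (TensorAlgebra.lift_ι_apply f x)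

theorem algHom_ext {A : Type*} [Ring A] [Algebra F A] {f g : GSym 𝒱 →ₐ[F] A}
    (h : ∀ x, f (ι 𝒱 x) = g (ι 𝒱 x)) : f = g :=
  RingQuot.ringQuot_ext' F _ _ (TensorAlgebra.hom_ext (LinearMap.ext h))

/-- The map `S[f] : S[V] → S[W]` induced by a linear map `f : V → W` of degree zero. -/
def map {W : Type*} [AddCommGroup W] [Module F W] {𝒲 : ℤ → Submodule F W} (f : V →ₗ[F] W)
    (hf : ∀ i, ∀ x ∈ 𝒱 i, f x ∈ 𝒲 i) : GSym 𝒱 →ₐ[F] GSym 𝒲 :=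
  lift (ι 𝒲 ∘ₗ f) fun i j x hx y hy => ι_mul_ι (hf i x hx) (hf j y hy)

variable (𝒱)

/-- The constituent of total degree `n`: the span of the products `x₁ ⋯ x_k` of homogeneous
elements with `|x₁| + ⋯ + |x_k| = n`. -/
def degree (n : ℤ) : Submodule F (GSym 𝒱) :=
  Submodule.span F {z | ∃ l : List (ℤ × V), (∀ p ∈ l, p.2 ∈ 𝒱 p.1) ∧
    (l.map Prod.fst).sum = n ∧ (l.map fun p => ι 𝒱 p.2).prod = z}

/-- The algebra map to polynomials with `x ↦ x T` on `V`; the coefficient of `T ^ n` is the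
projection onto the constituent of word length `n`. -/
def lengthPoly : GSym 𝒱 →ₐ[F] Polynomial (GSym 𝒱) :=
  lift ((Polynomial.monomial 1).restrictScalars F ∘ₗ ι 𝒱) fun i j x hx y hy => by
    simp only [LinearMap.comp_apply, LinearMap.restrictScalars_apply,
      Polynomial.monomial_mul_monomial, Polynomial.smul_monomial]
    rw [ι_mul_ι hx hy]

/-- The linear map that is given by `f n` on the constituent `S^c_n[V]` of word length `n`. -/
def ofLength {W : Type*} [AddCommGroup W] [Module F W] (f : ℕ → GSym 𝒱 →ₗ[F] W) :
    GSym 𝒱 →ₗ[F] W :=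
  Polynomial.lsum (R := F) (A := GSym 𝒱) (M := W) f ∘ₗ (lengthPoly 𝒱).toLinearMap

/-- The cogenerating morphism `S^c[V] → V`, the projection onto word length one. -/
def pr : GSym 𝒱 →ₗ[F] V :=
  letI : Module Fᵐᵒᵖ V := Module.compHom _ ((RingHom.id F).fromOpposite mul_comm)
  haveI : IsCentralScalar F V := ⟨fun _ _ => rfl⟩
  TrivSqZeroExt.sndHom F V ∘ₗ (lift (𝒱 := 𝒱) (TrivSqZeroExt.inrHom F V)
    fun i j x _ y _ => by simp [TrivSqZeroExt.inr_mul_inr]).toLinearMap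

/-- The counit. -/
def counit : GSym 𝒱 →ₐ[F] F := lift 0 fun _ _ _ _ _ _ => by simp

variable [DirectSum.Decomposition 𝒱]

/-- The algebra automorphism `c ↦ (-1)^{|c|} c`. -/
def parity : GSym 𝒱 →ₐ[F] GSym 𝒱 :=
  map (sgn 𝒱) fun i x hx => by rw [sgn_of_mem hx]; exact Submodule.smul_mem _ _ hx

/-- The map `c ↦ (-1)^{i |c|} c`. -/
def koszul (i : ℤ) : GSym 𝒱 →ₗ[F] GSym 𝒱 :=
  if Even i then LinearMap.id else (parity 𝒱).toLinearMap

/-- Left multiplication by `x ⊗ 1 + 1 ⊗ x` on the graded tensor product `S[V] ⊗ S[V]`, for `x`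
of degree `i`, that is, `a ⊗ b ↦ x a ⊗ b + (-1)^{i |a|} a ⊗ x b`. -/
def primMul (i : ℤ) : V →ₗ[F] Module.End F (GSym 𝒱 ⊗[F] GSym 𝒱) :=
  (LinearMap.mk₂ F (fun (f g : Module.End F (GSym 𝒱)) => TensorProduct.map f g)
      TensorProduct.map_add_left TensorProduct.map_smul_left
      TensorProduct.map_add_right TensorProduct.map_smul_right).flip LinearMap.id ∘ₗ
      LinearMap.mul F (GSym 𝒱) ∘ₗ ι 𝒱
    + (LinearMap.mk₂ F (fun (f g : Module.End F (GSym 𝒱)) => TensorProduct.map f g)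
      TensorProduct.map_add_left TensorProduct.map_smul_left
      TensorProduct.map_add_right TensorProduct.map_smul_right) (koszul 𝒱 i) ∘ₗ
      LinearMap.mul F (GSym 𝒱) ∘ₗ ι 𝒱

@[simp]
theorem primMul_tmul (i : ℤ) (x : V) (a b : GSym 𝒱) :
    primMul 𝒱 i x (a ⊗ₜ b) = (ι 𝒱 x * a) ⊗ₜ b + koszul 𝒱 i a ⊗ₜ (ι 𝒱 x * b) := rfl

theorem koszul_ι_mul {i j : ℤ} {x : V} (hx : x ∈ 𝒱 j) (a : GSym 𝒱) :
    koszul 𝒱 i (ι 𝒱 x * a) = ((-1 : F) ^ (i * j)) • (ι 𝒱 x * koszul 𝒱 i a) := by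
  unfold koszul
  split_ifs with h
  · simp [(h.mul_right j).neg_one_zpow]
  · have : (-1 : F) ^ (i * j) = (-1) ^ j := by
      rw [zpow_mul, (Int.not_even_iff_odd.mp h).neg_one_zpow]
    rw [this]
    simp [parity, map, sgn_of_mem hx]

theorem primMul_comm {i j : ℤ} {x y : V} (hx : x ∈ 𝒱 i) (hy : y ∈ 𝒱 j) :
    primMul 𝒱 i x * primMul 𝒱 j y = ((-1 : F) ^ (i * j)) • (primMul 𝒱 j y * primMul 𝒱 i x) := by
  have hk : koszul 𝒱 i ∘ₗ koszul 𝒱 j = koszul 𝒱 j ∘ₗ koszul 𝒱 i := by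
    unfold koszul; split_ifs <;> rfl
  refine TensorProduct.ext' fun a b => ?_
  have hk' := LinearMap.congr_fun hk a
  simp only [LinearMap.comp_apply] at hk'
  have e : ((-1 : F) ^ (i * j)) * ((-1 : F) ^ (i * j)) = 1 := by
    rw [← mul_zpow]; simp
  have hxy : ∀ c, ι 𝒱 x * (ι 𝒱 y * c) = ((-1 : F) ^ (i * j)) • (ι 𝒱 y * (ι 𝒱 x * c)) := by
    intro c; rw [← mul_assoc, ι_mul_ι hx hy, smul_mul_assoc, mul_assoc]
  simp only [Module.End.mul_apply, LinearMap.smul_apply, primMul_tmul, map_add, smul_add,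
    koszul_ι_mul 𝒱 hx, koszul_ι_mul 𝒱 hy, hxy, hk', TensorProduct.smul_tmul',
    TensorProduct.tmul_smul, mul_comm j i, smul_smul, e, one_smul]
  abel

/-- The diagonal map of `S[V]` as an action: the algebra map that sends a homogeneous `x ∈ V` to
left multiplication by `x ⊗ 1 + 1 ⊗ x` on the graded tensor product. -/
def comulAction : GSym 𝒱 →ₐ[F] Module.End F (GSym 𝒱 ⊗[F] GSym 𝒱) :=
  lift (ofDegree 𝒱 (primMul 𝒱)) fun i j x hx y hy => by
    rw [ofDegree_of_mem _ hx, ofDegree_of_mem _ hy, primMul_comm 𝒱 hx hy]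

/-- The diagonal map `Δ : S^c[V] → S^c[V] ⊗ S^c[V]`: the map with `Δ 1 = 1 ⊗ 1` and
`Δ (x c) = (x ⊗ 1 + 1 ⊗ x) Δ c` for `x ∈ V`, the product being that of the graded tensor
product. -/
def comul : GSym 𝒱 →ₗ[F] GSym 𝒱 ⊗[F] GSym 𝒱 :=
  LinearMap.applyₗ (1 ⊗ₜ[F] 1) ∘ₗ (comulAction 𝒱).toLinearMap

theorem comul_one : comul 𝒱 1 = 1 ⊗ₜ 1 := by simp [comul]

theorem comul_ι_mul {i : ℤ} {x : V} (hx : x ∈ 𝒱 i) (c : GSym 𝒱) :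
    comul 𝒱 (ι 𝒱 x * c) = primMul 𝒱 i x (comul 𝒱 c) := by
  simp [comul, comulAction, ofDegree_of_mem _ hx]

variable {𝒱}

/-- The convolution product `c ↦ Σ a(c') b(c'')` of a homogeneous linear map
`a` and a linear map `b` of degree zero, with values in an algebra. (As `b` has degree zero, no
sign arises.) -/
def conv {A : Type*} [Ring A] [Algebra F A] (a b : GSym 𝒱 →ₗ[F] A) : GSym 𝒱 →ₗ[F] A :=
  LinearMap.mul' F A ∘ₗ TensorProduct.map a b ∘ₗ comul 𝒱

/-- Convolution powers; the zeroth one is the unit `c ↦ ε(c) 1`. -/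
def convPow {A : Type*} [Ring A] [Algebra F A] (a : GSym 𝒱 →ₗ[F] A) : ℕ → (GSym 𝒱 →ₗ[F] A)
  | 0 => Algebra.linearMap F A ∘ₗ (counit 𝒱).toLinearMap
  | n + 1 => conv a (convPow a n)

/-- The morphism of coaugmented graded coalgebras `S^c[V] → S^c[W]` cogenerated by a linear map
`f : S^c[V] → W` of degree zero with `f 1 = 0`. It is the convolution exponential
`Σ_n (1 / n!) f^{*n}`; since `f 1 = 0`, on an element of word length `m` only the terms with
`n ≤ m` can be non-zero. -/
def cohom {W : Type*} [AddCommGroup W] [Module F W] (𝒲 : ℤ → Submodule F W)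
    (f : GSym 𝒱 →ₗ[F] W) : GSym 𝒱 →ₗ[F] GSym 𝒲 :=
  ofLength 𝒱 fun m => ∑ n ∈ Finset.range (m + 1), ((n.factorial : F)⁻¹) • convPow (ι 𝒲 ∘ₗ f) n

/-- The coderivation `c ↦ Σ f(c') c''` of `S^c[V]` cogenerated by a homogeneous linear map
`f : S^c[V] → V`. -/
def coder (f : GSym 𝒱 →ₗ[F] V) : GSym 𝒱 →ₗ[F] GSym 𝒱 :=
  conv (ι 𝒱 ∘ₗ f) LinearMap.id

/-- The bracket `[a, b](c) = Σ (-1)^{|b||c'|} [a(c'), b(c'')]` of two linear maps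
`a, b : S^c[V] → L`, the map `b` being of odd degree. -/
def cup {L : Type*} [AddCommGroup L] [Module F L] (B : L →ₗ[F] L →ₗ[F] L)
    (a b : GSym 𝒱 →ₗ[F] L) : GSym 𝒱 →ₗ[F] L :=
  TensorProduct.lift B ∘ₗ TensorProduct.map (a ∘ₗ (parity 𝒱).toLinearMap) b ∘ₗ comul 𝒱

/-- `D` is a coaugmented coalgebra differential on `S^c[V]`: an operator of degree `-1` and of
square zero that is a coderivation and vanishes on `1`. -/
structure IsCodifferential (D : GSym 𝒱 →ₗ[F] GSym 𝒱) : Prop where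
  mem : ∀ n, ∀ c ∈ degree 𝒱 n, D c ∈ degree 𝒱 (n - 1)
  square : D ∘ₗ D = 0
  comul : GSym.comul 𝒱 ∘ₗ D =
    (TensorProduct.map D LinearMap.id + TensorProduct.map (parity 𝒱).toLinearMap D) ∘ₗ
      GSym.comul 𝒱
  one : D 1 = 0

/-- `(S^c[V], D)` and `(S^c[W], D')` are coaugmented differential graded coalgebras and `f` is a
morphism of such from the first to the second. -/
structure IsDGCoalgHom {W : Type*} [AddCommGroup W] [Module F W] {𝒲 : ℤ → Submodule F W}
    [DirectSum.Decomposition 𝒲] (D : GSym 𝒱 →ₗ[F] GSym 𝒱) (D' : GSym 𝒲 →ₗ[F] GSym 𝒲)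
    (f : GSym 𝒱 →ₗ[F] GSym 𝒲) : Prop where
  source : IsCodifferential D
  target : IsCodifferential D'
  mem : ∀ n, ∀ c ∈ degree 𝒱 n, f c ∈ degree 𝒲 n
  comul : GSym.comul 𝒲 ∘ₗ f = TensorProduct.map f f ∘ₗ GSym.comul 𝒱
  counit : ∀ c, GSym.counit 𝒲 (f c) = GSym.counit 𝒱 c
  one : f 1 = 1
  comm : f ∘ₗ D = D' ∘ₗ f

end GSym

end Sym

/-! ## Differential graded Lie algebras -/

section Lie

variable {F : Type*} [Field F] {L : Type*} [AddCommGroup L] [Module F L]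

/-- A differential graded Lie algebra structure on the graded vector space `L`, with a
differential of degree `-1`. -/
structure DGLie (𝓛 : ℤ → Submodule F L) where
  d : L →ₗ[F] L
  d_mem : ∀ i, ∀ x ∈ 𝓛 i, d x ∈ 𝓛 (i - 1)
  d_d : ∀ x, d (d x) = 0
  bracket : L →ₗ[F] L →ₗ[F] L
  bracket_mem : ∀ i j, ∀ x ∈ 𝓛 i, ∀ y ∈ 𝓛 j, bracket x y ∈ 𝓛 (i + j)
  skew : ∀ i j, ∀ x ∈ 𝓛 i, ∀ y ∈ 𝓛 j, bracket x y = -(((-1 : F) ^ (i * j)) • bracket y x)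
  leibniz : ∀ i, ∀ x ∈ 𝓛 i, ∀ y, d (bracket x y) = bracket (d x) y + ((-1 : F) ^ i) • bracket x (d y)
  jacobi : ∀ i j, ∀ x ∈ 𝓛 i, ∀ y ∈ 𝓛 j, ∀ z, bracket x (bracket y z) =
    bracket (bracket x y) z + ((-1 : F) ^ (i * j)) • bracket y (bracket x z)

namespace DGLie

variable {𝓛 : ℤ → Submodule F L}

section Homology

variable [DirectSum.Decomposition 𝓛] (K : DGLie 𝓛)

theorem d_comp (i : ℤ) (x : L) : K.d (comp 𝓛 i x) = comp 𝓛 (i - 1) (K.d x) := by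
  refine LinearMap.congr_fun (f := K.d ∘ₗ comp 𝓛 i) (g := comp 𝓛 (i - 1) ∘ₗ K.d)
    (hom_ext 𝓛 fun j y hy => ?_) x
  by_cases h : j = i
  · subst h
    simp [comp_of_mem hy, comp_of_mem (K.d_mem _ _ hy)]
  · simp [comp_of_mem_ne hy h, comp_of_mem_ne (K.d_mem _ _ hy) (i := i - 1) (by omega)]

theorem d_sgn (x : L) : K.d (sgn 𝓛 x) = -sgn 𝓛 (K.d x) := by
  refine LinearMap.congr_fun (f := K.d ∘ₗ sgn 𝓛) (g := -(sgn 𝓛 ∘ₗ K.d))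
    (hom_ext 𝓛 fun j y hy => ?_) x
  simp [sgn_of_mem hy, sgn_of_mem (K.d_mem _ _ hy), zpow_sub₀, div_neg]

theorem sgn_sgn (x : L) : sgn 𝓛 (sgn 𝓛 x) = x := by
  refine LinearMap.congr_fun (f := sgn 𝓛 ∘ₗ sgn 𝓛) (g := LinearMap.id)
    (hom_ext 𝓛 fun j y hy => ?_) x
  simp [sgn_of_mem hy, smul_smul, ← mul_zpow]

theorem leibniz' (x y : L) :
    K.d (K.bracket x y) = K.bracket (K.d x) y + K.bracket (sgn 𝓛 x) (K.d y) := by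
  refine LinearMap.congr_fun (f := K.d ∘ₗ K.bracket.flip y)
    (g := K.bracket.flip y ∘ₗ K.d + K.bracket.flip (K.d y) ∘ₗ sgn 𝓛)
    (hom_ext 𝓛 fun j x hx => ?_) x
  simp [sgn_of_mem hx, K.leibniz j x hx]

/-- The grading of the homology `H(K) = ker d / im d`. -/
def homologyGrading (i : ℤ) : Submodule F (Homology K.d) :=
  ((𝓛 i).submoduleOf (LinearMap.ker K.d)).map (Submodule.mkQ _)

/-- The projection of the homology onto its constituent of degree `i`. -/
def homologyComp (i : ℤ) : Homology K.d →ₗ[F] Homology K.d :=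
  Submodule.mapQ _ _
    ((comp 𝓛 i).restrict (p := LinearMap.ker K.d) (q := LinearMap.ker K.d) fun x hx => by
      rw [LinearMap.mem_ker] at hx ⊢
      rw [d_comp, hx, map_zero]) <| by
    rintro ⟨x, hx⟩ ⟨w, hw⟩
    refine ⟨comp 𝓛 (i + 1) w, ?_⟩
    rw [d_comp, hw]
    simp

instance homologyDecomposition : DirectSum.Decomposition K.homologyGrading :=
  DirectSum.IsInternal.chooseDecomposition _ <| by
    refine isInternal_of_proj K.homologyComp ?_ ?_ ?_
    · rintro i _ ⟨⟨z, hz⟩, hi, rfl⟩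
      refine congrArg Submodule.Quotient.mk (Subtype.ext ?_)
      exact comp_of_mem hi
    · rintro i j hj _ ⟨⟨z, hz⟩, hi, rfl⟩
      refine (congrArg Submodule.Quotient.mk (Subtype.ext ?_)).trans (Submodule.Quotient.mk_zero _)
      exact comp_of_mem_ne hi hj
    · rw [eq_top_iff]
      rintro x -
      obtain ⟨⟨z, hz⟩, rfl⟩ := Submodule.Quotient.mk_surjective _ x
      classical
      have hc : ∀ i, comp 𝓛 i z ∈ LinearMap.ker K.d := fun i => by
        rw [LinearMap.mem_ker, d_comp, LinearMap.mem_ker.mp hz, map_zero]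
      have hsum : (⟨z, hz⟩ : LinearMap.ker K.d) =
          ∑ i ∈ (DirectSum.decompose 𝓛 z).support, ⟨comp 𝓛 i z, hc i⟩ := by
        refine Subtype.ext ?_
        rw [AddSubmonoidClass.coe_finsetSum]
        simp only [comp_eq_decompose]
        exact (DirectSum.sum_support_decompose 𝓛 z).symm
      rw [hsum, ← Submodule.mkQ_apply, map_sum]
      exact Submodule.sum_mem _ fun i _ =>
        Submodule.mem_iSup_of_mem i ⟨⟨_, hc i⟩, by
          show comp 𝓛 i z ∈ 𝓛 i
          rw [comp_eq_decompose]
          exact Subtype.prop _, rfl⟩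

/-- The bracket of two cycles, as a homology class. -/
def cycleBracket : LinearMap.ker K.d →ₗ[F] LinearMap.ker K.d →ₗ[F] Homology K.d :=
  LinearMap.mk₂ F (fun x y => Submodule.Quotient.mk ⟨K.bracket x y, by
      simp [leibniz', LinearMap.mem_ker.mp x.2, LinearMap.mem_ker.mp y.2]⟩)
    (fun x y z => congrArg Submodule.Quotient.mk (Subtype.ext (by simp)))
    (fun a x y => congrArg Submodule.Quotient.mk (Subtype.ext (by simp)))
    (fun x y z => congrArg Submodule.Quotient.mk (Subtype.ext (by simp)))
    (fun a x y => congrArg Submodule.Quotient.mk (Subtype.ext (by simp)))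

/-- The bracket induced on homology: `[[x], [y]] = [[x, y]]`. -/
def homologyBracket : Homology K.d →ₗ[F] Homology K.d →ₗ[F] Homology K.d :=
  (Submodule.liftQ _ (Submodule.liftQ _ K.cycleBracket (by
    rintro ⟨x, hx⟩ ⟨w, hw⟩
    refine LinearMap.ext fun y => ?_
    refine (Submodule.Quotient.mk_eq_zero _).mpr ⟨K.bracket w y, ?_⟩
    rw [leibniz', hw, LinearMap.mem_ker.mp y.2]
    simp)).flip (by
    rintro ⟨y, hy⟩ ⟨w, hw⟩
    refine LinearMap.ext fun x => ?_
    obtain ⟨x, rfl⟩ := Submodule.Quotient.mk_surjective _ x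
    refine (Submodule.Quotient.mk_eq_zero _).mpr ⟨K.bracket (sgn 𝓛 x) w, ?_⟩
    rw [leibniz', hw, d_sgn, LinearMap.mem_ker.mp x.2, sgn_sgn]
    simp)).flip

theorem homologyBracket_mk (x y : LinearMap.ker K.d) :
    K.homologyBracket (Submodule.Quotient.mk x) (Submodule.Quotient.mk y) = K.cycleBracket x y :=
  rfl

/-- The homology Lie algebra `H(K)`, with zero differential. -/
def homologyLie : DGLie K.homologyGrading where
  d := 0
  d_mem i x hx := by simp
  d_d x := by simp
  bracket := K.homologyBracket
  bracket_mem := by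
    rintro i j _ ⟨x, hx, rfl⟩ _ ⟨y, hy, rfl⟩
    exact ⟨_, K.bracket_mem i j _ hx _ hy, rfl⟩
  skew := by
    rintro i j _ ⟨x, hx, rfl⟩ _ ⟨y, hy, rfl⟩
    exact congrArg Submodule.Quotient.mk (Subtype.ext (K.skew i j _ hx _ hy))
  leibniz i x hx y := by simp
  jacobi := by
    rintro i j _ ⟨x, hx, rfl⟩ _ ⟨y, hy, rfl⟩ z
    obtain ⟨z, rfl⟩ := Submodule.Quotient.mk_surjective _ z
    exact congrArg Submodule.Quotient.mk (Subtype.ext (K.jacobi i j _ hx _ hy z))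

end Homology

/-- The differential of the classifying (Cartan-Chevalley-Eilenberg) coalgebra
`C[K] = (S^c[sK], ceDiff)`: the coderivation `D` characterized by `τ D = -d τ + 1/2 [τ, τ]`, where
`τ : S^c[sK] → K` is the universal twisting cochain, i.e. the cogenerating morphism followed by
the desuspension. The summand `-d` is the differential of the suspension. -/
def ceDiff [DirectSum.Decomposition 𝓛] (K : DGLie 𝓛) : GSym (shift 𝓛) →ₗ[F] GSym (shift 𝓛) :=
  GSym.coder (-(K.d ∘ₗ GSym.pr (shift 𝓛)) +
    (2⁻¹ : F) • GSym.cup K.bracket (GSym.pr (shift 𝓛)) (GSym.pr (shift 𝓛)))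

/-- An `L∞`-quasi-isomorphism `K → K'`: a morphism of coaugmented differential graded coalgebras
`C[K] → C[K']` whose linear part `sK → sK'` is a quasi-isomorphism. -/
def IsLInftyQuasiIso {L' : Type*} [AddCommGroup L'] [Module F L'] {𝓛' : ℤ → Submodule F L'}
    [DirectSum.Decomposition 𝓛] [DirectSum.Decomposition 𝓛'] (K : DGLie 𝓛) (K' : DGLie 𝓛')
    (f : GSym (shift 𝓛) →ₗ[F] GSym (shift 𝓛')) : Prop :=
  GSym.IsDGCoalgHom K.ceDiff K'.ceDiff f ∧
    IsQuasiIso (-K.d) (-K'.d) (GSym.pr (shift 𝓛') ∘ₗ f ∘ₗ GSym.ι (shift 𝓛))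

/-- `K` and `K'` are `L∞`-equivalent: there are `L∞`-quasi-isomorphisms in both directions. -/
def LInftyEquivalent {L' : Type*} [AddCommGroup L'] [Module F L'] {𝓛' : ℤ → Submodule F L'}
    [DirectSum.Decomposition 𝓛] [DirectSum.Decomposition 𝓛'] (K : DGLie 𝓛)
    (K' : DGLie 𝓛') : Prop :=
  (∃ f, IsLInftyQuasiIso K K' f) ∧ ∃ g, IsLInftyQuasiIso K' K g

/-- `L` is concentrated in degrees `-1` and `-2`. -/
def Concentrated (𝓛 : ℤ → Submodule F L) : Prop := ∀ i, i ≠ -1 → i ≠ -2 → 𝓛 i = ⊥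

theorem bracket_d_left [DirectSum.Decomposition 𝓛] (K : DGLie 𝓛) (hK : Concentrated 𝓛)
    (w y : L) : K.bracket (K.d w) y = 0 := by
  refine LinearMap.congr_fun (f := K.bracket.flip y ∘ₗ K.d) (g := 0)
    (hom_ext 𝓛 fun i w hw => ?_) w
  refine LinearMap.congr_fun (f := K.bracket (K.d w)) (g := 0) (hom_ext 𝓛 fun j y hy => ?_) y
  have h0 : ∀ n, n ≠ -1 → n ≠ -2 → ∀ u ∈ 𝓛 n, u = 0 := fun n h1 h2 u hu => by
    rw [hK n h1 h2] at hu
    exact (Submodule.mem_bot F).mp hu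
  by_cases hi : i = -1 ∨ i = -2
  · by_cases hj : j = -1 ∨ j = -2
    · exact h0 (i - 1 + j) (by omega) (by omega) _ (K.bracket_mem _ _ _ (K.d_mem _ _ hw) _ hy)
    · simp [h0 j (by omega) (by omega) y hy]
  · simp [h0 i (by omega) (by omega) w hw]

theorem bracket_d_right [DirectSum.Decomposition 𝓛] (K : DGLie 𝓛) (hK : Concentrated 𝓛)
    (x w : L) : K.bracket x (K.d w) = 0 := by
  refine LinearMap.congr_fun (f := K.bracket.flip (K.d w)) (g := 0)
    (hom_ext 𝓛 fun i x hx => ?_) x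
  refine LinearMap.congr_fun (f := K.bracket x ∘ₗ K.d) (g := 0) (hom_ext 𝓛 fun j w hw => ?_) w
  simp [K.skew _ _ x hx _ (K.d_mem _ _ hw), K.bracket_d_left hK]

/-- The differential graded Lie algebra `K_a` associated with a differential graded Lie algebra
`K` concentrated in degrees `-1` and `-2` and a contraction of `K` onto its homology: the chain
complex is that of `K`; relative to the decomposition `K_{-2} = d K_{-1} ⊕ incl H_{-2}(K)`, the
bracket of `K_a` is the component of the bracket of `K` in `d K_{-1}`, and `d h` is the projection
onto that summand. -/
def reduced [DirectSum.Decomposition 𝓛] (K : DGLie 𝓛) (hK : Concentrated 𝓛)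
    (c : Contraction K.homologyGrading 0 𝓛 K.d) : DGLie 𝓛 where
  d := K.d
  d_mem := K.d_mem
  d_d := K.d_d
  bracket := K.bracket.compr₂ (K.d ∘ₗ c.h)
  bracket_mem i j x hx y hy := by
    simpa using K.d_mem _ _ (c.h_mem _ _ (K.bracket_mem i j x hx y hy))
  skew i j x hx y hy := by
    simp only [LinearMap.compr₂_apply]
    rw [K.skew i j x hx y hy, map_neg, map_smul]
  leibniz i x hx y := by
    simp [K.d_d, K.bracket_d_left hK, K.bracket_d_right hK]
  jacobi i j x hx y hy z := by
    simp [K.bracket_d_left hK, K.bracket_d_right hK]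

theorem reduced_bracket [DirectSum.Decomposition 𝓛] (K : DGLie 𝓛) (hK : Concentrated 𝓛)
    (c : Contraction K.homologyGrading 0 𝓛 K.d) (x y : L) :
    (K.reduced hK c).bracket x y = K.bracket x y - c.incl (c.proj (K.bracket x y)) := by
  have h := c.homotopy (K.bracket x y)
  rw [K.leibniz', K.bracket_d_left hK, K.bracket_d_right hK] at h
  simpa [reduced] using h

end DGLie

/-! ## The universal solution of the deformation equation -/

section Universal

variable {H : Type*} [AddCommGroup H] [Module F H] {𝓗 : ℤ → Submodule F H}
  [DirectSum.Decomposition 𝓗] {𝓛 : ℤ → Submodule F L} {d : L →ₗ[F] L}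

/-- The terms `τ^ℓ : S^c[sH] → L`: `τ^1` is the universal twisting cochain of `H` followed by the
inclusion, and `τ^ℓ = 1/2 h ([τ^1, τ^{ℓ-1}] + ⋯ + [τ^{ℓ-1}, τ^1])` for `ℓ ≥ 2`. -/
def tauTerm (c : Contraction 𝓗 0 𝓛 d) (B : L →ₗ[F] L →ₗ[F] L) :
    ℕ → (GSym (shift 𝓗) →ₗ[F] L)
  | 0 => 0
  | 1 => c.incl ∘ₗ GSym.pr (shift 𝓗)
  | ℓ + 2 => (2⁻¹ : F) • c.h ∘ₗ ∑ j : Fin (ℓ + 1),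
      GSym.cup B (tauTerm c B (j + 1)) (tauTerm c B (ℓ + 1 - j))

/-- The twisting cochain `τ = τ^1 + τ^2 + ⋯`, the map `τ^ℓ` being defined on the constituent of
word length `ℓ`. -/
def tau (c : Contraction 𝓗 0 𝓛 d) (B : L →ₗ[F] L →ₗ[F] L) : GSym (shift 𝓗) →ₗ[F] L :=
  GSym.ofLength (shift 𝓗) (tauTerm c B)

/-- The adjoint `S^c[sH] → S^c[sL]` of the twisting cochain `τ`: the morphism of coalgebras
cogenerated by `s τ`. -/
def tauBar (c : Contraction 𝓗 0 𝓛 d) (B : L →ₗ[F] L →ₗ[F] L) :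
    GSym (shift 𝓗) →ₗ[F] GSym (shift 𝓛) :=
  GSym.cohom (shift 𝓛) (tau c B)

/-- The operator `𝒟 = 𝒟^1 + 𝒟^2 + ⋯` on `S^c[sH]`, where `𝒟^{ℓ-1}` is the coderivation that is
cogenerated by `1/2 proj ([τ^1, τ^{ℓ-1}] + ⋯ + [τ^{ℓ-1}, τ^1])` on the constituent of word length
`ℓ`, for `ℓ ≥ 2`. -/
def calD (c : Contraction 𝓗 0 𝓛 d) (B : L →ₗ[F] L →ₗ[F] L) :
    GSym (shift 𝓗) →ₗ[F] GSym (shift 𝓗) :=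
  GSym.coder <| GSym.ofLength (shift 𝓗) fun ℓ =>
    (2⁻¹ : F) • c.proj ∘ₗ ∑ j ∈ Finset.Ioo 0 ℓ, GSym.cup B (tauTerm c B j) (tauTerm c B (ℓ - j))

/-- The map `S^c[proj] : S^c[sL] → S^c[sH]`. -/
def symProj (c : Contraction 𝓗 0 𝓛 d) : GSym (shift 𝓛) →ₗ[F] GSym (shift 𝓗) :=
  (GSym.map c.proj fun i x hx => c.proj_mem (i - 1) x hx).toLinearMap

end Universal

end Lie

end DGL

end

/-!
The symmetric coalgebra is cofree in the category of coaugmented graded coalgebras (`coalgHom_ext`,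
`comp_eq_comp_of_pr`), so that morphisms and coderivations are determined by their corestrictions
to the cogenerators. Here it is the symmetric algebra with letters primitive, and the morphism
cogenerated by `f` is the convolution exponential of `f`; that it is a morphism of coalgebras is the
functional equation of the exponential (`comul_cohom`), and that it is unique rests on the fact that
the exponential of the projection onto the cogenerators is the identity (`cohom_pr`).

Let `K` be a differential graded Lie algebra in degrees `-1` and `-2` with a contraction onto its
homology, and suppose first that `d h` is the identity on all brackets, as it is for the reduced
bracket. The coalgebra map `straighten` cogenerated by `pr - 1/2 h [pr, pr]` is invertible, since its
linear part is the identity, and it carries the differential of the classifying coalgebra to its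
linear part (`straighten_ceDiff`). It also carries the adjoint of `τ` to the map `S[incl]`, which is
the fixed point equation `τ = τ¹ + 1/2 h [τ, τ]` (`tau_eq`, `straighten_tauBar`), and it preserves
`S[proj]` because `proj h = 0`. For the linear differential, the contraction of the cogenerators
extends to one of the symmetric coalgebra (`Contraction.sym`): the derivation extending `h`
has an anticommutator with the differential that multiplies a word by the number of its letters in
the kernel of `proj`, so dividing by that number, where it is not zero, gives the homotopy.
Transport along `straighten` gives the contraction of the classifying coalgebra
(`DGLie.ceContraction`). Since the reduced bracket is zero on homology, formality follows.

For the given bracket, the recursion yields the same `τ`, because it only involves `h` applied to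
brackets, and `h d h = h` (`tau_compr₂`). The identities for `𝒟` hold for degree reasons: a map of
degree `-3` from the symmetric coalgebra, which lives in degrees `≤ 0`, to a space in degrees `-1`
and `-2` is zero (`DGLie.eq_zero_of_degree`).
-/

noncomputable section

namespace DGL

/-! ### Spans of words -/

namespace GSym

section Words

variable {F : Type*} [Field F] {V : Type*} [AddCommGroup V] [Module F V]
  (𝒱 : ℤ → Submodule F V) {σ M : Type*} [AddCommMonoid M]

/-- The span of the words `x₁ ⋯ x_k` of total weight `m`, where the letters of type `i` are the
elements of the subspace `s i`, and have weight `w i`. The grading by degree, the grading by word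
length, and the bigrading coming from a splitting of `V` are all of this form. -/
def wordSpan (s : σ → Submodule F V) (w : σ → M) (m : M) : Submodule F (GSym 𝒱) :=
  Submodule.span F {z | ∃ l : List (σ × V), (∀ p ∈ l, p.2 ∈ s p.1) ∧
    (l.map fun p => w p.1).sum = m ∧ (l.map fun p => ι 𝒱 p.2).prod = z}

/-- The constituent of word length `n`. -/
abbrev length (n : ℕ) : Submodule F (GSym 𝒱) := wordSpan 𝒱 𝒱 (fun _ => 1) n

theorem degree_eq_wordSpan (n : ℤ) : degree 𝒱 n = wordSpan 𝒱 𝒱 id n := rfl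

variable {𝒱} {s : σ → Submodule F V} {w : σ → M}

theorem wordSpan_mono {N : Type*} [AddCommMonoid N] (π : M →+ N) (m : M) :
    wordSpan 𝒱 s w m ≤ wordSpan 𝒱 s (fun i => π (w i)) (π m) := by
  refine Submodule.span_mono ?_
  rintro _ ⟨l, h1, rfl, rfl⟩
  exact ⟨l, h1, by rw [map_list_sum, List.map_map]; rfl, rfl⟩

theorem one_mem_wordSpan : (1 : GSym 𝒱) ∈ wordSpan 𝒱 s w 0 :=
  Submodule.subset_span ⟨[], by simp, by simp, by simp⟩

theorem ι_mul_mem_wordSpan {i : σ} {x : V} (hx : x ∈ s i) {m : M} {c : GSym 𝒱}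
    (hc : c ∈ wordSpan 𝒱 s w m) : ι 𝒱 x * c ∈ wordSpan 𝒱 s w (w i + m) := by
  induction hc using Submodule.span_induction with
  | mem c hc =>
    obtain ⟨l, h1, h2, rfl⟩ := hc
    exact Submodule.subset_span ⟨(i, x) :: l, by simpa [hx] using h1, by simp [h2], by simp⟩
  | zero => simp
  | add a b _ _ ha hb => rw [mul_add]; exact add_mem ha hb
  | smul r a _ ha => rw [mul_smul_comm]; exact Submodule.smul_mem _ _ ha

theorem ι_mem_wordSpan {i : σ} {x : V} (hx : x ∈ s i) : ι 𝒱 x ∈ wordSpan 𝒱 s w (w i) := by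
  have h := ι_mul_mem_wordSpan (𝒱 := 𝒱) (w := w) hx one_mem_wordSpan
  rwa [mul_one, add_zero] at h

/-- Induction on words of given weight. -/
@[elab_as_elim]
theorem wordSpan_induction {P : ∀ m c, c ∈ wordSpan 𝒱 s w m → Prop}
    (one : P 0 1 one_mem_wordSpan)
    (ι_mul : ∀ i x (hx : x ∈ s i) m c (hc : c ∈ wordSpan 𝒱 s w m), P m c hc →
      P (w i + m) (ι 𝒱 x * c) (ι_mul_mem_wordSpan hx hc))
    (zero : ∀ m, P m 0 (zero_mem _))
    (add : ∀ m a b ha hb, P m a ha → P m b hb → P m (a + b) (add_mem ha hb))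
    (smul : ∀ m (r : F) a ha, P m a ha → P m (r • a) (Submodule.smul_mem _ r ha)) {m : M}
    {c : GSym 𝒱} (hc : c ∈ wordSpan 𝒱 s w m) : P m c hc := by
  induction hc using Submodule.span_induction with
  | mem c hc =>
    obtain ⟨l, h1, rfl, rfl⟩ := hc
    induction l with
    | nil => simpa using one
    | cons p l ih =>
      simp only [List.map_cons, List.sum_cons, List.prod_cons]
      exact ι_mul _ _ (h1 p (by simp)) _ _
        (Submodule.subset_span ⟨l, fun q hq => h1 q (by simp [hq]), rfl, rfl⟩)
        (ih fun q hq => h1 q (by simp [hq]))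
  | zero => exact zero m
  | add a b _ _ ha hb => exact add m a b _ _ ha hb
  | smul r a _ ha => exact smul m r a _ ha

theorem mul_mem_wordSpan {m n : M} {a b : GSym 𝒱} (ha : a ∈ wordSpan 𝒱 s w m)
    (hb : b ∈ wordSpan 𝒱 s w n) : a * b ∈ wordSpan 𝒱 s w (m + n) := by
  induction ha using wordSpan_induction with
  | one => simpa using hb
  | ι_mul i x hx m c _ ih =>
    rw [mul_assoc, add_assoc]; exact ι_mul_mem_wordSpan hx ih
  | zero m => simp
  | add m a c _ _ h1 h2 => rw [add_mul]; exact add_mem h1 h2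
  | smul m r a _ h => rw [smul_mul_assoc]; exact Submodule.smul_mem _ _ h

theorem iSup_wordSpan (hs : ⨆ i, s i = ⊤) : ⨆ m, wordSpan 𝒱 s w m = ⊤ := by
  have hι : ∀ x : V, ∀ c ∈ ⨆ m, wordSpan 𝒱 s w m, ι 𝒱 x * c ∈ ⨆ m, wordSpan 𝒱 s w m := by
    intro x c hc
    have hx : x ∈ ⨆ i, s i := hs ▸ Submodule.mem_top
    induction hx using Submodule.iSup_induction' with
    | mem i x hx =>
      induction hc using Submodule.iSup_induction' with
      | mem m c hc => exact Submodule.mem_iSup_of_mem _ (ι_mul_mem_wordSpan hx hc)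
      | zero => simp
      | add a b _ _ ha hb => rw [mul_add]; exact add_mem ha hb
    | zero => simp
    | add a b _ _ ha hb => rw [map_add, add_mul]; exact add_mem ha hb
  rw [eq_top_iff]
  rintro c -
  let q : TensorAlgebra F V →ₐ[F] GSym 𝒱 := RingQuot.mkAlgHom F (GSymRel 𝒱)
  obtain ⟨t, rfl⟩ : ∃ t, q t = c := RingQuot.mkAlgHom_surjective F (GSymRel 𝒱) c
  suffices h : ∀ c ∈ ⨆ m, wordSpan 𝒱 s w m, q t * c ∈ ⨆ m, wordSpan 𝒱 s w m by
    simpa using h 1 (Submodule.mem_iSup_of_mem 0 one_mem_wordSpan)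
  induction t using TensorAlgebra.induction with
  | algebraMap r =>
    intro c hc
    rw [AlgHom.commutes, ← Algebra.smul_def]; exact Submodule.smul_mem _ _ hc
  | ι x => exact hι x
  | mul a b ha hb =>
    intro c hc
    rw [map_mul, mul_assoc]
    exact ha _ (hb _ hc)
  | add a b ha hb =>
    intro c hc
    rw [map_add, add_mul]
    exact add_mem (ha _ hc) (hb _ hc)

/-- Comparison of a grading by weight with a finer one. -/
theorem wordSpan_le_iSup {σ' M' : Type*} [AddCommMonoid M'] {s' : σ' → Submodule F V}
    {w' : σ' → M'} (π : M' →+ M) (h : ∀ i, s i ≤ ⨆ j, ⨆ (_ : π (w' j) = w i), s' j) (m : M) :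
    wordSpan 𝒱 s w m ≤ ⨆ p, ⨆ (_ : π p = m), wordSpan 𝒱 s' w' p := by
  intro c hc
  induction hc using wordSpan_induction with
  | one => exact Submodule.mem_iSup_of_mem 0 (Submodule.mem_iSup_of_mem (map_zero π)
      one_mem_wordSpan)
  | ι_mul i x hx m c _ ih =>
    have h1 : (⨆ p, ⨆ (_ : π p = m), wordSpan 𝒱 s' w' p) ≤
        Submodule.comap (LinearMap.mulLeft F (ι 𝒱 x))
          (⨆ p, ⨆ (_ : π p = w i + m), wordSpan 𝒱 s' w' p) := by
      refine iSup₂_le fun p hp c hc => ?_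
      have h2 : (⨆ j, ⨆ (_ : π (w' j) = w i), s' j) ≤
          Submodule.comap (LinearMap.mulRight F c ∘ₗ ι 𝒱)
            (⨆ p, ⨆ (_ : π p = w i + m), wordSpan 𝒱 s' w' p) :=
        iSup₂_le fun j hj x hx => Submodule.mem_iSup_of_mem (w' j + p)
          (Submodule.mem_iSup_of_mem (by rw [map_add, hj, hp]) (ι_mul_mem_wordSpan hx hc))
      exact h2 (h i hx)
    exact h1 ih
  | zero m => simp
  | add m a b _ _ h1 h2 => exact add_mem h1 h2
  | smul m r a _ h => exact Submodule.smul_mem _ _ h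

/-- Linear maps that agree on all words are equal. -/
theorem wordSpan_hom_ext {W : Type*} [AddCommGroup W] [Module F W] {f g : GSym 𝒱 →ₗ[F] W}
    (hs : ⨆ i, s i = ⊤) (w : σ → M) (h : ∀ m, ∀ c ∈ wordSpan 𝒱 s w m, f c = g c) : f = g := by
  refine LinearMap.ext fun c => ?_
  have hc : c ∈ ⨆ m, wordSpan 𝒱 s w m := iSup_wordSpan (𝒱 := 𝒱) (w := w) hs ▸ Submodule.mem_top
  induction hc using Submodule.iSup_induction' with
  | mem m c hc => exact h m c hc
  | zero => simp
  | add a b _ _ ha hb => rw [map_add, map_add, ha, hb]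

@[simp]
theorem counit_ι (x : V) : counit 𝒱 (ι 𝒱 x) = 0 := by simp [counit]

section

variable [DirectSum.Decomposition 𝒱]

theorem iSup_eq_top : ⨆ i, 𝒱 i = ⊤ :=
  (DirectSum.Decomposition.isInternal 𝒱).submodule_iSup_eq_top

theorem degree_hom_ext {W : Type*} [AddCommGroup W] [Module F W] {f g : GSym 𝒱 →ₗ[F] W}
    (h : ∀ n, ∀ c ∈ degree 𝒱 n, f c = g c) : f = g :=
  wordSpan_hom_ext (s := 𝒱) iSup_eq_top id h

theorem length_hom_ext {W : Type*} [AddCommGroup W] [Module F W] {f g : GSym 𝒱 →ₗ[F] W}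
    (h : ∀ n, ∀ c ∈ length 𝒱 n, f c = g c) : f = g :=
  wordSpan_hom_ext (s := 𝒱) iSup_eq_top _ h

/-- Induction on words in homogeneous letters. -/
@[elab_as_elim]
theorem word_induction {P : GSym 𝒱 → Prop} (one : P 1)
    (ι_mul : ∀ i, ∀ x ∈ 𝒱 i, ∀ c, P c → P (ι 𝒱 x * c))
    (add : ∀ a b, P a → P b → P (a + b)) (smul : ∀ (r : F) a, P a → P (r • a)) (c : GSym 𝒱) :
    P c := by
  have hc : c ∈ ⨆ m, degree 𝒱 m :=
    (iSup_wordSpan (𝒱 := 𝒱) (s := 𝒱) (w := id) iSup_eq_top) ▸ Submodule.mem_top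
  have zero : P 0 := by simpa using smul 0 1 one
  induction hc using Submodule.iSup_induction' with
  | mem m c hc =>
    rw [degree_eq_wordSpan] at hc
    induction hc using wordSpan_induction with
    | one => exact one
    | ι_mul i x hx m c _ ih => exact ι_mul i x hx c ih
    | zero => exact zero
    | add m a b _ _ h1 h2 => exact add _ _ h1 h2
    | smul m r a _ h => exact smul _ _ h
  | zero => exact zero
  | add a b _ _ ha hb => exact add _ _ ha hb

/-- Linear maps out of the symmetric algebra agree if they agree on `1` and if the agreement on
`c` implies that on `x c`. -/
theorem word_hom_ext {W : Type*} [AddCommGroup W] [Module F W] {f g : GSym 𝒱 →ₗ[F] W}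
    (one : f 1 = g 1) (h : ∀ i, ∀ x ∈ 𝒱 i, ∀ c, f c = g c → f (ι 𝒱 x * c) = g (ι 𝒱 x * c)) :
    f = g := by
  refine LinearMap.ext fun c => ?_
  induction c using word_induction with
  | one => exact one
  | ι_mul i x hx c hc => exact h i x hx c hc
  | add a b ha hb => rw [map_add, map_add, ha, hb]
  | smul r a ha => rw [map_smul, map_smul, ha]

/-! ### Parity, counit and projection on words -/

@[simp]
theorem koszul_one (i : ℤ) : koszul 𝒱 i (1 : GSym 𝒱) = 1 := by
  unfold koszul; split_ifs <;> simp

theorem koszul_of_mem {i n : ℤ} {c : GSym 𝒱} (hc : c ∈ degree 𝒱 n) :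
    koszul 𝒱 i c = ((-1 : F) ^ (i * n)) • c := by
  rw [degree_eq_wordSpan] at hc
  induction hc using wordSpan_induction with
  | one => simp
  | ι_mul j x hx m c _ ih =>
    rw [koszul_ι_mul 𝒱 hx, ih, mul_smul_comm, smul_smul, id, mul_add,
      zpow_add₀ (by simp)]
  | zero m => simp
  | add m a b _ _ h1 h2 => rw [map_add, h1, h2, smul_add]
  | smul m r a _ h => rw [map_smul, h, smul_comm]

theorem koszul_of_odd {i : ℤ} (hi : Odd i) : koszul 𝒱 i = (parity 𝒱).toLinearMap := by
  rw [koszul, if_neg (Int.not_even_iff_odd.mpr hi)]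

theorem koszul_of_even {i : ℤ} (hi : Even i) : koszul 𝒱 i = LinearMap.id := by
  rw [koszul, if_pos hi]

theorem parity_of_mem {n : ℤ} {c : GSym 𝒱} (hc : c ∈ degree 𝒱 n) :
    parity 𝒱 c = ((-1 : F) ^ n) • c := by
  have h := koszul_of_mem (i := 1) hc
  rwa [koszul_of_odd odd_one, one_mul] at h

theorem koszul_koszul (i j : ℤ) (c : GSym 𝒱) : koszul 𝒱 i (koszul 𝒱 j c) = koszul 𝒱 (i + j) c := by
  refine LinearMap.congr_fun (f := koszul 𝒱 i ∘ₗ koszul 𝒱 j) (degree_hom_ext fun n c hc => ?_) c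
  rw [LinearMap.comp_apply, koszul_of_mem hc, map_smul, koszul_of_mem hc, koszul_of_mem hc,
    smul_smul, ← zpow_add₀ (by simp), add_mul, add_comm]

theorem koszul_mul (i : ℤ) (a b : GSym 𝒱) :
    koszul 𝒱 i (a * b) = koszul 𝒱 i a * koszul 𝒱 i b := by
  unfold koszul; split_ifs <;> simp

theorem parity_parity (c : GSym 𝒱) : parity 𝒱 (parity 𝒱 c) = c := by
  have h := koszul_koszul (𝒱 := 𝒱) 1 1 c
  rwa [koszul_of_odd odd_one, koszul_of_even ⟨1, rfl⟩] at h

theorem koszul_mem_wordSpan {s : σ → Submodule F V} (hs : ∀ t, ∃ i, s t ≤ 𝒱 i) (i : ℤ) {m : M}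
    {c : GSym 𝒱} (hc : c ∈ wordSpan 𝒱 s w m) : koszul 𝒱 i c ∈ wordSpan 𝒱 s w m := by
  induction hc using wordSpan_induction with
  | one => simpa using one_mem_wordSpan
  | ι_mul j x hx m c _ ih =>
    obtain ⟨k, hk⟩ := hs j
    rw [koszul_ι_mul 𝒱 (hk hx)]
    exact Submodule.smul_mem _ _ (ι_mul_mem_wordSpan hx ih)
  | zero m => simp
  | add m a b _ _ h1 h2 => rw [map_add]; exact add_mem h1 h2
  | smul m r a _ h => rw [map_smul]; exact Submodule.smul_mem _ _ h

/-- Moving a letter past an arbitrary element. -/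
theorem ι_mul_eq {i : ℤ} {x : V} (hx : x ∈ 𝒱 i) (c : GSym 𝒱) :
    ι 𝒱 x * c = koszul 𝒱 i c * ι 𝒱 x := by
  induction c using word_induction with
  | one => simp
  | ι_mul j y hy c ih =>
    rw [koszul_ι_mul 𝒱 hy, ← mul_assoc, ι_mul_ι hx hy, smul_mul_assoc, mul_assoc, ih,
      smul_mul_assoc, mul_assoc]
  | add a b ha hb => rw [mul_add, ha, hb, map_add, add_mul]
  | smul r a ha => rw [mul_smul_comm, ha, map_smul, smul_mul_assoc]

/-- Graded commutativity of the symmetric algebra. -/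
theorem mul_comm_of_mem {i j : ℤ} {a b : GSym 𝒱} (ha : a ∈ degree 𝒱 i) (hb : b ∈ degree 𝒱 j) :
    a * b = ((-1 : F) ^ (i * j)) • (b * a) := by
  suffices h : ∀ b, a * b = koszul 𝒱 i b * a by
    rw [h, koszul_of_mem hb, smul_mul_assoc]
  clear hb b
  rw [degree_eq_wordSpan] at ha
  induction ha using wordSpan_induction with
  | one => simp [koszul_of_even]
  | ι_mul k x hx m c _ ih =>
    intro b
    rw [mul_assoc, ih, ← mul_assoc, ι_mul_eq hx, koszul_koszul, mul_assoc, id]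
  | zero m => simp
  | add m a c _ _ h1 h2 => intro b; rw [add_mul, h1, h2, mul_add]
  | smul m r a _ h => intro b; rw [smul_mul_assoc, h, mul_smul_comm]

@[simp]
theorem counit_koszul (i : ℤ) (c : GSym 𝒱) : counit 𝒱 (koszul 𝒱 i c) = counit 𝒱 c := by
  refine LinearMap.congr_fun (f := (counit 𝒱).toLinearMap ∘ₗ koszul 𝒱 i)
    (g := (counit 𝒱).toLinearMap) (word_hom_ext (by simp) fun j x hx c _ => ?_) c
  simp [koszul_ι_mul 𝒱 hx]

end

@[simp]
theorem pr_one : pr 𝒱 1 = 0 := by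
  let _ : Module Fᵐᵒᵖ V := Module.compHom _ ((RingHom.id F).fromOpposite mul_comm)
  have : IsCentralScalar F V := ⟨fun _ _ => rfl⟩
  simp [pr]

@[simp]
theorem pr_ι (x : V) : pr 𝒱 (ι 𝒱 x) = x := by simp [pr]

theorem pr_mul (a b : GSym 𝒱) : pr 𝒱 (a * b) = counit 𝒱 a • pr 𝒱 b + counit 𝒱 b • pr 𝒱 a := by
  let _ : Module Fᵐᵒᵖ V := Module.compHom _ ((RingHom.id F).fromOpposite mul_comm)
  have : IsCentralScalar F V := ⟨fun _ _ => rfl⟩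
  have h : (TrivSqZeroExt.fstHom F F V).comp (lift (𝒱 := 𝒱) (TrivSqZeroExt.inrHom F V)
    fun i j x _ y _ => by simp [TrivSqZeroExt.inr_mul_inr]) = counit 𝒱 :=
    algHom_ext fun x => by simp [counit]
  have h' : ∀ c, _ = counit 𝒱 c := AlgHom.congr_fun h
  simp only [AlgHom.comp_apply, TrivSqZeroExt.fstHom_apply] at h'
  simp [pr, TrivSqZeroExt.snd_mul, h']

@[simp]
theorem pr_ι_mul (x : V) (c : GSym 𝒱) : pr 𝒱 (ι 𝒱 x * c) = counit 𝒱 c • x := by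
  simp [pr_mul]

end Words

section Coalgebra

variable {F : Type*} [Field F] {V : Type*} [AddCommGroup V] [Module F V]
  {𝒱 : ℤ → Submodule F V} [DirectSum.Decomposition 𝒱]

/-! ### The coalgebra structure -/

theorem comul_koszul (i : ℤ) (c : GSym 𝒱) :
    comul 𝒱 (koszul 𝒱 i c) = TensorProduct.map (koszul 𝒱 i) (koszul 𝒱 i) (comul 𝒱 c) := by
  refine LinearMap.congr_fun (f := comul 𝒱 ∘ₗ koszul 𝒱 i)
    (g := TensorProduct.map (koszul 𝒱 i) (koszul 𝒱 i) ∘ₗ comul 𝒱)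
    (word_hom_ext (by simp [comul_one]) fun j x hx c hc => ?_) c
  simp only [LinearMap.comp_apply] at hc ⊢
  rw [koszul_ι_mul 𝒱 hx, map_smul, comul_ι_mul 𝒱 hx, comul_ι_mul 𝒱 hx, hc]
  generalize comul 𝒱 c = t
  induction t with
  | zero => simp
  | tmul a b =>
    simp only [TensorProduct.map_tmul, primMul_tmul, map_add, koszul_ι_mul 𝒱 hx, smul_add,
      TensorProduct.smul_tmul', TensorProduct.tmul_smul, koszul_koszul, add_comm i j]
  | add a b ha hb => simp only [map_add, smul_add, ha, hb]

instance : CoalgebraStruct F (GSym 𝒱) where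
  comul := comul 𝒱
  counit := (counit 𝒱).toLinearMap

/-- Coassociativity of the diagonal map, with the signs of the graded tensor product absorbed in
the definition of the diagonal. -/
theorem coassoc_apply (c : GSym 𝒱) :
    TensorProduct.assoc F _ _ _ ((comul 𝒱).rTensor _ (comul 𝒱 c)) =
      (comul 𝒱).lTensor _ (comul 𝒱 c) := by
  refine LinearMap.congr_fun
    (f := (TensorProduct.assoc F _ _ _).toLinearMap ∘ₗ (comul 𝒱).rTensor _ ∘ₗ comul 𝒱)
    (g := (comul 𝒱).lTensor _ ∘ₗ comul 𝒱)
    (word_hom_ext (by simp [comul_one]) fun i x hx c hc => ?_) c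
  simp only [LinearMap.comp_apply, LinearEquiv.coe_coe] at hc ⊢
  -- both sides intertwine multiplication by `x` with the threefold diagonal multiplication
  let M : Module.End F (GSym 𝒱 ⊗[F] (GSym 𝒱 ⊗[F] GSym 𝒱)) :=
    TensorProduct.map (LinearMap.mulLeft F (ι 𝒱 x)) LinearMap.id +
      TensorProduct.map (koszul 𝒱 i) (primMul 𝒱 i x)
  have hl : ∀ t : GSym 𝒱 ⊗[F] GSym 𝒱,
      TensorProduct.assoc F _ _ _ ((comul 𝒱).rTensor _ (primMul 𝒱 i x t)) =
        M (TensorProduct.assoc F _ _ _ ((comul 𝒱).rTensor _ t)) := by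
    intro t
    induction t with
    | zero => simp
    | tmul a b =>
      simp only [primMul_tmul, map_add, LinearMap.rTensor_tmul, comul_ι_mul 𝒱 hx, comul_koszul]
      generalize comul 𝒱 a = t
      induction t with
      | zero => simp
      | tmul p q => simp [M, TensorProduct.add_tmul, TensorProduct.tmul_add, add_assoc]
      | add p q hp hq =>
        simp only [map_add, TensorProduct.add_tmul] at hp hq ⊢
        rw [← hp, ← hq]; abel
    | add p q hp hq => simp only [map_add, hp, hq]
  have hr : ∀ t : GSym 𝒱 ⊗[F] GSym 𝒱,
      (comul 𝒱).lTensor _ (primMul 𝒱 i x t) = M ((comul 𝒱).lTensor _ t) := by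
    intro t
    induction t with
    | zero => simp
    | tmul a b => simp [M, comul_ι_mul 𝒱 hx]
    | add p q hp hq => simp only [map_add, hp, hq]
  rw [comul_ι_mul 𝒱 hx, hl, hr, hc]

instance : Coalgebra F (GSym 𝒱) where
  coassoc := LinearMap.ext coassoc_apply
  rTensor_counit_comp_comul := by
    refine word_hom_ext (by simp [CoalgebraStruct.counit, CoalgebraStruct.comul, comul_one])
      fun i x hx c hc => ?_
    simp only [CoalgebraStruct.counit, CoalgebraStruct.comul, LinearMap.comp_apply] at hc ⊢
    have h : ∀ t : GSym 𝒱 ⊗[F] GSym 𝒱,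
        (counit 𝒱).toLinearMap.rTensor _ (primMul 𝒱 i x t) =
          (LinearMap.mulLeft F (ι 𝒱 x)).lTensor _ ((counit 𝒱).toLinearMap.rTensor _ t) := by
      intro t
      induction t with
      | zero => simp
      | tmul a b => simp
      | add p q hp hq => simp only [map_add, hp, hq]
    rw [comul_ι_mul 𝒱 hx, h, hc]
    simp
  lTensor_counit_comp_comul := by
    refine word_hom_ext (by simp [CoalgebraStruct.counit, CoalgebraStruct.comul, comul_one])
      fun i x hx c hc => ?_
    simp only [CoalgebraStruct.counit, CoalgebraStruct.comul, LinearMap.comp_apply] at hc ⊢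
    have h : ∀ t : GSym 𝒱 ⊗[F] GSym 𝒱,
        (counit 𝒱).toLinearMap.lTensor _ (primMul 𝒱 i x t) =
          (LinearMap.mulLeft F (ι 𝒱 x)).rTensor _ ((counit 𝒱).toLinearMap.lTensor _ t) := by
      intro t
      induction t with
      | zero => simp
      | tmul a b => simp
      | add p q hp hq => simp only [map_add, hp, hq]
    rw [comul_ι_mul 𝒱 hx, h, hc]
    simp

section Words

variable {σ M : Type*} [AddCommMonoid M] {s : σ → Submodule F V} {w : σ → M}
  {W : Type*} [AddCommGroup W] [Module F W]

/-- The diagonal map is compatible with gradings by weight. -/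
theorem comul_mem_of_wordSpan (hs : ∀ t, ∃ i, s t ≤ 𝒱 i) {m : M} {c : GSym 𝒱}
    (hc : c ∈ wordSpan 𝒱 s w m) : comul 𝒱 c ∈ Submodule.span F {t | ∃ j k, j + k = m ∧
      ∃ a ∈ wordSpan 𝒱 s w j, ∃ b ∈ wordSpan 𝒱 s w k, a ⊗ₜ[F] b = t} := by
  induction hc using wordSpan_induction with
  | one =>
    rw [comul_one]
    exact Submodule.subset_span
      ⟨0, 0, add_zero 0, 1, one_mem_wordSpan, 1, one_mem_wordSpan, rfl⟩
  | ι_mul i x hx m c _ ih =>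
    obtain ⟨n, hn⟩ := hs i
    rw [comul_ι_mul 𝒱 (hn hx)]
    generalize comul 𝒱 c = t at ih
    induction ih using Submodule.span_induction with
    | mem t ht =>
      obtain ⟨j, k, rfl, a, ha, b, hb, rfl⟩ := ht
      rw [primMul_tmul]
      exact add_mem
        (Submodule.subset_span ⟨w i + j, k, add_assoc _ _ _, _, ι_mul_mem_wordSpan hx ha, b, hb,
          rfl⟩)
        (Submodule.subset_span ⟨j, w i + k, add_left_comm _ _ _, _,
          koszul_mem_wordSpan hs n ha, _, ι_mul_mem_wordSpan hx hb, rfl⟩)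
    | zero => simp
    | add p q _ _ hp hq => rw [map_add]; exact add_mem hp hq
    | smul r p _ hp => rw [map_smul]; exact Submodule.smul_mem _ _ hp
  | zero m => simp
  | add m a b _ _ h1 h2 => rw [map_add]; exact add_mem h1 h2
  | smul m r a _ h => rw [map_smul]; exact Submodule.smul_mem _ _ h

/-- To check that `G (Δ c)` lies in `N`, it suffices to consider the terms `a ⊗ b` whose weights add
up to that of `c`. -/
theorem comul_induction (hs : ∀ t, ∃ i, s t ≤ 𝒱 i) {m : M} {c : GSym 𝒱}
    (hc : c ∈ wordSpan 𝒱 s w m) {G : GSym 𝒱 ⊗[F] GSym 𝒱 →ₗ[F] W} {N : Submodule F W}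
    (h : ∀ j k, j + k = m → ∀ a ∈ wordSpan 𝒱 s w j, ∀ b ∈ wordSpan 𝒱 s w k, G (a ⊗ₜ b) ∈ N) :
    G (comul 𝒱 c) ∈ N := by
  have hm := comul_mem_of_wordSpan hs hc
  rw [← Submodule.mem_comap]
  refine Submodule.span_le.mpr ?_ hm
  rintro _ ⟨j, k, e, a, ha, b, hb, rfl⟩
  exact h j k e a ha b hb

theorem comul_congr (hs : ∀ t, ∃ i, s t ≤ 𝒱 i) {m : M} {c : GSym 𝒱}
    (hc : c ∈ wordSpan 𝒱 s w m) {G H : GSym 𝒱 ⊗[F] GSym 𝒱 →ₗ[F] W}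
    (h : ∀ j k, j + k = m → ∀ a ∈ wordSpan 𝒱 s w j, ∀ b ∈ wordSpan 𝒱 s w k,
      G (a ⊗ₜ b) = H (a ⊗ₜ b)) :
    G (comul 𝒱 c) = H (comul 𝒱 c) := by
  have := comul_induction hs hc (G := G - H) (N := ⊥) fun j k e a ha b hb => by
    simp [h j k e a ha b hb]
  simpa [sub_eq_zero] using this

theorem comul_induction_degree {m : ℤ} {c : GSym 𝒱}
    (hc : c ∈ degree 𝒱 m) {G : GSym 𝒱 ⊗[F] GSym 𝒱 →ₗ[F] W} {N : Submodule F W}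
    (h : ∀ j k, j + k = m → ∀ a ∈ degree 𝒱 j, ∀ b ∈ degree 𝒱 k, G (a ⊗ₜ b) ∈ N) :
    G (comul 𝒱 c) ∈ N :=
  comul_induction (s := 𝒱) (w := id) (fun t => ⟨t, le_rfl⟩) hc h

theorem comul_congr_length {m : ℕ} {c : GSym 𝒱}
    (hc : c ∈ length 𝒱 m) {G H : GSym 𝒱 ⊗[F] GSym 𝒱 →ₗ[F] W}
    (h : ∀ j k, j + k = m → ∀ a ∈ length 𝒱 j, ∀ b ∈ length 𝒱 k, G (a ⊗ₜ b) = H (a ⊗ₜ b)) :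
    G (comul 𝒱 c) = H (comul 𝒱 c) :=
  comul_congr (fun t => ⟨t, le_rfl⟩) hc h

theorem tmul_degree_hom_ext {G H : GSym 𝒱 ⊗[F] GSym 𝒱 →ₗ[F] W}
    (h : ∀ j k, ∀ a ∈ degree 𝒱 j, ∀ b ∈ degree 𝒱 k, G (a ⊗ₜ b) = H (a ⊗ₜ b)) : G = H :=
  TensorProduct.ext <| degree_hom_ext fun j a ha => degree_hom_ext fun k b hb => h j k a ha b hb

end Words

/-! ### Graded cocommutativity -/

/-- Twice the interchange map `a ⊗ b ↦ (-1)^{|a||b|} b ⊗ a` of the graded tensor product, in terms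
of the parity automorphism. -/
def twoSwap (𝒱 : ℤ → Submodule F V) [DirectSum.Decomposition 𝒱] :
    GSym 𝒱 ⊗[F] GSym 𝒱 →ₗ[F] GSym 𝒱 ⊗[F] GSym 𝒱 :=
  (LinearMap.id + TensorProduct.map LinearMap.id (parity 𝒱).toLinearMap +
    TensorProduct.map (parity 𝒱).toLinearMap LinearMap.id -
    TensorProduct.map (parity 𝒱).toLinearMap (parity 𝒱).toLinearMap) ∘ₗ
      (TensorProduct.comm F (GSym 𝒱) (GSym 𝒱)).toLinearMap

theorem twoSwap_tmul (a b : GSym 𝒱) : twoSwap 𝒱 (a ⊗ₜ b) =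
    b ⊗ₜ a + b ⊗ₜ parity 𝒱 a + parity 𝒱 b ⊗ₜ a - parity 𝒱 b ⊗ₜ parity 𝒱 a := by
  simp [twoSwap]

theorem twoSwap_of_mem {i j : ℤ} {a b : GSym 𝒱} (ha : a ∈ degree 𝒱 i) (hb : b ∈ degree 𝒱 j) :
    twoSwap 𝒱 (a ⊗ₜ b) = (2 * (-1 : F) ^ (i * j)) • (b ⊗ₜ a) := by
  rw [twoSwap_tmul, parity_of_mem ha, parity_of_mem hb]
  have : (1 : F) + (-1) ^ i + (-1) ^ j - (-1) ^ i * (-1) ^ j = 2 * (-1 : F) ^ (i * j) := by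
    rcases Int.even_or_odd i with hi | hi
    · rw [hi.neg_one_zpow, (hi.mul_right j).neg_one_zpow]; ring
    · rcases Int.even_or_odd j with hj | hj
      · rw [hi.neg_one_zpow, hj.neg_one_zpow, (hj.mul_left i).neg_one_zpow]; ring
      · rw [hi.neg_one_zpow, hj.neg_one_zpow, (hi.mul hj).neg_one_zpow]; ring
  rw [← this]
  simp only [← TensorProduct.smul_tmul', TensorProduct.tmul_smul, smul_smul, sub_smul, add_smul,
    one_smul]

/-- Graded cocommutativity of the diagonal map. -/
theorem twoSwap_comul (c : GSym 𝒱) : twoSwap 𝒱 (comul 𝒱 c) = (2 : F) • comul 𝒱 c := by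
  refine LinearMap.congr_fun (f := twoSwap 𝒱 ∘ₗ comul 𝒱) (g := (2 : F) • comul 𝒱)
    (word_hom_ext ?_ fun i x hx c hc => ?_) c
  · simp [comul_one, twoSwap_tmul, two_smul]
  · simp only [LinearMap.comp_apply, LinearMap.smul_apply] at hc ⊢
    rw [comul_ι_mul 𝒱 hx, ← map_smul, ← hc]
    refine LinearMap.congr_fun (f := twoSwap 𝒱 ∘ₗ primMul 𝒱 i x)
      (g := primMul 𝒱 i x ∘ₗ twoSwap 𝒱) (tmul_degree_hom_ext fun j k a ha b hb => ?_) _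
    have hxa : ι 𝒱 x * a ∈ degree 𝒱 (i + j) := ι_mul_mem_wordSpan (w := id) hx ha
    have hxb : ι 𝒱 x * b ∈ degree 𝒱 (i + k) := ι_mul_mem_wordSpan (w := id) hx hb
    have e : (-1 : F) ^ (i * j) * (-1) ^ (i * j) = 1 := by rw [← mul_zpow]; simp
    simp only [LinearMap.comp_apply, primMul_tmul, map_add, koszul_of_mem ha, map_smul,
      ← TensorProduct.smul_tmul', twoSwap_of_mem hxa hb, twoSwap_of_mem ha hxb,
      twoSwap_of_mem ha hb, koszul_of_mem hb, smul_add, smul_smul]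
    rw [add_comm]
    congr 2
    · rw [mul_left_comm, mul_add, zpow_add₀ (by simp), mul_comm j i, ← mul_assoc ((-1 : F) ^ _),
        e, one_mul]
    · rw [add_mul, zpow_add₀ (by simp)]; ring

variable [CharZero F]

/-- Graded commutativity of the convolution product: a consequence of the graded cocommutativity
of the symmetric coalgebra. -/
theorem conv_comm_of {A : Type*} [Ring A] [Algebra F A] {u v u' v' : GSym 𝒱 →ₗ[F] A}
    (h : ∀ i j, ∀ a ∈ degree 𝒱 i, ∀ b ∈ degree 𝒱 j,
      u a * v b = ((-1 : F) ^ (i * j)) • (v' b * u' a)) : conv u v = conv v' u' := by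
  have h2 : (2 : F) • (LinearMap.mul' F A ∘ₗ TensorProduct.map u v) =
      LinearMap.mul' F A ∘ₗ TensorProduct.map v' u' ∘ₗ twoSwap 𝒱 :=
    tmul_degree_hom_ext fun j k a ha b hb => by
      simp [twoSwap_of_mem ha hb, h j k a ha b hb, smul_smul]
  refine LinearMap.ext fun c => ?_
  have h3 := LinearMap.congr_fun h2 (comul 𝒱 c)
  simp only [LinearMap.comp_apply, LinearMap.smul_apply, twoSwap_comul, map_smul] at h3
  exact (smul_right_injective A (two_ne_zero (α := F))) h3

end Coalgebra

section Cofree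

open WithConv

variable {F : Type*} [Field F] {V : Type*} [AddCommGroup V] [Module F V]

/-! ### The two embeddings into the graded tensor product -/

section

variable (𝒱 : ℤ → Submodule F V)

/-- The action of the first tensor factor on the graded tensor product. -/
def leftAction : GSym 𝒱 →ₐ[F] Module.End F (GSym 𝒱 ⊗[F] GSym 𝒱) :=
  (Module.End.rTensorAlgHom F (GSym 𝒱) (GSym 𝒱)).comp (Algebra.lmul F (GSym 𝒱))

@[simp]
theorem leftAction_tmul (c a b : GSym 𝒱) : leftAction 𝒱 c (a ⊗ₜ b) = (c * a) ⊗ₜ b := rfl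

end

variable {𝒱 : ℤ → Submodule F V} [DirectSum.Decomposition 𝒱]
  {A : Type*} [Ring A] [Algebra F A]

/-! ### Convolution -/

theorem conv_eq_ofConv (a b : GSym 𝒱 →ₗ[F] A) : conv a b = (toConv a * toConv b).ofConv := rfl

theorem conv_assoc (a b c : GSym 𝒱 →ₗ[F] A) : conv (conv a b) c = conv a (conv b c) :=
  congrArg ofConv (mul_assoc (toConv a) (toConv b) (toConv c))

theorem conv_add_left (a b c : GSym 𝒱 →ₗ[F] A) : conv (a + b) c = conv a c + conv b c :=
  congrArg ofConv (add_mul (toConv a) (toConv b) (toConv c))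

theorem convPow_eq_ofConv (a : GSym 𝒱 →ₗ[F] A) (n : ℕ) : convPow a n = (toConv a ^ n).ofConv := by
  induction n with
  | zero => rfl
  | succ n ih => rw [pow_succ', convPow, ih]; rfl

theorem algHom_comp_conv {B : Type*} [Ring B] [Algebra F B] (φ : A →ₐ[F] B)
    (a b : GSym 𝒱 →ₗ[F] A) :
    φ.toLinearMap ∘ₗ conv a b = conv (φ.toLinearMap ∘ₗ a) (φ.toLinearMap ∘ₗ b) :=
  LinearMap.algHom_comp_convMul_distrib φ (toConv a) (toConv b)

theorem algHom_comp_convPow {B : Type*} [Ring B] [Algebra F B] (φ : A →ₐ[F] B)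
    (a : GSym 𝒱 →ₗ[F] A) (n : ℕ) :
    φ.toLinearMap ∘ₗ convPow a n = convPow (φ.toLinearMap ∘ₗ a) n := by
  induction n with
  | zero => ext; simp [convPow]
  | succ n ih => rw [convPow, algHom_comp_conv, ih]; rfl

theorem unit_conv (a b : GSym 𝒱 →ₗ[F] A) : conv (convPow b 0) a = a :=
  congrArg ofConv (one_mul (toConv a))

theorem conv_unit (a b : GSym 𝒱 →ₗ[F] A) : conv a (convPow b 0) = a :=
  congrArg ofConv (mul_one (toConv a))

/-- Left multiplication by `1 ⊗ x` on the graded tensor product, for `x` of degree `i`. -/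
def rightMul (𝒱 : ℤ → Submodule F V) [DirectSum.Decomposition 𝒱] (i : ℤ) :
    V →ₗ[F] Module.End F (GSym 𝒱 ⊗[F] GSym 𝒱) :=
  TensorProduct.mapBilinear (.id F) (GSym 𝒱) (GSym 𝒱) (GSym 𝒱) (GSym 𝒱) (koszul 𝒱 i) ∘ₗ
    LinearMap.mul F (GSym 𝒱) ∘ₗ ι 𝒱

@[simp]
theorem rightMul_tmul (i : ℤ) (x : V) (a b : GSym 𝒱) :
    rightMul 𝒱 i x (a ⊗ₜ b) = koszul 𝒱 i a ⊗ₜ (ι 𝒱 x * b) := rfl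

variable (𝒱) in
/-- The action of the second tensor factor on the graded tensor product. -/
def rightAction : GSym 𝒱 →ₐ[F] Module.End F (GSym 𝒱 ⊗[F] GSym 𝒱) :=
  lift (ofDegree 𝒱 (rightMul 𝒱)) fun i j x hx y hy => by
    rw [ofDegree_of_mem _ hx, ofDegree_of_mem _ hy]
    refine TensorProduct.ext' fun a b => ?_
    simp only [Module.End.mul_apply, rightMul_tmul, LinearMap.smul_apply, koszul_koszul,
      ← TensorProduct.tmul_smul, ← mul_assoc, ι_mul_ι hx hy, smul_mul_assoc, add_comm i j]

theorem rightAction_ι {i : ℤ} {x : V} (hx : x ∈ 𝒱 i) :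
    rightAction 𝒱 (ι 𝒱 x) = rightMul 𝒱 i x := by
  simp [rightAction, ofDegree_of_mem _ hx]

theorem rightAction_one_tmul (c b : GSym 𝒱) : rightAction 𝒱 c (1 ⊗ₜ b) = 1 ⊗ₜ (c * b) := by
  induction c using word_induction with
  | one => simp
  | ι_mul i x hx c ih => simp [rightAction_ι hx, ih, mul_assoc]
  | add a b ha hb => simp [ha, hb, add_mul, TensorProduct.tmul_add]
  | smul r a ha => simp [ha]

theorem comulAction_ι (x : V) :
    comulAction 𝒱 (ι 𝒱 x) = leftAction 𝒱 (ι 𝒱 x) + rightAction 𝒱 (ι 𝒱 x) := by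
  refine LinearMap.congr_fun (f := (comulAction 𝒱).toLinearMap ∘ₗ ι 𝒱)
    (g := ((leftAction 𝒱).toLinearMap + (rightAction 𝒱).toLinearMap) ∘ₗ ι 𝒱)
    (hom_ext 𝒱 fun i x hx => TensorProduct.ext' fun a b => ?_) x
  simp [comulAction, ofDegree_of_mem _ hx, rightAction_ι hx]

theorem rightAction_ι_mul_leftAction {i : ℤ} {x : V} (hx : x ∈ 𝒱 i) (b : GSym 𝒱) :
    rightAction 𝒱 (ι 𝒱 x) * leftAction 𝒱 b =
      leftAction 𝒱 (koszul 𝒱 i b) * rightAction 𝒱 (ι 𝒱 x) := by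
  rw [rightAction_ι hx]
  refine TensorProduct.ext' fun p q => ?_
  simp only [Module.End.mul_apply, leftAction_tmul, rightMul_tmul, koszul_mul]

/-- Elements of the two tensor factors commute in the graded sense. -/
theorem rightAction_mul_leftAction {i j : ℤ} {a b : GSym 𝒱} (ha : a ∈ degree 𝒱 i)
    (hb : b ∈ degree 𝒱 j) : rightAction 𝒱 a * leftAction 𝒱 b =
      ((-1 : F) ^ (i * j)) • (leftAction 𝒱 b * rightAction 𝒱 a) := by
  suffices h : ∀ b, rightAction 𝒱 a * leftAction 𝒱 b =
      leftAction 𝒱 (koszul 𝒱 i b) * rightAction 𝒱 a by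
    rw [h, koszul_of_mem hb, map_smul, smul_mul_assoc]
  clear hb b
  rw [degree_eq_wordSpan] at ha
  induction ha using wordSpan_induction with
  | one => simp [koszul_of_even]
  | ι_mul k x hx m c _ ih =>
    intro b
    rw [map_mul, mul_assoc, ih, ← mul_assoc, rightAction_ι_mul_leftAction hx, koszul_koszul,
      mul_assoc, id]
  | zero m => simp
  | add m a c _ _ h1 h2 => intro b; rw [map_add, add_mul, h1, h2, mul_add]
  | smul m r a _ h => intro b; rw [map_smul, smul_mul_assoc, h, mul_smul_comm]

/-- The action of the diagonal is the convolution of the actions of the two tensor factors. -/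
theorem comulAction_eq_conv : (comulAction 𝒱).toLinearMap =
    conv (leftAction 𝒱).toLinearMap (rightAction 𝒱).toLinearMap := by
  refine word_hom_ext (by simp [conv, comul_one]) fun i x hx c hc => ?_
  simp only [conv, LinearMap.comp_apply, AlgHom.toLinearMap_apply] at hc ⊢
  rw [comul_ι_mul 𝒱 hx, map_mul, hc, comulAction_ι]
  generalize comul 𝒱 c = t
  induction t with
  | zero => simp
  | tmul a b =>
    simp only [primMul_tmul, map_add, TensorProduct.map_tmul, AlgHom.toLinearMap_apply, map_mul,
      LinearMap.mul'_apply, add_mul, mul_assoc]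
    rw [← mul_assoc (rightAction 𝒱 (ι 𝒱 x)), rightAction_ι_mul_leftAction hx, mul_assoc]
  | add a b ha hb => simp only [map_add, mul_add, ha, hb]

section

variable {W : Type*} [AddCommGroup W] [Module F W] {𝒲 : ℤ → Submodule F W}
  [DirectSum.Decomposition 𝒲]

/-- Evaluation at `1 ⊗ 1` of the convolution of maps into the two tensor factors. -/
theorem conv_leftAction_rightAction (f g : GSym 𝒱 →ₗ[F] GSym 𝒲) (c : GSym 𝒱) :
    conv ((leftAction 𝒲).toLinearMap ∘ₗ f) ((rightAction 𝒲).toLinearMap ∘ₗ g) c (1 ⊗ₜ 1) =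
      TensorProduct.map f g (comul 𝒱 c) := by
  simp only [conv, LinearMap.comp_apply]
  generalize comul 𝒱 c = t
  induction t with
  | zero => simp
  | tmul a b => simp [rightAction_one_tmul]
  | add a b ha hb => simp only [map_add, LinearMap.add_apply, ha, hb]

end

/-! ### Coderivations -/

theorem conv_mem_degree {W : Type*} [AddCommGroup W] [Module F W] {𝒲 : ℤ → Submodule F W}
    {m e e' : ℤ} {f g : GSym 𝒱 →ₗ[F] GSym 𝒲}
    (hf : ∀ n, ∀ c ∈ degree 𝒱 n, f c ∈ degree 𝒲 (n + e))
    (hg : ∀ n, ∀ c ∈ degree 𝒱 n, g c ∈ degree 𝒲 (n + e')) {c : GSym 𝒱} (hc : c ∈ degree 𝒱 m) :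
    conv f g c ∈ degree 𝒲 (m + (e + e')) := by
  refine comul_induction_degree hc (G := LinearMap.mul' F _ ∘ₗ TensorProduct.map f g)
    fun j k h a ha b hb => ?_
  have := mul_mem_wordSpan (w := id) (hf j a ha) (hg k b hb)
  rwa [show j + e + (k + e') = m + (e + e') by omega] at this

theorem coder_mem_degree {f : GSym 𝒱 →ₗ[F] V} {e : ℤ}
    (hf : ∀ n, ∀ c ∈ degree 𝒱 n, f c ∈ 𝒱 (n + e)) {n : ℤ} {c : GSym 𝒱} (hc : c ∈ degree 𝒱 n) :
    coder f c ∈ degree 𝒱 (n + e) := by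
  have := conv_mem_degree (f := ι 𝒱 ∘ₗ f) (g := LinearMap.id) (e := e) (e' := 0)
    (fun n c hc => ι_mem_wordSpan (w := id) (hf n c hc)) (fun n c hc => by simpa using hc) hc
  rwa [add_zero] at this

theorem coder_one {f : GSym 𝒱 →ₗ[F] V} (hf : f 1 = 0) : coder f 1 = 0 := by
  simp [coder, conv, comul_one, hf]

theorem counit_coder (f : GSym 𝒱 →ₗ[F] V) (c : GSym 𝒱) : counit 𝒱 (coder f c) = 0 := by
  rw [coder]
  refine (LinearMap.congr_fun (algHom_comp_conv (counit 𝒱) _ _) c).trans ?_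
  have : (counit 𝒱).toLinearMap ∘ₗ ι 𝒱 ∘ₗ f = 0 := LinearMap.ext fun c => counit_ι _
  rw [this]
  simp [conv]

theorem pr_coder (f : GSym 𝒱 →ₗ[F] V) (c : GSym 𝒱) : pr 𝒱 (coder f c) = f c := by
  have h : pr 𝒱 ∘ₗ LinearMap.mul' F (GSym 𝒱) ∘ₗ TensorProduct.map (ι 𝒱 ∘ₗ f) LinearMap.id =
      (TensorProduct.rid F V).toLinearMap ∘ₗ TensorProduct.map f (counit 𝒱).toLinearMap :=
    TensorProduct.ext' fun a b => by simp
  have h2 := Coalgebra.lTensor_counit_comul (R := F) c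
  change pr 𝒱 (LinearMap.mul' F (GSym 𝒱) (TensorProduct.map (ι 𝒱 ∘ₗ f) LinearMap.id _)) = _
  refine (LinearMap.congr_fun h (comul 𝒱 c)).trans ?_
  rw [← LinearMap.rTensor_comp_lTensor]
  exact (congrArg (fun t => TensorProduct.rid F V (f.rTensor F t)) h2).trans (by simp)

variable [CharZero F]

/-- `coder f` is a coderivation of degree `-1`. Acting on `S ⊗ S`, the diagonal `α` is the convolution
`λ * ρ` of the actions of the two factors, and `α ι = λ ι + ρ ι`. Hence `α (coder f)`, which is
`(α ι f) * α`, is the sum of `(λ ι f) * λ * ρ` and `(ρ ι f) * λ * ρ`; in the second summand `ρ ι f` is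
moved past `λ` by graded cocommutativity. -/
theorem comul_coder {f : GSym 𝒱 →ₗ[F] V} (hf : ∀ n, ∀ c ∈ degree 𝒱 n, f c ∈ 𝒱 (n - 1)) :
    comul 𝒱 ∘ₗ coder f = (TensorProduct.map (coder f) LinearMap.id +
      TensorProduct.map (parity 𝒱).toLinearMap (coder f)) ∘ₗ comul 𝒱 := by
  have hl : conv ((rightAction 𝒱).toLinearMap ∘ₗ ι 𝒱 ∘ₗ f) (leftAction 𝒱).toLinearMap =
      conv ((leftAction 𝒱).toLinearMap ∘ₗ (parity 𝒱).toLinearMap)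
        ((rightAction 𝒱).toLinearMap ∘ₗ ι 𝒱 ∘ₗ f) := by
    refine conv_comm_of fun i j a ha b hb => ?_
    simp only [LinearMap.comp_apply, AlgHom.toLinearMap_apply]
    rw [rightAction_mul_leftAction (i := i - 1) (ι_mem_wordSpan (w := id) (hf i a ha)) hb,
      parity_of_mem hb, map_smul, smul_mul_assoc, smul_smul, ← zpow_add₀ (by simp),
      show i * j + j = (i - 1) * j + 2 * j by ring, zpow_add₀ (by simp), zpow_mul _ 2 j]
    simp
  have hα : (comulAction 𝒱).toLinearMap ∘ₗ ι 𝒱 ∘ₗ f =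
      (leftAction 𝒱).toLinearMap ∘ₗ ι 𝒱 ∘ₗ f + (rightAction 𝒱).toLinearMap ∘ₗ ι 𝒱 ∘ₗ f :=
    LinearMap.ext fun c => comulAction_ι _
  have h : (comulAction 𝒱).toLinearMap ∘ₗ coder f =
      conv ((leftAction 𝒱).toLinearMap ∘ₗ coder f) (rightAction 𝒱).toLinearMap +
      conv ((leftAction 𝒱).toLinearMap ∘ₗ (parity 𝒱).toLinearMap)
        ((rightAction 𝒱).toLinearMap ∘ₗ coder f) := by
    rw [coder, algHom_comp_conv, algHom_comp_conv, algHom_comp_conv, hα, LinearMap.comp_id,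
      comulAction_eq_conv, conv_add_left, ← conv_assoc, ← conv_assoc, hl, conv_assoc,
      LinearMap.comp_id, LinearMap.comp_id, conv_assoc, conv_assoc]
  refine LinearMap.ext fun c => ?_
  have h' := congrArg (fun T : Module.End F _ => T (1 ⊗ₜ 1)) (LinearMap.congr_fun h c)
  simp only [LinearMap.comp_apply, AlgHom.toLinearMap_apply, LinearMap.add_apply] at h'
  rw [conv_leftAction_rightAction] at h'
  rw [← LinearMap.comp_id (rightAction 𝒱).toLinearMap, conv_leftAction_rightAction] at h'
  exact h'

end Cofree

section Cohom

open WithConv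

variable {F : Type*} [Field F] {V : Type*} [AddCommGroup V] [Module F V]
  {𝒱 : ℤ → Submodule F V}

/-! ### Word length -/

theorem lengthPoly_of_mem {n : ℕ} {c : GSym 𝒱} (hc : c ∈ length 𝒱 n) :
    lengthPoly 𝒱 c = Polynomial.monomial n c := by
  induction hc using wordSpan_induction with
  | one => simp
  | ι_mul i x hx m c _ ih =>
    rw [map_mul, ih, lengthPoly, lift_ι]
    simp [Polynomial.monomial_mul_monomial]
  | zero m => simp
  | add m a b _ _ h1 h2 => rw [map_add, h1, h2, map_add]
  | smul m r a _ h => rw [map_smul, h, Polynomial.smul_monomial]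

theorem ofLength_of_mem {W : Type*} [AddCommGroup W] [Module F W] (f : ℕ → GSym 𝒱 →ₗ[F] W)
    {n : ℕ} {c : GSym 𝒱} (hc : c ∈ length 𝒱 n) : ofLength 𝒱 f c = f n c := by
  rw [ofLength, LinearMap.comp_apply, AlgHom.toLinearMap_apply, lengthPoly_of_mem hc,
    Polynomial.lsum_apply, Polynomial.sum_monomial_index _ _ (map_zero (f n))]

/-- A map assembled from maps on the constituents of given word length is compatible with degrees as
soon as these are, since the two gradings are compatible. -/
theorem ofLength_mem {W : Type*} [AddCommGroup W] [Module F W] {f : ℕ → GSym 𝒱 →ₗ[F] W} {n : ℤ}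
    {N : Submodule F W} (hf : ∀ k, ∀ c ∈ degree 𝒱 n, f k c ∈ N) {c : GSym 𝒱}
    (hc : c ∈ degree 𝒱 n) : ofLength 𝒱 f c ∈ N := by
  have hle : degree 𝒱 n ≤ ⨆ p, ⨆ (_ : AddMonoidHom.fst ℤ ℕ p = n),
      wordSpan 𝒱 𝒱 (fun i => (i, (1 : ℕ))) p :=
    wordSpan_le_iSup (w := id) (AddMonoidHom.fst ℤ ℕ) (fun i => le_iSup₂_of_le i rfl le_rfl) n
  have key : ∀ p, AddMonoidHom.fst ℤ ℕ p = n → wordSpan 𝒱 𝒱 (fun i => (i, (1 : ℕ))) p ≤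
      N.comap (ofLength 𝒱 f) := by
    intro p hp c hc
    have h1 := wordSpan_mono (AddMonoidHom.fst ℤ ℕ) p hc
    rw [hp] at h1
    have h1' : c ∈ degree 𝒱 n := h1
    have h2 := wordSpan_mono (AddMonoidHom.snd ℤ ℕ) p hc
    have h2' : c ∈ length 𝒱 p.2 := h2
    rw [Submodule.mem_comap, ofLength_of_mem _ h2']
    exact hf _ _ h1'
  exact (hle.trans (iSup₂_le key)) hc

theorem one_mem_length : (1 : GSym 𝒱) ∈ length 𝒱 0 := one_mem_wordSpan

theorem counit_of_mem_length {n : ℕ} (hn : n ≠ 0) {c : GSym 𝒱} (hc : c ∈ length 𝒱 n) :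
    counit 𝒱 c = 0 := by
  induction hc using wordSpan_induction with
  | one => exact absurd rfl hn
  | ι_mul i x hx m c _ ih => simp
  | zero m => simp
  | add m a b _ _ h1 h2 => rw [map_add, h1 hn, h2 hn, add_zero]
  | smul m r a _ h => rw [map_smul, h hn, smul_zero]

theorem pr_of_mem_length {n : ℕ} (hn : n ≠ 1) {c : GSym 𝒱} (hc : c ∈ length 𝒱 n) :
    pr 𝒱 c = 0 := by
  induction hc using wordSpan_induction with
  | one => simp
  | ι_mul i x hx m c hc _ => simp [counit_of_mem_length (n := m) (by omega) hc]
  | zero m => simp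
  | add m a b _ _ h1 h2 => rw [map_add, h1 hn, h2 hn, add_zero]
  | smul m r a _ h => rw [map_smul, h hn, smul_zero]

theorem eq_counit_of_mem_length {c : GSym 𝒱} (hc : c ∈ length 𝒱 0) :
    c = counit 𝒱 c • (1 : GSym 𝒱) := by
  suffices h : ∀ n, c ∈ length 𝒱 n → n = 0 → c = counit 𝒱 c • (1 : GSym 𝒱) from h 0 hc rfl
  intro n hc'
  clear hc
  induction hc' using wordSpan_induction with
  | one => simp
  | ι_mul i x hx m c hc _ => intro h; omega
  | zero m => simp
  | add m a b _ _ h1 h2 => intro h; rw [map_add, add_smul, ← h1 h, ← h2 h]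
  | smul m r a _ h => intro h'; rw [map_smul, smul_assoc, ← h h']

theorem counit_of_mem_degree {n : ℤ} (hn : n ≠ 0) {c : GSym 𝒱} (hc : c ∈ degree 𝒱 n) :
    counit 𝒱 c = 0 := by
  rw [degree_eq_wordSpan] at hc
  induction hc using wordSpan_induction with
  | one => exact absurd rfl hn
  | ι_mul i x hx m c _ ih => simp
  | zero m => simp
  | add m a b _ _ h1 h2 => rw [map_add, h1 hn, h2 hn, add_zero]
  | smul m r a _ h => rw [map_smul, h hn, smul_zero]

theorem pr_mem_degree {n : ℤ} {c : GSym 𝒱} (hc : c ∈ degree 𝒱 n) : pr 𝒱 c ∈ 𝒱 n := by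
  have h : pr 𝒱 c ∈ 𝒱 n ∧ (n ≠ 0 → counit 𝒱 c = 0) := by
    rw [degree_eq_wordSpan] at hc
    induction hc using wordSpan_induction with
    | one => simp
    | ι_mul i x hx m c hc ih =>
      refine ⟨?_, by simp⟩
      rw [pr_ι_mul]
      by_cases hm : m = 0
      · subst hm; rw [add_zero]; exact Submodule.smul_mem _ _ hx
      · simp [ih.2 hm]
    | zero m => simp
    | add m a b _ _ h1 h2 =>
      exact ⟨by rw [map_add]; exact add_mem h1.1 h2.1,
        fun h => by rw [map_add, h1.2 h, h2.2 h, add_zero]⟩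
    | smul m r a _ h =>
      exact ⟨by rw [map_smul]; exact Submodule.smul_mem _ _ h.1,
        fun h' => by rw [map_smul, h.2 h', smul_zero]⟩
  exact h.1

variable (𝒱) in
/-- The linear maps that vanish on words of length less than `k`. -/
def vanishingBelow (W : Type*) [AddCommGroup W] [Module F W] (k : ℕ) :
    Submodule F (GSym 𝒱 →ₗ[F] W) where
  carrier := {g | ∀ m < k, ∀ c ∈ length 𝒱 m, g c = 0}
  zero_mem' m _ c _ := rfl
  add_mem' ha hb m hm c hc := by rw [LinearMap.add_apply, ha m hm c hc, hb m hm c hc, add_zero]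
  smul_mem' r a ha m hm c hc := by rw [LinearMap.smul_apply, ha m hm c hc, smul_zero]

theorem vanishingBelow_mono {W : Type*} [AddCommGroup W] [Module F W] {k l : ℕ} (h : k ≤ l) :
    vanishingBelow 𝒱 W l ≤ vanishingBelow 𝒱 W k :=
  fun _ hg m hm => hg m (by omega)

theorem mem_vanishingBelow_one {W : Type*} [AddCommGroup W] [Module F W] {g : GSym 𝒱 →ₗ[F] W}
    (hg : g 1 = 0) : g ∈ vanishingBelow 𝒱 W 1 := by
  intro m hm c hc
  obtain rfl : m = 0 := by omega
  rw [eq_counit_of_mem_length hc, map_smul, hg, smul_zero]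

section

variable [DirectSum.Decomposition 𝒱] {A : Type*} [Ring A] [Algebra F A]

theorem conv_congr_length {m : ℕ} {c : GSym 𝒱} (hc : c ∈ length 𝒱 m)
    {a b a' b' : GSym 𝒱 →ₗ[F] A} (ha : ∀ j ≤ m, ∀ p ∈ length 𝒱 j, a p = a' p)
    (hb : ∀ j ≤ m, ∀ p ∈ length 𝒱 j, b p = b' p) : conv a b c = conv a' b' c :=
  comul_congr_length hc (G := LinearMap.mul' F A ∘ₗ TensorProduct.map a b)
    (H := LinearMap.mul' F A ∘ₗ TensorProduct.map a' b') fun i j h p hp q hq => by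
      simp [ha i (by omega) p hp, hb j (by omega) q hq]

theorem conv_mem_vanishingBelow {k l : ℕ} {a b : GSym 𝒱 →ₗ[F] A}
    (ha : a ∈ vanishingBelow 𝒱 A k) (hb : b ∈ vanishingBelow 𝒱 A l) :
    conv a b ∈ vanishingBelow 𝒱 A (k + l) := by
  intro m hm c hc
  refine comul_congr_length hc (G := LinearMap.mul' F A ∘ₗ TensorProduct.map a b) (H := 0)
    fun i j h p hp q hq => ?_
  rcases lt_or_ge i k with hi | hi
  · simp [ha i hi p hp]
  · simp [hb j (by omega) q hq]

theorem convPow_mem_vanishingBelow {a : GSym 𝒱 →ₗ[F] A} (ha : a ∈ vanishingBelow 𝒱 A 1) (n : ℕ) :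
    convPow a n ∈ vanishingBelow 𝒱 A n := by
  induction n with
  | zero => intro m hm; omega
  | succ n ih =>
    rw [convPow, add_comm n 1]
    exact conv_mem_vanishingBelow ha ih

/-- The binomial formula for the convolution product. -/
theorem convPow_add {u v : GSym 𝒱 →ₗ[F] A} (h : conv u v = conv v u) (n : ℕ) :
    convPow (u + v) n = ∑ p ∈ Finset.HasAntidiagonal.antidiagonal n,
      (n.choose p.1 : F) • conv (convPow u p.1) (convPow v p.2) := by
  have hc : Commute (toConv u) (toConv v) := congrArg toConv h
  have h2 := congrArg ofConv (hc.add_pow' n)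
  rw [← toConv_add] at h2
  rw [convPow_eq_ofConv, h2, ofConv_sum]
  refine Finset.sum_congr rfl fun p _ => ?_
  rw [conv_eq_ofConv, convPow_eq_ofConv, convPow_eq_ofConv, Nat.cast_smul_eq_nsmul]
  rfl

/-! ### Morphisms of coalgebras -/

variable {W : Type*} [AddCommGroup W] [Module F W] {𝒲 : ℤ → Submodule F W}

/-- The convolution exponential may be truncated anywhere above the word length. -/
theorem cohom_of_mem {f : GSym 𝒱 →ₗ[F] W} (hf : f 1 = 0) {m N : ℕ} (hN : m < N) {c : GSym 𝒱}
    (hc : c ∈ length 𝒱 m) :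
    cohom 𝒲 f c = ∑ n ∈ Finset.range N, ((n.factorial : F)⁻¹) • convPow (ι 𝒲 ∘ₗ f) n c := by
  rw [cohom, ofLength_of_mem _ hc, LinearMap.sum_apply]
  refine Finset.sum_subset (Finset.range_mono (by omega)) fun n _ hn => ?_
  rw [LinearMap.smul_apply, convPow_mem_vanishingBelow (mem_vanishingBelow_one (by simp [hf])) n m
    (by simpa using hn) c hc, smul_zero]

theorem cohom_one (f : GSym 𝒱 →ₗ[F] W) : cohom 𝒲 f 1 = 1 := by
  rw [cohom, ofLength_of_mem _ one_mem_length]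
  simp [convPow]

theorem counit_convPow_succ (f : GSym 𝒱 →ₗ[F] W) (n : ℕ) (c : GSym 𝒱) :
    counit 𝒲 (convPow (ι 𝒲 ∘ₗ f) (n + 1) c) = 0 := by
  rw [convPow]
  refine (LinearMap.congr_fun (algHom_comp_conv (counit 𝒲) _ _) c).trans ?_
  have : (counit 𝒲).toLinearMap ∘ₗ ι 𝒲 ∘ₗ f = 0 := LinearMap.ext fun c => counit_ι _
  rw [this]
  simp [conv]

theorem counit_cohom (f : GSym 𝒱 →ₗ[F] W) (c : GSym 𝒱) :
    counit 𝒲 (cohom 𝒲 f c) = counit 𝒱 c := by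
  refine LinearMap.congr_fun (f := (counit 𝒲).toLinearMap ∘ₗ cohom 𝒲 f)
    (g := (counit 𝒱).toLinearMap) (length_hom_ext fun m c hc => ?_) c
  rw [LinearMap.comp_apply, cohom, ofLength_of_mem _ hc, Finset.sum_range_succ']
  simp only [LinearMap.add_apply, LinearMap.sum_apply, LinearMap.smul_apply, map_add, map_sum,
    map_smul, AlgHom.toLinearMap_apply, counit_convPow_succ, smul_zero, Finset.sum_const_zero]
  simp [convPow]

theorem convPow_mem_degree {f : GSym 𝒱 →ₗ[F] W} (hf : ∀ n, ∀ c ∈ degree 𝒱 n, f c ∈ 𝒲 n) (k : ℕ) :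
    ∀ n, ∀ c ∈ degree 𝒱 n, convPow (ι 𝒲 ∘ₗ f) k c ∈ degree 𝒲 (n + 0) := by
  induction k with
  | zero =>
    intro n c hc
    by_cases hn : n = 0
    · subst hn
      simp only [convPow, LinearMap.comp_apply, Algebra.linearMap_apply,
        Algebra.algebraMap_eq_smul_one]
      exact Submodule.smul_mem _ _ (one_mem_wordSpan (w := id))
    · simp [convPow, counit_of_mem_degree hn hc]
  | succ k ih =>
    intro n c hc
    exact conv_mem_degree (e := 0) (e' := 0)
      (fun n c hc => by rw [add_zero]; exact ι_mem_wordSpan (w := id) (hf n c hc)) ih hc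

theorem cohom_mem_degree {f : GSym 𝒱 →ₗ[F] W} (hf : ∀ n, ∀ c ∈ degree 𝒱 n, f c ∈ 𝒲 n) {n : ℤ}
    {c : GSym 𝒱} (hc : c ∈ degree 𝒱 n) : cohom 𝒲 f c ∈ degree 𝒲 n := by
  refine ofLength_mem (fun m c hc => ?_) hc
  rw [LinearMap.sum_apply]
  refine Submodule.sum_mem _ fun k _ => ?_
  have := convPow_mem_degree hf k n c hc
  rw [add_zero] at this
  exact Submodule.smul_mem _ _ this

theorem pr_cohom {f : GSym 𝒱 →ₗ[F] W} (hf : f 1 = 0) (c : GSym 𝒱) :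
    pr 𝒲 (cohom 𝒲 f c) = f c := by
  refine LinearMap.congr_fun (f := pr 𝒲 ∘ₗ cohom 𝒲 f) (length_hom_ext fun m c hc => ?_) c
  have h0 : ∀ n, pr 𝒲 (convPow (ι 𝒲 ∘ₗ f) (n + 2) c) = 0 := fun n => by
    have : pr 𝒲 ∘ₗ LinearMap.mul' F _ ∘ₗ
        TensorProduct.map (ι 𝒲 ∘ₗ f) (convPow (ι 𝒲 ∘ₗ f) (n + 1)) = 0 :=
      TensorProduct.ext' fun a b => by
        have hb : counit 𝒲 (convPow (ι 𝒲 ∘ₗ f) (n + 1) b) = 0 := counit_convPow_succ f n b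
        simp [hb]
    exact LinearMap.congr_fun this (comul 𝒱 c)
  have h1 : convPow (ι 𝒲 ∘ₗ f) 1 = ι 𝒲 ∘ₗ f := conv_unit _ _
  rw [LinearMap.comp_apply, cohom_of_mem hf (N := m + 2) (by omega) hc, Finset.sum_range_succ',
    Finset.sum_range_succ']
  simp only [map_add, map_sum, map_smul, h0, zero_add, h1]
  simp [convPow, Algebra.algebraMap_eq_smul_one]

theorem koszul_ι_pr (i : ℤ) (c : GSym 𝒱) : koszul 𝒱 i (ι 𝒱 (pr 𝒱 c)) =
    ι 𝒱 (pr 𝒱 (koszul 𝒱 i c)) := by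
  refine LinearMap.congr_fun (f := koszul 𝒱 i ∘ₗ ι 𝒱 ∘ₗ pr 𝒱) (g := ι 𝒱 ∘ₗ pr 𝒱 ∘ₗ koszul 𝒱 i)
    (degree_hom_ext fun n c hc => ?_) c
  have h : ι 𝒱 (pr 𝒱 c) ∈ degree 𝒱 n := ι_mem_wordSpan (w := id) (pr_mem_degree hc)
  simp [koszul_of_mem hc, koszul_of_mem h]

/-- The power rule: if `(ι pr)^{*n}` is regarded as the `n`-th power of a variable, then splitting
off a letter is differentiation. -/
theorem convPow_pr_ι_mul (n : ℕ) : ∀ i, ∀ x ∈ 𝒱 i, ∀ c,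
    convPow (ι 𝒱 ∘ₗ pr 𝒱) (n + 1) (ι 𝒱 x * c) =
      (n + 1 : F) • (ι 𝒱 x * convPow (ι 𝒱 ∘ₗ pr 𝒱) n c) := by
  induction n with
  | zero =>
    intro i x hx c
    rw [zero_add, show convPow (ι 𝒱 ∘ₗ pr 𝒱) 1 = ι 𝒱 ∘ₗ pr 𝒱 from conv_unit _ _]
    simp [convPow, Algebra.algebraMap_eq_smul_one]
  | succ n ih =>
    intro i x hx c
    have h : LinearMap.mul' F _ ∘ₗ TensorProduct.map (ι 𝒱 ∘ₗ pr 𝒱)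
        (convPow (ι 𝒱 ∘ₗ pr 𝒱) (n + 1)) ∘ₗ primMul 𝒱 i x =
        LinearMap.mulLeft F (ι 𝒱 x) ∘ₗ (LinearMap.mul' F _ ∘ₗ TensorProduct.map
          (convPow (ι 𝒱 ∘ₗ pr 𝒱) 0) (convPow (ι 𝒱 ∘ₗ pr 𝒱) (n + 1))) +
        (n + 1 : F) • LinearMap.mulLeft F (ι 𝒱 x) ∘ₗ (LinearMap.mul' F _ ∘ₗ
          TensorProduct.map (ι 𝒱 ∘ₗ pr 𝒱) (convPow (ι 𝒱 ∘ₗ pr 𝒱) n)) := by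
      refine TensorProduct.ext' fun a b => ?_
      simp only [LinearMap.comp_apply, primMul_tmul, map_add, TensorProduct.map_tmul,
        LinearMap.mul'_apply, ih i x hx, LinearMap.add_apply, LinearMap.smul_apply,
        LinearMap.mulLeft_apply, pr_ι_mul, map_smul, mul_smul_comm, ← mul_assoc, ← koszul_ι_pr,
        ← ι_mul_eq hx]
      simp [convPow, Algebra.algebraMap_eq_smul_one]
    have h0 : conv (convPow (ι 𝒱 ∘ₗ pr 𝒱) 0) (convPow (ι 𝒱 ∘ₗ pr 𝒱) (n + 1)) =
        convPow (ι 𝒱 ∘ₗ pr 𝒱) (n + 1) := unit_conv _ _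
    have h' := LinearMap.congr_fun h (comul 𝒱 c)
    have e : convPow (ι 𝒱 ∘ₗ pr 𝒱) (n + 1 + 1) (ι 𝒱 x * c) =
      (LinearMap.mul' F _ ∘ₗ TensorProduct.map (ι 𝒱 ∘ₗ pr 𝒱)
        (convPow (ι 𝒱 ∘ₗ pr 𝒱) (n + 1)) ∘ₗ primMul 𝒱 i x) (comul 𝒱 c) := by
      rw [convPow, conv, LinearMap.comp_apply, LinearMap.comp_apply, comul_ι_mul 𝒱 hx]; rfl
    have e1 := LinearMap.congr_fun h0 c
    rw [e, h', LinearMap.add_apply, LinearMap.comp_apply]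
    rw [show (LinearMap.mul' F _ ∘ₗ TensorProduct.map (convPow (ι 𝒱 ∘ₗ pr 𝒱) 0)
      (convPow (ι 𝒱 ∘ₗ pr 𝒱) (n + 1))) (comul 𝒱 c) = convPow (ι 𝒱 ∘ₗ pr 𝒱) (n + 1) c from e1]
    change _ + (n + 1 : F) • (ι 𝒱 x * convPow (ι 𝒱 ∘ₗ pr 𝒱) (n + 1) c) = _
    rw [LinearMap.mulLeft_apply]
    push_cast
    module

/-- The convolution powers of the projection onto `V` are multiples of the projections onto the
constituents of given word length. -/
theorem convPow_pr_of_mem (n : ℕ) {m : ℕ} {c : GSym 𝒱} (hc : c ∈ length 𝒱 m) :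
    convPow (ι 𝒱 ∘ₗ pr 𝒱) n c = if m = n then (n.factorial : F) • c else 0 := by
  induction hc using wordSpan_induction generalizing n with
  | one =>
    rcases n with _ | n
    · simp [convPow]
    · rw [if_neg (by omega), convPow_mem_vanishingBelow
        (mem_vanishingBelow_one (by simp)) (n + 1) 0 (by omega) 1 one_mem_length]
  | ι_mul i x hx m c hc ih =>
    rcases n with _ | n
    · rw [if_neg (by omega)]
      simp [convPow]
    · rw [convPow_pr_ι_mul n i x hx, ih]
      by_cases h : m = n
      · rw [if_pos h, if_pos (by omega), mul_smul_comm, smul_smul, Nat.factorial_succ]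
        push_cast; rfl
      · rw [if_neg h, if_neg (by omega), mul_zero, smul_zero]
  | zero m => simp
  | add m a b _ _ h1 h2 => rw [map_add, h1, h2]; split_ifs <;> simp
  | smul m r a _ h => rw [map_smul, h, smul_ite, smul_zero, smul_comm]

end

end Cohom

end GSym

section

variable {F : Type*} [Field F] {V V' W W' : Type*} [AddCommGroup V] [Module F V]
  [AddCommGroup V'] [Module F V'] [AddCommGroup W] [Module F W] [AddCommGroup W'] [Module F W']

theorem tensorMap_sub_left (f g : V →ₗ[F] V') (h : W →ₗ[F] W') :
    TensorProduct.map (f - g) h = TensorProduct.map f h - TensorProduct.map g h :=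
  TensorProduct.ext' fun a b => by simp [TensorProduct.sub_tmul]

theorem tensorMap_sub_right (h : V →ₗ[F] V') (f g : W →ₗ[F] W') :
    TensorProduct.map h (f - g) = TensorProduct.map h f - TensorProduct.map h g :=
  TensorProduct.ext' fun a b => by simp [TensorProduct.tmul_sub]

end

namespace GSym

section Universal

variable {F : Type*} [Field F] [CharZero F] {V : Type*} [AddCommGroup V] [Module F V]
  {𝒱 : ℤ → Submodule F V} [DirectSum.Decomposition 𝒱]
  {W : Type*} [AddCommGroup W] [Module F W] {𝒲 : ℤ → Submodule F W}

/-- The functional equation of the exponential for the convolution product, on words of length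
less than `N`. -/
theorem sum_convPow_add_apply {A : Type*} [Ring A] [Algebra F A] {u v : GSym 𝒱 →ₗ[F] A}
    (h : conv u v = conv v u) (hu : u 1 = 0) (hv : v 1 = 0) {m N : ℕ} (hN : m < N) {c : GSym 𝒱}
    (hc : c ∈ length 𝒱 m) :
    ∑ n ∈ Finset.range N, ((n.factorial : F)⁻¹) • convPow (u + v) n c =
      conv (∑ n ∈ Finset.range N, ((n.factorial : F)⁻¹) • convPow u n)
        (∑ n ∈ Finset.range N, ((n.factorial : F)⁻¹) • convPow v n) c := by
  let g : ℕ × ℕ → A := fun p => ((p.1.factorial : F)⁻¹ * (p.2.factorial : F)⁻¹) •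
    conv (convPow u p.1) (convPow v p.2) c
  have hl : ∀ n, ((n.factorial : F)⁻¹) • convPow (u + v) n c =
      ∑ p ∈ Finset.HasAntidiagonal.antidiagonal n, g p := by
    intro n
    rw [convPow_add h, LinearMap.sum_apply, Finset.smul_sum]
    refine Finset.sum_congr rfl fun p hp => ?_
    rw [LinearMap.smul_apply, smul_smul]
    congr 1
    have hp' := Finset.HasAntidiagonal.mem_antidiagonal.mp hp
    have hch := Nat.choose_mul_factorial_mul_factorial (n := n) (k := p.1) (by omega)
    rw [show n - p.1 = p.2 by omega] at hch
    rw [← hch]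
    have h1 : (p.1.factorial : F) ≠ 0 := Nat.cast_ne_zero.mpr (Nat.factorial_ne_zero _)
    have h2 : (p.2.factorial : F) ≠ 0 := Nat.cast_ne_zero.mpr (Nat.factorial_ne_zero _)
    have h3 : (n.choose p.1 : F) ≠ 0 :=
      Nat.cast_ne_zero.mpr (Nat.choose_pos (by omega)).ne'
    push_cast
    field_simp
  have hr : conv (∑ n ∈ Finset.range N, ((n.factorial : F)⁻¹) • convPow u n)
      (∑ n ∈ Finset.range N, ((n.factorial : F)⁻¹) • convPow v n) c =
      ∑ p ∈ Finset.range N ×ˢ Finset.range N, g p := by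
    rw [Finset.sum_product]
    simp only [conv_eq_ofConv, WithConv.toConv_sum, Finset.sum_mul_sum, WithConv.toConv_smul,
      smul_mul_smul_comm, WithConv.ofConv_sum, LinearMap.sum_apply]
    rfl
  rw [hr, Finset.sum_congr rfl fun n _ => hl n]
  -- the products of total order at least `N` vanish on words of length less than `N`
  have hg : ∀ p : ℕ × ℕ, ¬ p.1 + p.2 < N → g p = 0 := fun p hp => by
    have := conv_mem_vanishingBelow (convPow_mem_vanishingBelow (mem_vanishingBelow_one hu) p.1)
      (convPow_mem_vanishingBelow (mem_vanishingBelow_one hv) p.2) m (by omega) c hc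
    simp only [g, this, smul_zero]
  rw [← Finset.sum_filter_of_ne (p := fun p : ℕ × ℕ => p.1 + p.2 < N)
    fun p _ hp => not_imp_comm.mp (hg p) hp]
  rw [← Finset.sum_fiberwise_of_maps_to (t := Finset.range N)
    (g := fun p : ℕ × ℕ => p.1 + p.2)
    fun p hp => by simpa using (Finset.mem_filter.mp hp).2]
  refine Finset.sum_congr rfl fun n hn => Finset.sum_congr ?_ fun _ _ => rfl
  ext p
  simp only [Finset.HasAntidiagonal.mem_antidiagonal, Finset.mem_filter, Finset.mem_product,
    Finset.mem_range] at hn ⊢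
  omega

variable [DirectSum.Decomposition 𝒲]

/-- A convolution exponential is a morphism of coalgebras: the diagonal sends `ι f` to the sum of its
images in the two tensor factors, which commute with each other, and the exponential of a sum of
commuting elements is the product of the exponentials. -/
theorem comul_cohom {f : GSym 𝒱 →ₗ[F] W} (hf : ∀ n, ∀ c ∈ degree 𝒱 n, f c ∈ 𝒲 n)
    (hf1 : f 1 = 0) :
    comul 𝒲 ∘ₗ cohom 𝒲 f = TensorProduct.map (cohom 𝒲 f) (cohom 𝒲 f) ∘ₗ comul 𝒱 := by
  refine length_hom_ext fun m c hc => ?_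
  let u := (leftAction 𝒲).toLinearMap ∘ₗ ι 𝒲 ∘ₗ f
  let v := (rightAction 𝒲).toLinearMap ∘ₗ ι 𝒲 ∘ₗ f
  have huv : conv u v = conv v u := (conv_comm_of fun i j a ha b hb =>
    rightAction_mul_leftAction (ι_mem_wordSpan (w := id) (hf i a ha))
      (ι_mem_wordSpan (w := id) (hf j b hb))).symm
  have hα : (comulAction 𝒲).toLinearMap ∘ₗ ι 𝒲 ∘ₗ f = u + v :=
    LinearMap.ext fun c => comulAction_ι _
  have h1 : comulAction 𝒲 (cohom 𝒲 f c) =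
      ∑ n ∈ Finset.range (m + 1), ((n.factorial : F)⁻¹) • convPow (u + v) n c := by
    rw [cohom_of_mem hf1 (Nat.lt_succ_self m) hc, map_sum]
    refine Finset.sum_congr rfl fun n _ => ?_
    rw [map_smul, ← hα, ← algHom_comp_convPow]
    rfl
  have h2 : conv ((leftAction 𝒲).toLinearMap ∘ₗ cohom 𝒲 f)
      ((rightAction 𝒲).toLinearMap ∘ₗ cohom 𝒲 f) c =
      conv (∑ n ∈ Finset.range (m + 1), ((n.factorial : F)⁻¹) • convPow u n)
        (∑ n ∈ Finset.range (m + 1), ((n.factorial : F)⁻¹) • convPow v n) c := by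
    refine conv_congr_length hc (fun j hj a ha => ?_) fun j hj a ha => ?_
    all_goals
      have ha' := cohom_of_mem (𝒲 := 𝒲) hf1 (N := m + 1) (by omega) ha
      simp only [LinearMap.comp_apply, ha', LinearMap.sum_apply, map_sum, map_smul,
        LinearMap.smul_apply]
      refine Finset.sum_congr rfl fun n _ => congrArg _ ?_
      rw [← algHom_comp_convPow]
      rfl
  rw [LinearMap.comp_apply, LinearMap.comp_apply, ← conv_leftAction_rightAction, h2,
    ← sum_convPow_add_apply huv (by simp [u, hf1]) (by simp [v, hf1]) (Nat.lt_succ_self m) hc, ← h1]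
  rfl

/-! ### Uniqueness of maps into a cofree coalgebra -/

/-- The exponential of the projection onto `V` is the identity. -/
theorem cohom_pr : cohom 𝒱 (pr 𝒱) = LinearMap.id := by
  refine length_hom_ext fun m c hc => ?_
  rw [cohom_of_mem pr_one (Nat.lt_succ_self m) hc, Finset.sum_eq_single m]
  · rw [convPow_pr_of_mem m hc, if_pos rfl, smul_smul, inv_mul_cancel₀, one_smul]
    · rfl
    exact Nat.cast_ne_zero.mpr (Nat.factorial_ne_zero _)
  · intro n _ hn
    rw [convPow_pr_of_mem n hc, if_neg hn.symm, smul_zero]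
  · simp

theorem eq_zero_of_convPow_pr {z : GSym 𝒱} (h : ∀ n, convPow (ι 𝒱 ∘ₗ pr 𝒱) n z = 0) : z = 0 := by
  obtain ⟨N, hN⟩ : ∃ N, ∀ M, N ≤ M → z = ∑ n ∈ Finset.range M,
      ((n.factorial : F)⁻¹) • convPow (ι 𝒱 ∘ₗ pr 𝒱) n z := by
    have hz : z ∈ ⨆ m, length 𝒱 m :=
      iSup_wordSpan (𝒱 := 𝒱) (s := 𝒱) (w := fun _ => 1) iSup_eq_top ▸ Submodule.mem_top
    clear h
    induction hz using Submodule.iSup_induction' with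
    | mem m c hc =>
      refine ⟨m + 1, fun M hM => ?_⟩
      rw [← cohom_of_mem (𝒲 := 𝒱) pr_one (by omega) hc, cohom_pr]; rfl
    | zero => exact ⟨0, by simp⟩
    | add a b _ _ ha hb =>
      obtain ⟨N, hN⟩ := ha
      obtain ⟨N', hN'⟩ := hb
      refine ⟨max N N', fun M hM => ?_⟩
      simp only [map_add, smul_add, Finset.sum_add_distrib]
      rw [← hN M (le_of_max_le_left hM), ← hN' M (le_of_max_le_right hM)]
  rw [hN N le_rfl]
  simp [h]

/-- A map into a cofree coalgebra that is a coderivation along some maps is determined by its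
corestriction to the cogenerators. -/
theorem eq_zero_of_pr_eq_zero {A Φ Ψ : GSym 𝒱 →ₗ[F] GSym 𝒲}
    (hA : comul 𝒲 ∘ₗ A = (TensorProduct.map A Φ + TensorProduct.map Ψ A) ∘ₗ comul 𝒱)
    (hε : ∀ c, counit 𝒲 (A c) = 0) (hpr : ∀ c, pr 𝒲 (A c) = 0) : A = 0 := by
  suffices h : ∀ n, convPow (ι 𝒲 ∘ₗ pr 𝒲) n ∘ₗ A = 0 from
    LinearMap.ext fun c => eq_zero_of_convPow_pr fun n => LinearMap.congr_fun (h n) c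
  intro n
  induction n with
  | zero => ext c; simp [convPow, hε]
  | succ n ih =>
    have h : TensorProduct.map (ι 𝒲 ∘ₗ pr 𝒲) (convPow (ι 𝒲 ∘ₗ pr 𝒲) n) ∘ₗ
        (TensorProduct.map A Φ + TensorProduct.map Ψ A) = 0 := by
      rw [LinearMap.comp_add, ← TensorProduct.map_comp, ← TensorProduct.map_comp, ih]
      have : (ι 𝒲 ∘ₗ pr 𝒲) ∘ₗ A = 0 := by ext c; simp [hpr]
      rw [this, TensorProduct.map_zero_left, TensorProduct.map_zero_right, add_zero]
    rw [convPow, conv, LinearMap.comp_assoc, LinearMap.comp_assoc, hA, ← LinearMap.comp_assoc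
      (comul 𝒱), h, LinearMap.zero_comp, LinearMap.comp_zero]

/-- Morphisms of coalgebras into a cofree coalgebra that agree after projection onto the
cogenerators are equal. -/
theorem coalgHom_ext {Φ Ψ : GSym 𝒱 →ₗ[F] GSym 𝒲}
    (hΦ : comul 𝒲 ∘ₗ Φ = TensorProduct.map Φ Φ ∘ₗ comul 𝒱)
    (hΨ : comul 𝒲 ∘ₗ Ψ = TensorProduct.map Ψ Ψ ∘ₗ comul 𝒱)
    (hε : ∀ c, counit 𝒲 (Φ c) = counit 𝒲 (Ψ c)) (hpr : ∀ c, pr 𝒲 (Φ c) = pr 𝒲 (Ψ c)) :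
    Φ = Ψ := by
  refine sub_eq_zero.mp (eq_zero_of_pr_eq_zero (A := Φ - Ψ) (Φ := Φ) (Ψ := Ψ) ?_ (by simp [hε])
    (by simp [hpr]))
  rw [LinearMap.comp_sub, hΦ, hΨ, tensorMap_sub_left, tensorMap_sub_right,
    sub_add_sub_cancel, LinearMap.sub_comp]

/-- Compatibility of a morphism of coalgebras with coderivations can be checked on cogenerators. -/
theorem comp_eq_comp_of_pr {D : GSym 𝒱 →ₗ[F] GSym 𝒱} {D' : GSym 𝒲 →ₗ[F] GSym 𝒲}
    {Φ : GSym 𝒱 →ₗ[F] GSym 𝒲}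
    (hD : comul 𝒱 ∘ₗ D = (TensorProduct.map D LinearMap.id +
      TensorProduct.map (parity 𝒱).toLinearMap D) ∘ₗ comul 𝒱)
    (hD' : comul 𝒲 ∘ₗ D' = (TensorProduct.map D' LinearMap.id +
      TensorProduct.map (parity 𝒲).toLinearMap D') ∘ₗ comul 𝒲)
    (hΦ : comul 𝒲 ∘ₗ Φ = TensorProduct.map Φ Φ ∘ₗ comul 𝒱)
    (hε : ∀ c, counit 𝒲 (Φ c) = counit 𝒱 c)
    (hdeg : ∀ n, ∀ c ∈ degree 𝒱 n, Φ c ∈ degree 𝒲 n)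
    (hεD : ∀ c, counit 𝒱 (D c) = 0) (hεD' : ∀ c, counit 𝒲 (D' c) = 0)
    (hpr : ∀ c, pr 𝒲 (Φ (D c)) = pr 𝒲 (D' (Φ c))) : Φ ∘ₗ D = D' ∘ₗ Φ := by
  have hP : (parity 𝒲).toLinearMap ∘ₗ Φ = Φ ∘ₗ (parity 𝒱).toLinearMap :=
    degree_hom_ext fun n c hc => by
      simp [parity_of_mem hc, parity_of_mem (hdeg n c hc)]
  refine sub_eq_zero.mp (eq_zero_of_pr_eq_zero (A := Φ ∘ₗ D - D' ∘ₗ Φ) (Φ := Φ)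
    (Ψ := (parity 𝒲).toLinearMap ∘ₗ Φ) ?_ (by simp [hε, hεD, hεD']) (by simp [hpr]))
  have h1 : comul 𝒲 ∘ₗ Φ ∘ₗ D = (TensorProduct.map (Φ ∘ₗ D) Φ +
      TensorProduct.map (Φ ∘ₗ (parity 𝒱).toLinearMap) (Φ ∘ₗ D)) ∘ₗ comul 𝒱 := by
    rw [← LinearMap.comp_assoc, hΦ, LinearMap.comp_assoc, hD, ← LinearMap.comp_assoc,
      LinearMap.comp_add, ← TensorProduct.map_comp, ← TensorProduct.map_comp, LinearMap.comp_id]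
  have h2 : comul 𝒲 ∘ₗ D' ∘ₗ Φ = (TensorProduct.map (D' ∘ₗ Φ) Φ +
      TensorProduct.map ((parity 𝒲).toLinearMap ∘ₗ Φ) (D' ∘ₗ Φ)) ∘ₗ comul 𝒱 := by
    rw [← LinearMap.comp_assoc, hD', LinearMap.comp_assoc, hΦ, ← LinearMap.comp_assoc,
      LinearMap.add_comp, ← TensorProduct.map_comp, ← TensorProduct.map_comp, LinearMap.id_comp]
  rw [LinearMap.comp_sub, h1, h2, hP, ← LinearMap.sub_comp, tensorMap_sub_left,
    tensorMap_sub_right]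
  congr 1
  abel

end Universal

section Map

variable {F : Type*} [Field F] {V : Type*} [AddCommGroup V] [Module F V]
  {𝒱 : ℤ → Submodule F V} {W : Type*} [AddCommGroup W] [Module F W] {𝒲 : ℤ → Submodule F W}

/-! ### The coalgebra map induced by a linear map -/

section

variable {f : V →ₗ[F] W} (hf : ∀ i, ∀ x ∈ 𝒱 i, f x ∈ 𝒲 i)

@[simp]
theorem map_ι (x : V) : map f hf (ι 𝒱 x) = ι 𝒲 (f x) := by simp [map]

theorem map_mem_degree {n : ℤ} {c : GSym 𝒱} (hc : c ∈ degree 𝒱 n) : map f hf c ∈ degree 𝒲 n := by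
  rw [degree_eq_wordSpan] at hc
  induction hc using wordSpan_induction with
  | one => rw [map_one]; exact one_mem_wordSpan (w := id)
  | ι_mul i x hx m c _ ih =>
    rw [map_mul, map_ι]; exact ι_mul_mem_wordSpan (w := id) (hf i x hx) ih
  | zero m => simp
  | add m a b _ _ h1 h2 => rw [map_add]; exact add_mem h1 h2
  | smul m r a _ h => rw [map_smul]; exact Submodule.smul_mem _ _ h

@[simp]
theorem counit_map (c : GSym 𝒱) : counit 𝒲 (map f hf c) = counit 𝒱 c :=
  AlgHom.congr_fun (algHom_ext (f := (counit 𝒲).comp (map f hf)) fun x => by simp) c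

variable [DirectSum.Decomposition 𝒱]

@[simp]
theorem pr_map (c : GSym 𝒱) : pr 𝒲 (map f hf c) = f (pr 𝒱 c) :=
  LinearMap.congr_fun (f := pr 𝒲 ∘ₗ (map f hf).toLinearMap) (g := f ∘ₗ pr 𝒱)
    (word_hom_ext (by simp) fun i x _ c _ => by simp) c

theorem comul_map [DirectSum.Decomposition 𝒲] : comul 𝒲 ∘ₗ (map f hf).toLinearMap =
    TensorProduct.map (map f hf).toLinearMap (map f hf).toLinearMap ∘ₗ comul 𝒱 := by
  refine word_hom_ext (by simp [comul_one]) fun i x hx c hc => ?_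
  simp only [LinearMap.comp_apply, AlgHom.toLinearMap_apply, map_mul, map_ι] at hc ⊢
  rw [comul_ι_mul 𝒲 (hf i x hx), comul_ι_mul 𝒱 hx, hc]
  refine LinearMap.congr_fun (f := primMul 𝒲 i (f x) ∘ₗ TensorProduct.map _ _)
    (g := TensorProduct.map _ _ ∘ₗ primMul 𝒱 i x) (tmul_degree_hom_ext fun j k a ha b hb => ?_) _
  simp [koszul_of_mem ha, koszul_of_mem (map_mem_degree hf ha)]

end

/-! ### Invertible morphisms of coalgebras -/

/-- The elements that are sums of words of length less than `n`. -/
def lengthLT (𝒱 : ℤ → Submodule F V) (n : ℕ) : Submodule F (GSym 𝒱) :=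
  ⨆ k, ⨆ (_ : k < n), length 𝒱 k

theorem length_le_lengthLT {k n : ℕ} (h : k < n) : length 𝒱 k ≤ lengthLT 𝒱 n :=
  le_iSup₂_of_le (f := fun k (_ : k < n) => length 𝒱 k) k h le_rfl

variable [DirectSum.Decomposition 𝒱]

theorem exists_mem_lengthLT (c : GSym 𝒱) : ∃ n, c ∈ lengthLT 𝒱 n := by
  have hmono : Monotone (lengthLT 𝒱) := fun m n h =>
    iSup₂_le fun k hk => length_le_lengthLT (by omega)
  have hc : c ∈ ⨆ m, length 𝒱 m :=
    iSup_wordSpan (𝒱 := 𝒱) (s := 𝒱) (w := fun _ => 1) iSup_eq_top ▸ Submodule.mem_top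
  induction hc using Submodule.iSup_induction' with
  | mem m c hc => exact ⟨m + 1, length_le_lengthLT (Nat.lt_succ_self m) hc⟩
  | zero => exact ⟨0, zero_mem _⟩
  | add a b _ _ ha hb =>
    obtain ⟨m, hm⟩ := ha
    obtain ⟨n, hn⟩ := hb
    exact ⟨max m n, add_mem (hmono (le_max_left _ _) hm) (hmono (le_max_right _ _) hn)⟩

theorem ι_mem_length (x : V) : ι 𝒱 x ∈ length 𝒱 1 := by
  have h : ⨆ i, 𝒱 i ≤ (length 𝒱 1).comap (ι 𝒱) :=
    iSup_le fun i x hx => ι_mem_wordSpan (w := fun _ => 1) hx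
  exact h (iSup_eq_top (𝒱 := 𝒱) ▸ Submodule.mem_top)

theorem convPow_mem_length (f : GSym 𝒱 →ₗ[F] V) (n : ℕ) (c : GSym 𝒱) :
    convPow (ι 𝒱 ∘ₗ f) n c ∈ length 𝒱 n := by
  induction n generalizing c with
  | zero =>
    simp only [convPow, LinearMap.comp_apply, Algebra.linearMap_apply,
      Algebra.algebraMap_eq_smul_one]
    exact Submodule.smul_mem _ _ one_mem_length
  | succ n ih =>
    simp only [convPow, conv, LinearMap.comp_apply]
    generalize comul 𝒱 c = t
    induction t with
    | zero => simp
    | tmul a b =>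
      rw [add_comm n 1]
      exact mul_mem_wordSpan (ι_mem_length (f a)) (ih b)
    | add a b ha hb => simp only [map_add]; exact add_mem ha hb

variable {f : GSym 𝒱 →ₗ[F] V}

theorem convPow_sub_mem_vanishingBelow (hf : f - pr 𝒱 ∈ vanishingBelow 𝒱 V 2) (n : ℕ) :
    convPow (ι 𝒱 ∘ₗ f) n - convPow (ι 𝒱 ∘ₗ pr 𝒱) n ∈ vanishingBelow 𝒱 (GSym 𝒱) (n + 1) := by
  have hpr : ι 𝒱 ∘ₗ pr 𝒱 ∈ vanishingBelow 𝒱 (GSym 𝒱) 1 := mem_vanishingBelow_one (by simp)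
  have hd : ι 𝒱 ∘ₗ f - ι 𝒱 ∘ₗ pr 𝒱 ∈ vanishingBelow 𝒱 (GSym 𝒱) 2 := fun m hm c hc => by
    simpa using congrArg (ι 𝒱) (hf m hm c hc)
  have hf' : ι 𝒱 ∘ₗ f ∈ vanishingBelow 𝒱 (GSym 𝒱) 1 := by
    have := add_mem (vanishingBelow_mono (by omega) hd) hpr
    rwa [sub_add_cancel] at this
  induction n with
  | zero => simp [convPow]
  | succ n ih =>
    have e : convPow (ι 𝒱 ∘ₗ f) (n + 1) - convPow (ι 𝒱 ∘ₗ pr 𝒱) (n + 1) =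
        conv (ι 𝒱 ∘ₗ f) (convPow (ι 𝒱 ∘ₗ f) n - convPow (ι 𝒱 ∘ₗ pr 𝒱) n) +
        conv (ι 𝒱 ∘ₗ f - ι 𝒱 ∘ₗ pr 𝒱) (convPow (ι 𝒱 ∘ₗ pr 𝒱) n) := by
      simp only [convPow, conv, tensorMap_sub_left, tensorMap_sub_right, LinearMap.comp_sub,
        LinearMap.sub_comp]
      abel
    rw [e]
    refine add_mem ?_ ?_
    · rw [add_comm (n + 1)]; exact conv_mem_vanishingBelow hf' ih
    · rw [show n + 1 + 1 = 2 + n by omega]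
      exact conv_mem_vanishingBelow hd (convPow_mem_vanishingBelow hpr n)

variable [CharZero F]

theorem cohom_sub_mem_lengthLT (hf1 : f 1 = 0) (hf : f - pr 𝒱 ∈ vanishingBelow 𝒱 V 2) {n : ℕ}
    {c : GSym 𝒱} (hc : c ∈ lengthLT 𝒱 (n + 1)) : cohom 𝒱 f c - c ∈ lengthLT 𝒱 n := by
  suffices h : lengthLT 𝒱 (n + 1) ≤ (lengthLT 𝒱 n).comap (cohom 𝒱 f - LinearMap.id) from h hc
  refine iSup₂_le fun m hm c hc => ?_
  have h := convPow_sub_mem_vanishingBelow hf m m (Nat.lt_succ_self m) c hc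
  rw [LinearMap.sub_apply, sub_eq_zero, convPow_pr_of_mem m hc, if_pos rfl] at h
  rw [Submodule.mem_comap, LinearMap.sub_apply, cohom_of_mem hf1 (Nat.lt_succ_self m) hc,
    Finset.sum_range_succ, h, smul_smul, inv_mul_cancel₀ (Nat.cast_ne_zero.mpr
      (Nat.factorial_ne_zero _)), one_smul, LinearMap.id_apply, add_sub_cancel_right]
  refine Submodule.sum_mem _ fun k hk => Submodule.smul_mem _ _ ?_
  exact length_le_lengthLT (by have := Finset.mem_range.mp hk; omega) (convPow_mem_length f k c)

/-- A morphism of coalgebras whose linear part is the identity is injective: it is the identity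
up to terms of lower word length. -/
theorem cohom_injective (hf1 : f 1 = 0) (hf : f - pr 𝒱 ∈ vanishingBelow 𝒱 V 2) :
    Function.Injective (cohom 𝒱 f) := by
  rw [injective_iff_map_eq_zero]
  intro c hc
  suffices h : ∀ n, c ∈ lengthLT 𝒱 n → c = 0 from (exists_mem_lengthLT c).elim h
  intro n
  induction n with
  | zero => intro h; simpa [lengthLT] using h
  | succ n ih =>
    intro h
    have := cohom_sub_mem_lengthLT hf1 hf h
    rw [hc, zero_sub] at this
    exact ih (by simpa using neg_mem this)

/-- A morphism of coalgebras whose linear part is the identity is surjective, also on every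
subspace that it preserves. -/
theorem exists_cohom_eq (hf1 : f 1 = 0) (hf : f - pr 𝒱 ∈ vanishingBelow 𝒱 V 2)
    {N : Submodule F (GSym 𝒱)} (hN : ∀ c ∈ N, cohom 𝒱 f c ∈ N) {y : GSym 𝒱} (hy : y ∈ N) :
    ∃ c ∈ N, cohom 𝒱 f c = y := by
  obtain ⟨n, hn⟩ := exists_mem_lengthLT y
  induction n generalizing y with
  | zero => exact ⟨0, zero_mem _, by simpa [lengthLT, eq_comm] using hn⟩
  | succ n ih =>
    obtain ⟨c, hc, h⟩ := ih (y := cohom 𝒱 f y - y) (sub_mem (hN y hy) hy)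
      (cohom_sub_mem_lengthLT hf1 hf hn)
    exact ⟨y - c, sub_mem hy hc, by rw [map_sub, h, sub_sub_cancel]⟩

end Map

/-! ### Brackets of linear maps on the symmetric coalgebra -/

section Cup

variable {F : Type*} [Field F] {V : Type*} [AddCommGroup V] [Module F V]
  {𝒱 : ℤ → Submodule F V} [DirectSum.Decomposition 𝒱]
  {L : Type*} [AddCommGroup L] [Module F L] {𝓛 : ℤ → Submodule F L} {B : L →ₗ[F] L →ₗ[F] L}
  {a b : GSym 𝒱 →ₗ[F] L}

theorem cup_mem (hB : ∀ i j, ∀ x ∈ 𝓛 i, ∀ y ∈ 𝓛 j, B x y ∈ 𝓛 (i + j))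
    (ha : ∀ n, ∀ c ∈ degree 𝒱 n, a c ∈ 𝓛 (n - 1)) (hb : ∀ n, ∀ c ∈ degree 𝒱 n, b c ∈ 𝓛 (n - 1))
    {n : ℤ} {c : GSym 𝒱} (hc : c ∈ degree 𝒱 n) : cup B a b c ∈ 𝓛 (n - 2) := by
  rw [cup, ← LinearMap.comp_assoc, LinearMap.comp_apply]
  refine comul_induction_degree hc fun j k h p hp q hq => ?_
  rw [show n - 2 = j - 1 + (k - 1) by omega]
  simp only [LinearMap.comp_apply, TensorProduct.map_tmul, TensorProduct.lift.tmul,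
    AlgHom.toLinearMap_apply, parity_of_mem hp, map_smul, LinearMap.smul_apply]
  exact Submodule.smul_mem _ _ (hB _ _ _ (ha j p hp) _ (hb k q hq))

theorem cup_one (ha : a 1 = 0) : cup B a b 1 = 0 := by
  simp [cup, comul_one, ha]

theorem cup_compr₂ (g : L →ₗ[F] L) :
    cup (B.compr₂ g) a b = g ∘ₗ cup B a b := by
  simp only [cup, ← LinearMap.comp_assoc]
  congr 2
  exact TensorProduct.ext' fun x y => by simp

theorem parity_mem_length {n : ℕ} {c : GSym 𝒱} (hc : c ∈ length 𝒱 n) :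
    parity 𝒱 c ∈ length 𝒱 n := by
  have := koszul_mem_wordSpan (𝒱 := 𝒱) (s := 𝒱) (w := fun _ => 1) (fun t => ⟨t, le_rfl⟩) 1 hc
  rwa [koszul_of_odd odd_one] at this

theorem cup_mem_vanishingBelow (ha : a 1 = 0) (hb : b 1 = 0) :
    cup B a b ∈ vanishingBelow 𝒱 L 2 := by
  intro m hm c hc
  rw [cup, ← LinearMap.comp_assoc, LinearMap.comp_apply]
  refine comul_congr_length (H := 0) hc fun j k h p hp q hq => ?_
  rcases Nat.eq_zero_or_pos j with hj | hj
  · simp [mem_vanishingBelow_one ha j (by omega) _ (parity_mem_length hp)]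
  · simp [mem_vanishingBelow_one hb k (by omega) q hq]

/-- Brackets are natural with respect to morphisms of coalgebras. -/
theorem cup_comp {W : Type*} [AddCommGroup W] [Module F W] {𝒲 : ℤ → Submodule F W}
    [DirectSum.Decomposition 𝒲] {Φ : GSym 𝒲 →ₗ[F] GSym 𝒱}
    (hΦ : comul 𝒱 ∘ₗ Φ = TensorProduct.map Φ Φ ∘ₗ comul 𝒲)
    (hdeg : ∀ n, ∀ c ∈ degree 𝒲 n, Φ c ∈ degree 𝒱 n) :
    cup B a b ∘ₗ Φ = cup B (a ∘ₗ Φ) (b ∘ₗ Φ) := by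
  have hP : (parity 𝒱).toLinearMap ∘ₗ Φ = Φ ∘ₗ (parity 𝒲).toLinearMap :=
    degree_hom_ext fun n c hc => by simp [parity_of_mem hc, parity_of_mem (hdeg n c hc)]
  rw [cup, cup, LinearMap.comp_assoc, LinearMap.comp_assoc, hΦ,
    ← LinearMap.comp_assoc (comul 𝒲), ← TensorProduct.map_comp, LinearMap.comp_assoc _ _ a, hP]
  rfl

end Cup

end GSym

/-! ### Codifferentials -/

namespace GSym

section Codifferential

variable {F : Type*} [Field F] {V : Type*} [AddCommGroup V] [Module F V]
  {𝒱 : ℤ → Submodule F V}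

theorem degree_eq_bot (h𝒱 : ∀ i, 0 < i → 𝒱 i = ⊥) {n : ℤ} (hn : 0 < n) : degree 𝒱 n = ⊥ := by
  rw [eq_bot_iff]
  intro c hc
  rw [degree_eq_wordSpan] at hc
  rw [Submodule.mem_bot]
  induction hc using wordSpan_induction with
  | one => omega
  | ι_mul i x hx m c _ ih =>
    rcases lt_or_ge 0 i with hi | hi
    · rw [h𝒱 i hi, Submodule.mem_bot] at hx
      simp [hx]
    · rw [id] at hn
      rw [ih (by omega), mul_zero]
  | zero m => rfl
  | add m a b _ _ h1 h2 => rw [h1 hn, h2 hn, add_zero]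
  | smul m r a _ h => rw [h hn, smul_zero]

variable [DirectSum.Decomposition 𝒱]

theorem isCodifferential_zero : IsCodifferential (0 : GSym 𝒱 →ₗ[F] GSym 𝒱) where
  mem n c _ := zero_mem _
  square := by simp
  comul := by simp
  one := rfl

/-- A coderivation `coder f` of degree `-1` is a differential if `f (coder f) = 0`: its square is a
coderivation, and so is determined by its corestriction. -/
theorem isCodifferential_coder [CharZero F] {f : GSym 𝒱 →ₗ[F] V}
    (hf : ∀ n, ∀ c ∈ degree 𝒱 n, f c ∈ 𝒱 (n - 1)) (hf1 : f 1 = 0) (hff : ∀ c, f (coder f c) = 0) :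
    IsCodifferential (coder f) where
  mem n c hc := coder_mem_degree hf hc
  square := by
    have hP : coder f ∘ₗ (parity 𝒱).toLinearMap = -((parity 𝒱).toLinearMap ∘ₗ coder f) :=
      degree_hom_ext fun n c hc => by
        have h : coder f c ∈ degree 𝒱 (n - 1) := coder_mem_degree hf hc
        simp [parity_of_mem hc, parity_of_mem h, zpow_sub₀, div_neg]
    have hPP : (parity 𝒱).toLinearMap ∘ₗ (parity 𝒱).toLinearMap = LinearMap.id :=
      LinearMap.ext parity_parity
    refine eq_zero_of_pr_eq_zero (Φ := LinearMap.id) (Ψ := LinearMap.id) ?_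
      (fun c => counit_coder f _) (fun c => (pr_coder f _).trans (hff c))
    rw [← LinearMap.comp_assoc, comul_coder hf, LinearMap.comp_assoc, comul_coder hf,
      ← LinearMap.comp_assoc]
    congr 1
    simp only [LinearMap.comp_add, LinearMap.add_comp, ← TensorProduct.map_comp, hP, hPP,
      LinearMap.id_comp, LinearMap.comp_id]
    have : TensorProduct.map (-((parity 𝒱).toLinearMap ∘ₗ coder f)) (coder f) =
        -TensorProduct.map ((parity 𝒱).toLinearMap ∘ₗ coder f) (coder f) :=
      TensorProduct.ext' fun a b => by simp [TensorProduct.neg_tmul]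
    rw [this]
    abel
  comul := comul_coder hf
  one := coder_one hf1

end Codifferential

end GSym

/-! ### The classifying coalgebra in degrees `-1` and `-2` -/

namespace DGLie

section Lie

variable {F : Type*} [Field F] {L : Type*} [AddCommGroup L] [Module F L]
  {𝓛 : ℤ → Submodule F L}

theorem Concentrated.shift_eq_bot (h : Concentrated 𝓛) {i : ℤ} (hi : 0 < i) : shift 𝓛 i = ⊥ :=
  h _ (by omega) (by omega)

/-- On the symmetric coalgebra on a space of degrees `≤ 0`, a map of degree `-3` to a space
concentrated in degrees `-1` and `-2` is zero. -/
theorem eq_zero_of_degree {V : Type*} [AddCommGroup V] [Module F V] {𝒱 : ℤ → Submodule F V}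
    [DirectSum.Decomposition 𝒱] (h𝒱 : ∀ i, 0 < i → 𝒱 i = ⊥) (h : Concentrated 𝓛)
    {g : GSym 𝒱 →ₗ[F] L} (hg : ∀ n, ∀ c ∈ GSym.degree 𝒱 n, g c ∈ 𝓛 (n - 3)) : g = 0 := by
  refine GSym.degree_hom_ext fun n c hc => ?_
  rcases lt_or_ge 0 n with hn | hn
  · rw [GSym.degree_eq_bot h𝒱 hn, Submodule.mem_bot] at hc
    rw [hc, map_zero, map_zero]
  · have := hg n c hc
    rwa [h _ (by omega) (by omega), Submodule.mem_bot] at this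

theorem pr_mem {n : ℤ} {c : GSym (shift 𝓛)} (hc : c ∈ GSym.degree (shift 𝓛) n) :
    GSym.pr (shift 𝓛) c ∈ 𝓛 (n - 1) :=
  GSym.pr_mem_degree hc

variable (K : DGLie 𝓛)

theorem homologyGrading_concentrated (h : Concentrated 𝓛) : Concentrated K.homologyGrading := by
  intro i h1 h2
  rw [eq_bot_iff]
  rintro _ ⟨x, hx, rfl⟩
  have hx' : (x : L) ∈ 𝓛 i := hx
  rw [h i h1 h2, Submodule.mem_bot] at hx'
  rw [Submodule.mem_bot, show x = 0 from Subtype.ext hx', map_zero]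

variable [DirectSum.Decomposition 𝓛]

/-- The corestriction of the differential of the classifying coalgebra to the cogenerators. -/
def ceGen : GSym (shift 𝓛) →ₗ[F] L :=
  -(K.d ∘ₗ GSym.pr (shift 𝓛)) +
    (2⁻¹ : F) • GSym.cup K.bracket (GSym.pr (shift 𝓛)) (GSym.pr (shift 𝓛))

theorem ceDiff_eq : K.ceDiff = GSym.coder K.ceGen := rfl

theorem ceGen_mem (n : ℤ) (c : GSym (shift 𝓛)) (hc : c ∈ GSym.degree (shift 𝓛) n) :
    K.ceGen c ∈ shift 𝓛 (n - 1) := by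
  change K.ceGen c ∈ 𝓛 (n - 1 - 1)
  refine add_mem (neg_mem (K.d_mem _ _ (pr_mem hc))) (Submodule.smul_mem _ _ ?_)
  rw [show n - 1 - 1 = n - 2 by omega]
  exact GSym.cup_mem K.bracket_mem (fun n c hc => pr_mem hc) (fun n c hc => pr_mem hc) hc

theorem ceGen_one : K.ceGen 1 = 0 := by simp [ceGen, GSym.cup_one]

/-- In degrees `-1` and `-2` the square of the differential of the classifying coalgebra vanishes for
degree reasons. -/
theorem isCodifferential_ceDiff [CharZero F] (h : Concentrated 𝓛) :
    GSym.IsCodifferential K.ceDiff := by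
  refine GSym.isCodifferential_coder K.ceGen_mem K.ceGen_one fun c => ?_
  refine LinearMap.congr_fun (f := K.ceGen ∘ₗ GSym.coder K.ceGen)
    (eq_zero_of_degree (𝓛 := 𝓛) (fun i => h.shift_eq_bot) h fun n c hc => ?_) c
  have := K.ceGen_mem _ _ (GSym.coder_mem_degree K.ceGen_mem hc)
  change _ ∈ 𝓛 (n - 1 - 1 - 1) at this
  rwa [show n - 1 - 1 - 1 = n - 3 by omega] at this

end Lie

end DGLie

/-! ### The universal solution of the deformation equation -/

section Tau

variable {F : Type*} [Field F] {L : Type*} [AddCommGroup L] [Module F L]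
  {H : Type*} [AddCommGroup H] [Module F H] {𝓗 : ℤ → Submodule F H}
  {𝓛 : ℤ → Submodule F L} {d : L →ₗ[F] L} (c : Contraction 𝓗 0 𝓛 d) {B : L →ₗ[F] L →ₗ[F] L}

/-- The side conditions make `d h` idempotent. -/
theorem Contraction.h_d_h (x : L) : c.h (d (c.h x)) = c.h x := by
  have := c.homotopy (c.h x)
  rwa [c.h_h, map_zero, zero_add, c.proj_h, map_zero, sub_zero] at this

variable [DirectSum.Decomposition 𝓗]

theorem tauTerm_zero (B : L →ₗ[F] L →ₗ[F] L) : tauTerm c B 0 = 0 := by rw [tauTerm]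

theorem tauTerm_eq (B : L →ₗ[F] L →ₗ[F] L) {ℓ : ℕ} (hℓ : 2 ≤ ℓ) :
    tauTerm c B ℓ = (2⁻¹ : F) • c.h ∘ₗ ∑ j ∈ Finset.Ioo 0 ℓ,
      GSym.cup B (tauTerm c B j) (tauTerm c B (ℓ - j)) := by
  obtain ⟨ℓ, rfl⟩ := Nat.exists_eq_add_of_le' hℓ
  rw [tauTerm]
  congr 2
  rw [Fin.sum_univ_eq_sum_range
    (fun j => GSym.cup B (tauTerm c B (j + 1)) (tauTerm c B (ℓ + 1 - j)))]
  refine Finset.sum_bij (fun j _ => j + 1) (fun j hj => ?_) (fun i _ j _ h => by omega)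
    (fun j hj => ⟨j - 1, ?_⟩) (fun j hj => ?_)
  · simp only [Finset.mem_range, Finset.mem_Ioo] at hj ⊢; omega
  · simp only [Finset.mem_range, Finset.mem_Ioo] at hj ⊢; exact ⟨by omega, by omega⟩
  · rw [show ℓ + 2 - (j + 1) = ℓ + 1 - j by omega]

/-- `τ^ℓ` vanishes on words whose length is not `ℓ`. -/
theorem tauTerm_of_ne (B : L →ₗ[F] L →ₗ[F] L) (ℓ : ℕ) : ∀ m ≠ ℓ, ∀ x ∈ GSym.length (shift 𝓗) m,
    tauTerm c B ℓ x = 0 := by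
  induction ℓ using Nat.strong_induction_on with
  | _ ℓ ih =>
    intro m hm x hx
    rcases lt_or_ge ℓ 2 with hℓ | hℓ
    · interval_cases ℓ
      · rw [tauTerm_zero, LinearMap.zero_apply]
      · simp [tauTerm, GSym.pr_of_mem_length hm hx]
    · rw [tauTerm_eq c B hℓ, LinearMap.smul_apply, LinearMap.comp_apply, LinearMap.sum_apply,
        Finset.sum_eq_zero, map_zero, smul_zero]
      intro j hj
      rw [Finset.mem_Ioo] at hj
      rw [GSym.cup, ← LinearMap.comp_assoc, LinearMap.comp_apply]
      refine GSym.comul_congr_length (H := 0) hx fun p q h a ha b hb => ?_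
      by_cases hp : p = j
      · simp [ih (ℓ - j) (by omega) q (by omega) b hb]
      · simp [ih j (by omega) p hp _ (GSym.parity_mem_length ha)]

theorem tau_of_mem (B : L →ₗ[F] L →ₗ[F] L) {ℓ : ℕ} {x : GSym (shift 𝓗)}
    (hx : x ∈ GSym.length (shift 𝓗) ℓ) : tau c B x = tauTerm c B ℓ x :=
  GSym.ofLength_of_mem _ hx

/-- The component of the bracket `[τ, τ]` on words of length `ℓ`. -/
theorem cup_tau_of_mem (B B' : L →ₗ[F] L →ₗ[F] L) {ℓ : ℕ} {x : GSym (shift 𝓗)}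
    (hx : x ∈ GSym.length (shift 𝓗) ℓ) :
    (∑ j ∈ Finset.Ioo 0 ℓ, GSym.cup B' (tauTerm c B j) (tauTerm c B (ℓ - j))) x =
      GSym.cup B' (tau c B) (tau c B) x := by
  have e : (∑ j ∈ Finset.Ioo 0 ℓ, GSym.cup B' (tauTerm c B j) (tauTerm c B (ℓ - j))) x =
      (∑ j ∈ Finset.Ioo 0 ℓ, TensorProduct.lift B' ∘ₗ TensorProduct.map
        (tauTerm c B j ∘ₗ (GSym.parity (shift 𝓗)).toLinearMap) (tauTerm c B (ℓ - j)))
          (GSym.comul (shift 𝓗) x) := by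
    simp only [LinearMap.sum_apply]; rfl
  rw [e, GSym.cup, ← LinearMap.comp_assoc, LinearMap.comp_apply]
  refine GSym.comul_congr_length hx fun p q h a ha b hb => ?_
  have ha' := GSym.parity_mem_length ha
  simp only [LinearMap.sum_apply, LinearMap.comp_apply, TensorProduct.map_tmul,
    TensorProduct.lift.tmul, AlgHom.toLinearMap_apply, tau_of_mem c B ha', tau_of_mem c B hb]
  subst h
  rw [Finset.sum_eq_single p]
  · rw [Nat.add_sub_cancel_left]
  · intro j _ hj
    rw [tauTerm_of_ne c B j p hj.symm _ ha', map_zero, LinearMap.zero_apply]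
  · intro hp
    rw [Finset.mem_Ioo] at hp
    rcases Nat.eq_zero_or_pos p with h0 | h0
    · simp [h0, tauTerm_zero]
    · obtain rfl : q = 0 := by omega
      simp [tauTerm_zero]

/-- The map `τ` solves the fixed point equation `τ = τ^1 + 1/2 h [τ, τ]`. -/
theorem tau_eq (B : L →ₗ[F] L →ₗ[F] L) : tau c B = c.incl ∘ₗ GSym.pr (shift 𝓗) +
    (2⁻¹ : F) • c.h ∘ₗ GSym.cup B (tau c B) (tau c B) := by
  refine GSym.length_hom_ext fun ℓ x hx => ?_
  rw [tau_of_mem c B hx, LinearMap.add_apply, LinearMap.smul_apply, LinearMap.comp_apply c.h,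
    ← cup_tau_of_mem c B B hx]
  rcases lt_or_ge ℓ 2 with hℓ | hℓ
  · have h : Finset.Ioo 0 ℓ = ∅ := by
      ext j; simp only [Finset.mem_Ioo, Finset.notMem_empty, iff_false]; omega
    rw [h]
    interval_cases ℓ
    · simp [tauTerm_zero, GSym.pr_of_mem_length zero_ne_one hx]
    · simp [tauTerm]
  · rw [tauTerm_eq c B hℓ, LinearMap.comp_apply, GSym.pr_of_mem_length (by omega) hx, map_zero,
      zero_add]
    rfl

theorem calD_eq (B : L →ₗ[F] L →ₗ[F] L) : calD c B =
    GSym.coder ((2⁻¹ : F) • c.proj ∘ₗ GSym.cup B (tau c B) (tau c B)) := by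
  rw [calD]
  congr 1
  refine GSym.length_hom_ext fun ℓ x hx => ?_
  rw [GSym.ofLength_of_mem _ hx, LinearMap.smul_apply, LinearMap.smul_apply, LinearMap.comp_apply,
    LinearMap.comp_apply, cup_tau_of_mem c B B hx]

theorem tauTerm_mem (hB : ∀ i j, ∀ x ∈ 𝓛 i, ∀ y ∈ 𝓛 j, B x y ∈ 𝓛 (i + j)) (ℓ : ℕ) :
    ∀ n, ∀ x ∈ GSym.degree (shift 𝓗) n, tauTerm c B ℓ x ∈ 𝓛 (n - 1) := by
  induction ℓ using Nat.strong_induction_on with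
  | _ ℓ ih =>
    intro n x hx
    rcases lt_or_ge ℓ 2 with hℓ | hℓ
    · interval_cases ℓ
      · simp [tauTerm_zero]
      · rw [tauTerm]
        exact c.incl_mem _ _ (DGLie.pr_mem hx)
    · rw [tauTerm_eq c B hℓ, LinearMap.smul_apply, LinearMap.comp_apply, LinearMap.sum_apply,
        show n - 1 = n - 2 + 1 by omega]
      refine Submodule.smul_mem _ _ (c.h_mem _ _ (Submodule.sum_mem _ fun j hj => ?_))
      rw [Finset.mem_Ioo] at hj
      exact GSym.cup_mem hB (ih j (by omega)) (ih (ℓ - j) (by omega)) hx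

theorem tau_mem (hB : ∀ i j, ∀ x ∈ 𝓛 i, ∀ y ∈ 𝓛 j, B x y ∈ 𝓛 (i + j)) (n : ℤ)
    (x : GSym (shift 𝓗)) (hx : x ∈ GSym.degree (shift 𝓗) n) : tau c B x ∈ 𝓛 (n - 1) :=
  GSym.ofLength_mem (fun ℓ => tauTerm_mem c hB ℓ n) hx

theorem tau_one (B : L →ₗ[F] L →ₗ[F] L) : tau c B 1 = 0 := by
  rw [tau_of_mem c B GSym.one_mem_length, tauTerm_zero, LinearMap.zero_apply]

/-- The recursion only involves the homotopy applied to the bracket, and `h d h = h`; hence the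
bracket may be replaced by its component `d h B`. -/
theorem tauTerm_compr₂ (B : L →ₗ[F] L →ₗ[F] L) (ℓ : ℕ) :
    tauTerm c (B.compr₂ (d ∘ₗ c.h)) ℓ = tauTerm c B ℓ := by
  induction ℓ using Nat.strong_induction_on with
  | _ ℓ ih =>
    rcases lt_or_ge ℓ 2 with hℓ | hℓ
    · interval_cases ℓ
      · simp only [tauTerm_zero]
      · simp only [tauTerm]
    · rw [tauTerm_eq c _ hℓ, tauTerm_eq c _ hℓ]
      ext x
      simp only [LinearMap.smul_apply, LinearMap.comp_apply, LinearMap.sum_apply, map_sum]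
      congr 1
      refine Finset.sum_congr rfl fun j hj => ?_
      rw [Finset.mem_Ioo] at hj
      rw [GSym.cup_compr₂, ih j (by omega), ih (ℓ - j) (by omega)]
      exact c.h_d_h _

theorem tau_compr₂ (B : L →ₗ[F] L →ₗ[F] L) : tau c (B.compr₂ (d ∘ₗ c.h)) = tau c B := by
  rw [tau, tau, show tauTerm c (B.compr₂ (d ∘ₗ c.h)) = tauTerm c B from
    funext (tauTerm_compr₂ c B)]

end Tau

/-! ### Linear coderivations are derivations -/

namespace GSym

section Derivation

variable {F : Type*} [Field F] {V : Type*} [AddCommGroup V] [Module F V]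
  {𝒱 : ℤ → Submodule F V} [DirectSum.Decomposition 𝒱] {g g' : V →ₗ[F] V} {e e' : ℤ}

/-- A coderivation of odd degree cogenerated by a linear map of `V` is a derivation of the
symmetric algebra. -/
theorem coder_pr_ι_mul (he : Odd e) (hg : ∀ i, ∀ x ∈ 𝒱 i, g x ∈ 𝒱 (i + e)) {i : ℤ} {x : V}
    (hx : x ∈ 𝒱 i) (c : GSym 𝒱) : coder (g ∘ₗ pr 𝒱) (ι 𝒱 x * c) =
      ι 𝒱 (g x) * c + ((-1 : F) ^ i) • (ι 𝒱 x * coder (g ∘ₗ pr 𝒱) c) := by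
  have h : LinearMap.mul' F _ ∘ₗ TensorProduct.map (ι 𝒱 ∘ₗ g ∘ₗ pr 𝒱) LinearMap.id ∘ₗ
        primMul 𝒱 i x =
      LinearMap.mulLeft F (ι 𝒱 (g x)) ∘ₗ (LinearMap.mul' F _ ∘ₗ
        TensorProduct.map (convPow (ι 𝒱 ∘ₗ pr 𝒱) 0) LinearMap.id) +
      ((-1 : F) ^ i) • LinearMap.mulLeft F (ι 𝒱 x) ∘ₗ (LinearMap.mul' F _ ∘ₗ
        TensorProduct.map (ι 𝒱 ∘ₗ g ∘ₗ pr 𝒱) LinearMap.id) := by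
    refine tmul_degree_hom_ext fun j k a ha b hb => ?_
    have hga : ι 𝒱 (g (pr 𝒱 a)) ∈ degree 𝒱 (j + e) :=
      ι_mem_wordSpan (w := id) (hg j _ (pr_mem_degree ha))
    have hc : ((-1 : F) ^ i) • (ι 𝒱 x * (ι 𝒱 (g (pr 𝒱 a)) * b)) =
        ((-1 : F) ^ (i * j)) • (ι 𝒱 (g (pr 𝒱 a)) * (ι 𝒱 x * b)) := by
      rw [← mul_assoc, mul_comm_of_mem (ι_mem_wordSpan (w := id) hx) hga, smul_mul_assoc,
        smul_smul, mul_assoc]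
      congr 1
      obtain ⟨k, rfl⟩ := he
      change (-1 : F) ^ i * (-1) ^ (i * (j + (2 * k + 1))) = _
      rw [← zpow_add₀ (by simp), show i + i * (j + (2 * k + 1)) = i * j + 2 * (i * k + i) by ring,
        zpow_add₀ (by simp), zpow_mul _ 2]
      simp
    simp only [LinearMap.comp_apply, primMul_tmul, map_add, TensorProduct.map_tmul,
      LinearMap.mul'_apply, LinearMap.add_apply, LinearMap.smul_apply, LinearMap.mulLeft_apply,
      LinearMap.id_apply, hc, koszul_of_mem ha, map_smul, pr_ι_mul, smul_mul_assoc]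
    simp [convPow, Algebra.algebraMap_eq_smul_one]
  have h0 : conv (convPow (ι 𝒱 ∘ₗ pr 𝒱) 0) (LinearMap.id : GSym 𝒱 →ₗ[F] GSym 𝒱) =
    LinearMap.id := unit_conv _ _
  have h1 : (LinearMap.mul' F _ ∘ₗ TensorProduct.map (convPow (ι 𝒱 ∘ₗ pr 𝒱) 0)
      (LinearMap.id : GSym 𝒱 →ₗ[F] GSym 𝒱)) (comul 𝒱 c) = c := LinearMap.congr_fun h0 c
  have h2 := LinearMap.congr_fun h (comul 𝒱 c)
  rw [LinearMap.add_apply, LinearMap.comp_apply (LinearMap.mulLeft F (ι 𝒱 (g x))), h1,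
    LinearMap.mulLeft_apply] at h2
  rw [coder, conv, LinearMap.comp_apply, LinearMap.comp_apply, comul_ι_mul 𝒱 hx]
  exact h2

theorem coder_pr_one : coder (g ∘ₗ pr 𝒱) 1 = 0 := coder_one (by simp)

/-- The anticommutator of two derivations of odd degree is a derivation of even degree. -/
theorem coder_pr_anticomm_ι_mul (he : Odd e) (hg : ∀ i, ∀ x ∈ 𝒱 i, g x ∈ 𝒱 (i + e)) (he' : Odd e')
    (hg' : ∀ i, ∀ x ∈ 𝒱 i, g' x ∈ 𝒱 (i + e')) {i : ℤ} {x : V} (hx : x ∈ 𝒱 i) (c : GSym 𝒱) :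
    coder (g ∘ₗ pr 𝒱) (coder (g' ∘ₗ pr 𝒱) (ι 𝒱 x * c)) +
      coder (g' ∘ₗ pr 𝒱) (coder (g ∘ₗ pr 𝒱) (ι 𝒱 x * c)) =
    ι 𝒱 (g (g' x) + g' (g x)) * c + ι 𝒱 x * (coder (g ∘ₗ pr 𝒱) (coder (g' ∘ₗ pr 𝒱) c) +
      coder (g' ∘ₗ pr 𝒱) (coder (g ∘ₗ pr 𝒱) c)) := by
  have hodd : ∀ e : ℤ, Odd e → (-1 : F) ^ (i + e) = -(-1) ^ i := fun e he => by
    rw [zpow_add₀ (by simp), he.neg_one_zpow, mul_neg_one]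
  have hs : (-1 : F) ^ i * (-1) ^ i = 1 := by rw [← mul_zpow]; simp
  rw [coder_pr_ι_mul he' hg' hx, coder_pr_ι_mul he hg hx, map_add, map_add, map_smul, map_smul,
    coder_pr_ι_mul he hg (hg' i x hx), coder_pr_ι_mul he hg hx,
    coder_pr_ι_mul he' hg' (hg i x hx), coder_pr_ι_mul he' hg' hx, hodd e he, hodd e' he', map_add,
    smul_add, smul_add, smul_smul, smul_smul, hs, add_mul, mul_add]
  module

theorem coder_pr_coder_pr [CharZero F] (he : Odd e) (hg : ∀ i, ∀ x ∈ 𝒱 i, g x ∈ 𝒱 (i + e))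
    (hgg : ∀ x, g (g x) = 0) (c : GSym 𝒱) : coder (g ∘ₗ pr 𝒱) (coder (g ∘ₗ pr 𝒱) c) = 0 := by
  have h : coder (g ∘ₗ pr 𝒱) ∘ₗ coder (g ∘ₗ pr 𝒱) + coder (g ∘ₗ pr 𝒱) ∘ₗ coder (g ∘ₗ pr 𝒱) = 0 :=
    word_hom_ext (by simp [coder_pr_one]) fun i x hx c hc => by
      refine (coder_pr_anticomm_ι_mul he hg he hg hx c).trans ?_
      rw [hgg]
      have hc' : coder (g ∘ₗ pr 𝒱) (coder (g ∘ₗ pr 𝒱) c) +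
        coder (g ∘ₗ pr 𝒱) (coder (g ∘ₗ pr 𝒱) c) = 0 := hc
      rw [hc']
      simp
  have h' := LinearMap.congr_fun h c
  rw [LinearMap.add_apply, ← two_smul F, LinearMap.zero_apply, smul_eq_zero] at h'
  exact h'.resolve_left two_ne_zero

end Derivation

end GSym

/-! ### The contraction of symmetric coalgebras induced by a contraction -/

section Linear

open GSym

variable {F : Type*} [Field F] {L : Type*} [AddCommGroup L] [Module F L]
  {H : Type*} [AddCommGroup H] [Module F H] {𝓗 : ℤ → Submodule F H}
  {𝓛 : ℤ → Submodule F L} {d : L →ₗ[F] L} (c : Contraction 𝓗 0 𝓛 d)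

namespace Contraction

/-- The homogeneous elements in the image of the inclusion (`false`) and in the kernel of the
projection (`true`). -/
def letters (p : ℤ × Bool) : Submodule F L :=
  shift 𝓛 p.1 ⊓ if p.2 then LinearMap.ker c.proj else LinearMap.ker (LinearMap.id - c.incl ∘ₗ c.proj)

/-- The bigrading of the symmetric coalgebra by the degree and by the number of letters in the
kernel of the projection. -/
abbrev biwords (p : ℤ × ℕ) : Submodule F (GSym (shift 𝓛)) :=
  wordSpan (shift 𝓛) c.letters (fun q => (q.1, q.2.toNat)) p

theorem mem_letters_false {i : ℤ} {x : L} :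
    x ∈ c.letters (i, false) ↔ x ∈ shift 𝓛 i ∧ c.incl (c.proj x) = x := by
  simp only [letters, Bool.false_eq_true, if_false, Submodule.mem_inf, LinearMap.mem_ker,
    LinearMap.sub_apply, LinearMap.id_apply, LinearMap.comp_apply, sub_eq_zero, eq_comm (a := x)]

theorem mem_letters_true {i : ℤ} {x : L} :
    x ∈ c.letters (i, true) ↔ x ∈ shift 𝓛 i ∧ c.proj x = 0 := by
  simp [letters]

theorem letters_le (p : ℤ × Bool) : c.letters p ≤ shift 𝓛 p.1 := inf_le_left

theorem incl_proj_mem {i : ℤ} {x : L} (hx : x ∈ shift 𝓛 i) :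
    c.incl (c.proj x) ∈ c.letters (i, false) :=
  c.mem_letters_false.mpr ⟨c.incl_mem _ _ (c.proj_mem _ _ hx), by rw [c.proj_incl]⟩

theorem sub_incl_proj_mem {i : ℤ} {x : L} (hx : x ∈ shift 𝓛 i) :
    x - c.incl (c.proj x) ∈ c.letters (i, true) :=
  c.mem_letters_true.mpr ⟨sub_mem hx (c.incl_mem _ _ (c.proj_mem _ _ hx)),
    by rw [map_sub, c.proj_incl, sub_self]⟩

theorem degree_le_iSup_biwords (n : ℤ) :
    degree (shift 𝓛) n ≤ ⨆ p, ⨆ (_ : AddMonoidHom.fst ℤ ℕ p = n), c.biwords p := by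
  have h := wordSpan_le_iSup (𝒱 := shift 𝓛) (s := shift 𝓛) (w := id) (s' := c.letters)
    (w' := fun q : ℤ × Bool => (q.1, q.2.toNat)) (AddMonoidHom.fst ℤ ℕ) (fun i x hx => ?_) n
  · exact h
  · have hb : ∀ b, c.letters (i, b) ≤ ⨆ j : ℤ × Bool, ⨆ (_ : j.1 = i), c.letters j := fun b =>
      le_iSup₂_of_le (f := fun (j : ℤ × Bool) (_ : j.1 = i) => c.letters j) (i, b) rfl le_rfl
    rw [← add_sub_cancel (c.incl (c.proj x)) x]
    exact add_mem (hb false (c.incl_proj_mem hx)) (hb true (c.sub_incl_proj_mem hx))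

theorem biwords_le_degree (p : ℤ × ℕ) : c.biwords p ≤ degree (shift 𝓛) p.1 := by
  intro z hz
  induction hz using wordSpan_induction with
  | one => exact one_mem_wordSpan (w := id)
  | ι_mul q x hx m z _ ih => exact ι_mul_mem_wordSpan (w := id) (c.letters_le _ hx) ih
  | zero m => exact zero_mem _
  | add m a b _ _ h1 h2 => exact add_mem h1 h2
  | smul m r a _ h => exact Submodule.smul_mem _ _ h

/-- The weight polynomial: the coefficient of `T ^ a` is the component with `a` letters in the
kernel of the projection. -/
def weightPoly : GSym (shift 𝓛) →ₐ[F] Polynomial (GSym (shift 𝓛)) :=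
  lift ((Polynomial.monomial 0).restrictScalars F ∘ₗ ι (shift 𝓛) ∘ₗ c.incl ∘ₗ c.proj +
      (Polynomial.monomial 1).restrictScalars F ∘ₗ ι (shift 𝓛) ∘ₗ
        (LinearMap.id - c.incl ∘ₗ c.proj))
    fun i j x hx y hy => by
      have hx0 : c.incl (c.proj x) ∈ shift 𝓛 i := c.letters_le _ (c.incl_proj_mem hx)
      have hy0 : c.incl (c.proj y) ∈ shift 𝓛 j := c.letters_le _ (c.incl_proj_mem hy)
      have hx1 : x - c.incl (c.proj x) ∈ shift 𝓛 i := sub_mem hx hx0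
      have hy1 : y - c.incl (c.proj y) ∈ shift 𝓛 j := sub_mem hy hy0
      simp only [LinearMap.add_apply, LinearMap.comp_apply, LinearMap.restrictScalars_apply,
        LinearMap.sub_apply, LinearMap.id_apply, add_mul, mul_add, smul_add,
        Polynomial.monomial_mul_monomial, Polynomial.smul_monomial]
      rw [ι_mul_ι hx0 hy0, ι_mul_ι hx0 hy1, ι_mul_ι hx1 hy0, ι_mul_ι hx1 hy1]
      simp only [zero_add, add_zero]
      abel

theorem weightPoly_of_mem {p : ℤ × ℕ} {z : GSym (shift 𝓛)} (hz : z ∈ c.biwords p) :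
    c.weightPoly z = Polynomial.monomial p.2 z := by
  induction hz using wordSpan_induction with
  | one => simp
  | ι_mul q x hx m z _ ih =>
    rw [map_mul, ih, weightPoly, lift_ι]
    obtain ⟨i, b⟩ := q
    cases b with
    | false =>
      obtain ⟨_, h⟩ := c.mem_letters_false.mp hx
      simp [h]
    | true =>
      obtain ⟨_, h⟩ := c.mem_letters_true.mp hx
      simp [h, Polynomial.monomial_mul_monomial]
  | zero m => simp
  | add m a b _ _ h1 h2 => rw [map_add, h1, h2, map_add]
  | smul m r a _ h => rw [map_smul, h, Polynomial.smul_monomial]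

theorem incl_mem_shift (i : ℤ) (x : H) (hx : x ∈ shift 𝓗 i) : c.incl x ∈ shift 𝓛 i :=
  c.incl_mem (i - 1) x hx

theorem proj_mem_shift (i : ℤ) (x : L) (hx : x ∈ shift 𝓛 i) : c.proj x ∈ shift 𝓗 i :=
  c.proj_mem (i - 1) x hx

theorem neg_h_mem (i : ℤ) (x : L) (hx : x ∈ shift 𝓛 i) : (-c.h) x ∈ shift 𝓛 (i + 1) := by
  have h := neg_mem (c.h_mem _ _ hx)
  rw [show i - 1 + 1 = i + 1 - 1 by omega] at h
  exact h

theorem neg_d_mem (hd : ∀ i, ∀ x ∈ 𝓛 i, d x ∈ 𝓛 (i - 1)) (i : ℤ) (x : L) (hx : x ∈ shift 𝓛 i) :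
    (-d) x ∈ shift 𝓛 (i + (-1)) :=
  neg_mem (hd _ _ hx)

/-- The map of symmetric coalgebras induced by the inclusion. -/
def symIncl : GSym (shift 𝓗) →ₗ[F] GSym (shift 𝓛) :=
  (GSym.map c.incl c.incl_mem_shift).toLinearMap

theorem symProj_eq : symProj c =
    (GSym.map (𝒱 := shift 𝓛) (𝒲 := shift 𝓗) c.proj c.proj_mem_shift).toLinearMap := rfl

theorem symIncl_one : c.symIncl 1 = 1 := map_one (GSym.map c.incl c.incl_mem_shift)

theorem symIncl_ι_mul (x : H) (z : GSym (shift 𝓗)) :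
    c.symIncl (ι (shift 𝓗) x * z) = ι (shift 𝓛) (c.incl x) * c.symIncl z := by
  rw [symIncl, AlgHom.toLinearMap_apply, map_mul, map_ι]
  rfl

theorem symProj_one : symProj c 1 = 1 := map_one (GSym.map c.proj c.proj_mem_shift)

theorem symProj_ι_mul (x : L) (z : GSym (shift 𝓛)) :
    symProj c (ι (shift 𝓛) x * z) = ι (shift 𝓗) (c.proj x) * symProj c z := by
  rw [symProj_eq, AlgHom.toLinearMap_apply, map_mul, map_ι]
  rfl

theorem symIncl_mem_biwords {n : ℤ} {z : GSym (shift 𝓗)} (hz : z ∈ degree (shift 𝓗) n) :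
    c.symIncl z ∈ c.biwords (n, 0) := by
  rw [degree_eq_wordSpan] at hz
  induction hz using wordSpan_induction with
  | one =>
    rw [c.symIncl_one, Prod.mk_zero_zero]
    exact one_mem_wordSpan
  | ι_mul i x hx m z _ ih =>
    have hx' : c.incl x ∈ c.letters (i, false) :=
      c.mem_letters_false.mpr ⟨c.incl_mem _ _ hx, by rw [c.proj_incl]⟩
    have := ι_mul_mem_wordSpan (𝒱 := shift 𝓛)
      (w := fun q : ℤ × Bool => (q.1, q.2.toNat)) hx' ih
    rw [c.symIncl_ι_mul]
    convert this using 2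
    ext <;> simp
  | zero m => simp
  | add m a b _ _ h1 h2 => rw [map_add]; exact add_mem h1 h2
  | smul m r a _ h => rw [map_smul]; exact Submodule.smul_mem _ _ h

theorem symIncl_symProj_of_mem {p : ℤ × ℕ} {z : GSym (shift 𝓛)} (hz : z ∈ c.biwords p) :
    c.symIncl (symProj c z) = if p.2 = 0 then z else 0 := by
  induction hz using wordSpan_induction with
  | one => simp [c.symProj_one, c.symIncl_one]
  | ι_mul q x hx m z _ ih =>
    rw [c.symProj_ι_mul, c.symIncl_ι_mul, ih]
    obtain ⟨i, b⟩ := q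
    cases b with
    | false =>
      obtain ⟨_, h⟩ := c.mem_letters_false.mp hx
      simp [h]
    | true =>
      obtain ⟨_, h⟩ := c.mem_letters_true.mp hx
      simp [h]
  | zero m => simp
  | add m a b _ _ h1 h2 => rw [map_add, map_add, h1, h2]; split_ifs <;> simp
  | smul m r a _ h => rw [map_smul, map_smul, h]; split_ifs <;> simp

theorem symProj_symIncl [DirectSum.Decomposition 𝓗] (z : GSym (shift 𝓗)) : symProj c (c.symIncl z) = z :=
  LinearMap.congr_fun (f := symProj c ∘ₗ c.symIncl) (g := LinearMap.id)
    (word_hom_ext (by simp [c.symIncl_one, c.symProj_one]) fun i x _ z hz => by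
      rw [LinearMap.comp_apply, LinearMap.id_apply] at hz ⊢
      rw [c.symIncl_ι_mul, c.symProj_ι_mul, hz, c.proj_incl]) z

theorem symProj_of_mem [DirectSum.Decomposition 𝓗] {p : ℤ × ℕ} {z : GSym (shift 𝓛)} (hz : z ∈ c.biwords p) (hp : p.2 ≠ 0) :
    symProj c z = 0 := by
  rw [← c.symProj_symIncl (symProj c z), c.symIncl_symProj_of_mem hz, if_neg hp, map_zero]

variable [DirectSum.Decomposition 𝓛]

theorem biwords_hom_ext {W : Type*} [AddCommGroup W] [Module F W] {f g : GSym (shift 𝓛) →ₗ[F] W}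
    (h : ∀ n a, ∀ z ∈ c.biwords (n, a), f z = g z) : f = g := by
  refine degree_hom_ext fun n z hz => ?_
  have : (⨆ p, ⨆ (_ : AddMonoidHom.fst ℤ ℕ p = n), c.biwords p) ≤ LinearMap.ker (f - g) :=
    iSup₂_le fun p _ z hz => by simpa [sub_eq_zero] using h p.1 p.2 z hz
  simpa [sub_eq_zero] using this (c.degree_le_iSup_biwords n hz)

/-- The derivation extending the homotopy. The sign is that of the suspension. -/
def homotopyDer : GSym (shift 𝓛) →ₗ[F] GSym (shift 𝓛) := coder ((-c.h) ∘ₗ pr (shift 𝓛))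

/-- The homotopy on the symmetric coalgebra: the derivation extending the homotopy, divided by the
number of letters in the kernel of the projection. On words without such letters it is zero, in
accordance with the convention `0⁻¹ = 0`. -/
def symHomotopy : GSym (shift 𝓛) →ₗ[F] GSym (shift 𝓛) :=
  Polynomial.lsum (R := F) (fun a => (a : F)⁻¹ • c.homotopyDer) ∘ₗ c.weightPoly.toLinearMap

theorem symHomotopy_of_mem {p : ℤ × ℕ} {z : GSym (shift 𝓛)} (hz : z ∈ c.biwords p) :
    c.symHomotopy z = (p.2 : F)⁻¹ • c.homotopyDer z := by
  rw [symHomotopy, LinearMap.comp_apply, AlgHom.toLinearMap_apply, c.weightPoly_of_mem hz,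
    Polynomial.lsum_apply, Polynomial.sum_monomial_index _ _ (by simp)]
  rfl

theorem coder_pr_mem_biwords {g : L →ₗ[F] L} {e : ℤ} (he : Odd e)
    (hg : ∀ i, ∀ x ∈ shift 𝓛 i, g x ∈ shift 𝓛 (i + e)) (hg0 : ∀ x, g (c.incl x) = 0)
    (hg1 : ∀ x, c.proj x = 0 → c.proj (g x) = 0) {n : ℤ} {a : ℕ} {z : GSym (shift 𝓛)}
    (hz : z ∈ c.biwords (n, a)) : coder (g ∘ₗ pr (shift 𝓛)) z ∈ c.biwords (n + e, a) := by
  suffices h : ∀ p, z ∈ c.biwords p → coder (g ∘ₗ pr (shift 𝓛)) z ∈ c.biwords (p.1 + e, p.2) from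
    h (n, a) hz
  clear hz n a
  intro p hz
  induction hz using wordSpan_induction with
  | one => rw [coder_pr_one]; exact zero_mem _
  | ι_mul q x hx m z hz ih =>
    rw [coder_pr_ι_mul he hg (c.letters_le _ hx)]
    obtain ⟨i, b⟩ := q
    refine add_mem ?_ (Submodule.smul_mem _ _ ?_)
    · cases b with
      | false =>
        obtain ⟨_, h⟩ := c.mem_letters_false.mp hx
        rw [← h, hg0, map_zero, zero_mul]
        exact zero_mem _
      | true =>
        obtain ⟨h1, h2⟩ := c.mem_letters_true.mp hx
        have hgx : g x ∈ c.letters (i + e, true) :=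
          c.mem_letters_true.mpr ⟨hg i x h1, hg1 x h2⟩
        have := ι_mul_mem_wordSpan (𝒱 := shift 𝓛)
          (w := fun q : ℤ × Bool => (q.1, q.2.toNat)) hgx hz
        convert this using 2
        ext <;> simp; ring
    · have := ι_mul_mem_wordSpan (𝒱 := shift 𝓛)
          (w := fun q : ℤ × Bool => (q.1, q.2.toNat)) hx ih
      convert this using 2
      ext <;> simp; ring
  | zero m => simp
  | add m a b _ _ h1 h2 => rw [map_add]; exact add_mem h1 h2
  | smul m r a _ h => rw [map_smul]; exact Submodule.smul_mem _ _ h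

theorem homotopyDer_mem_biwords {n : ℤ} {a : ℕ} {z : GSym (shift 𝓛)}
    (hz : z ∈ c.biwords (n, a)) : c.homotopyDer z ∈ c.biwords (n + 1, a) :=
  c.coder_pr_mem_biwords odd_one c.neg_h_mem (fun x => by simp [c.h_incl])
    (fun x _ => by simp [c.proj_h]) hz

/-- The differential of the symmetric coalgebra on the suspension of `(L, d)`. -/
def symDiff (_ : Contraction 𝓗 0 𝓛 d) : GSym (shift 𝓛) →ₗ[F] GSym (shift 𝓛) :=
  coder ((-d) ∘ₗ pr (shift 𝓛))

theorem symDiff_mem_biwords (hd : ∀ i, ∀ x ∈ 𝓛 i, d x ∈ 𝓛 (i - 1)) {n : ℤ} {a : ℕ}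
    {z : GSym (shift 𝓛)} (hz : z ∈ c.biwords (n, a)) : c.symDiff z ∈ c.biwords (n + (-1), a) :=
  c.coder_pr_mem_biwords odd_one.neg (neg_d_mem hd) (fun x => by simp [← c.incl_comm])
    (fun x _ => by simp [c.proj_comm]) hz

/-- The anticommutator of the differential and of the derivation extending the homotopy counts the
letters in the kernel of the projection. -/
theorem symDiff_homotopyDer_add (hd : ∀ i, ∀ x ∈ 𝓛 i, d x ∈ 𝓛 (i - 1)) {p : ℤ × ℕ}
    {z : GSym (shift 𝓛)} (hz : z ∈ c.biwords p) :
    c.symDiff (c.homotopyDer z) + c.homotopyDer (c.symDiff z) = (p.2 : F) • z := by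
  induction hz using wordSpan_induction with
  | one => simp only [symDiff, homotopyDer, coder_pr_one, map_zero, add_zero, Prod.snd_zero,
      Nat.cast_zero, zero_smul]
  | ι_mul q x hx m z hz ih =>
    refine (coder_pr_anticomm_ι_mul odd_one.neg (neg_d_mem hd) odd_one c.neg_h_mem
      (c.letters_le _ hx) z).trans ?_
    rw [show ∀ z, coder ((-d) ∘ₗ pr (shift 𝓛)) (coder ((-c.h) ∘ₗ pr (shift 𝓛)) z) +
      coder ((-c.h) ∘ₗ pr (shift 𝓛)) (coder ((-d) ∘ₗ pr (shift 𝓛)) z) =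
        c.symDiff (c.homotopyDer z) + c.homotopyDer (c.symDiff z) from fun _ => rfl, ih]
    have hx' : (-d) ((-c.h) x) + (-c.h) ((-d) x) = x - c.incl (c.proj x) := by
      simpa using c.homotopy x
    rw [hx', mul_smul_comm]
    obtain ⟨i, b⟩ := q
    cases b with
    | false =>
      obtain ⟨_, h⟩ := c.mem_letters_false.mp hx
      simp [h]
    | true =>
      obtain ⟨_, h⟩ := c.mem_letters_true.mp hx
      simp [h, add_smul]
  | zero m => simp
  | add m a b _ _ h1 h2 =>
    rw [smul_add, ← h1, ← h2]; simp only [map_add]; abel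
  | smul m r a _ h => simp only [map_smul]; rw [← smul_add, h, smul_comm]

theorem symHomotopy_mem (n : ℤ) (z : GSym (shift 𝓛)) (hz : z ∈ degree (shift 𝓛) n) :
    c.symHomotopy z ∈ degree (shift 𝓛) (n + 1) := by
  have key : ∀ p, AddMonoidHom.fst ℤ ℕ p = n → c.biwords p ≤
      (degree (shift 𝓛) (n + 1)).comap c.symHomotopy := by
    rintro ⟨m, a⟩ rfl y hy
    rw [Submodule.mem_comap, c.symHomotopy_of_mem hy]
    exact Submodule.smul_mem _ _ (c.biwords_le_degree (m + 1, a) (c.homotopyDer_mem_biwords hy))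
  exact iSup₂_le key (c.degree_le_iSup_biwords n hz)

variable [DirectSum.Decomposition 𝓗]

/-- A contraction of chain complexes induces a contraction of the symmetric coalgebras on their
suspensions, with the linear coderivation as differential. -/
def sym [CharZero F] (hd : ∀ i, ∀ x ∈ 𝓛 i, d x ∈ 𝓛 (i - 1)) :
    Contraction (degree (shift 𝓗)) 0 (degree (shift 𝓛)) c.symDiff where
  incl := c.symIncl
  proj := symProj c
  h := c.symHomotopy
  incl_mem n z hz := map_mem_degree c.incl_mem_shift hz
  proj_mem n z hz := map_mem_degree c.proj_mem_shift hz
  h_mem := c.symHomotopy_mem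
  incl_comm z := by
    rw [LinearMap.zero_apply, map_zero]
    refine LinearMap.congr_fun (f := 0) (g := c.symDiff ∘ₗ c.symIncl)
      (word_hom_ext (by simp only [LinearMap.zero_apply, LinearMap.comp_apply, symDiff,
        c.symIncl_one, coder_pr_one]) fun i x hx z hz => ?_) z
    rw [LinearMap.zero_apply] at hz ⊢
    rw [LinearMap.comp_apply] at hz ⊢
    rw [c.symIncl_ι_mul]
    refine Eq.trans ?_ (coder_pr_ι_mul odd_one.neg (neg_d_mem hd) (i := i)
      (c.incl_mem _ _ hx) _).symm
    rw [show coder ((-d) ∘ₗ pr (shift 𝓛)) (c.symIncl z) = 0 from hz.symm]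
    simp [← c.incl_comm]
  proj_comm z := by
    refine LinearMap.congr_fun (f := symProj c ∘ₗ c.symDiff) (g := 0)
      (word_hom_ext (by simp only [LinearMap.zero_apply, LinearMap.comp_apply, symDiff,
        coder_pr_one, map_zero]) fun i x hx z hz => ?_) z
    rw [LinearMap.zero_apply, LinearMap.comp_apply] at hz ⊢
    have h := coder_pr_ι_mul odd_one.neg (neg_d_mem hd) hx z
    rw [symDiff] at hz ⊢
    rw [h]
    rw [map_add, map_smul]
    rw [c.symProj_ι_mul, c.symProj_ι_mul, hz]
    simp [c.proj_comm]
  proj_incl := c.symProj_symIncl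
  homotopy z := by
    refine LinearMap.congr_fun (f := c.symDiff ∘ₗ c.symHomotopy + c.symHomotopy ∘ₗ c.symDiff)
      (g := LinearMap.id - c.symIncl ∘ₗ symProj c) (c.biwords_hom_ext fun n a z hz => ?_) z
    simp only [LinearMap.add_apply, LinearMap.sub_apply, LinearMap.comp_apply, LinearMap.id_apply]
    rw [c.symHomotopy_of_mem hz, c.symHomotopy_of_mem (c.symDiff_mem_biwords hd hz), map_smul,
      ← smul_add, c.symDiff_homotopyDer_add hd hz, c.symIncl_symProj_of_mem hz, smul_smul]
    by_cases ha : a = 0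
    · simp [ha]
    · simp [ha]
  proj_h z := by
    refine LinearMap.congr_fun (f := symProj c ∘ₗ c.symHomotopy) (g := 0)
      (c.biwords_hom_ext fun n a z hz => ?_) z
    rw [LinearMap.comp_apply, c.symHomotopy_of_mem hz, map_smul, LinearMap.zero_apply]
    by_cases ha : a = 0
    · simp [ha]
    · rw [c.symProj_of_mem (c.homotopyDer_mem_biwords hz) ha, smul_zero]
  h_incl z := by
    refine LinearMap.congr_fun (f := c.symHomotopy ∘ₗ c.symIncl) (g := 0)
      (degree_hom_ext fun n z hz => ?_) z
    rw [LinearMap.comp_apply, c.symHomotopy_of_mem (c.symIncl_mem_biwords hz)]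
    simp
  h_h z := by
    refine LinearMap.congr_fun (f := c.symHomotopy ∘ₗ c.symHomotopy) (g := 0)
      (c.biwords_hom_ext fun n a z hz => ?_) z
    rw [LinearMap.comp_apply, c.symHomotopy_of_mem hz, map_smul,
      c.symHomotopy_of_mem (c.homotopyDer_mem_biwords hz), homotopyDer,
      coder_pr_coder_pr odd_one c.neg_h_mem (fun x => by simp [c.h_h])]
    simp

end Contraction

end Linear

/-! ### Contractions, quasi-isomorphisms and transport -/

namespace Contraction

variable {F : Type*} [Field F] {M N : Type*} [AddCommGroup M] [Module F M] [AddCommGroup N]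
  [Module F N] {𝓜 : ℤ → Submodule F M} {dM : M →ₗ[F] M} {𝓝 : ℤ → Submodule F N} {d : N →ₗ[F] N}

theorem isQuasiIso_incl (C : Contraction 𝓜 dM 𝓝 d) : IsQuasiIso dM d C.incl := by
  refine ⟨LinearMap.ext C.incl_comm, ?_, ?_⟩
  · rw [injective_iff_map_eq_zero]
    intro x hx
    obtain ⟨⟨x, hx'⟩, rfl⟩ := Submodule.Quotient.mk_surjective _ x
    obtain ⟨w, hw⟩ := (Submodule.Quotient.mk_eq_zero _).mp hx
    have hw' : d w = C.incl x := hw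
    refine (Submodule.Quotient.mk_eq_zero _).mpr ⟨C.proj w, ?_⟩
    rw [← C.proj_comm, hw', C.proj_incl]
    rfl
  · intro y
    obtain ⟨⟨y, hy⟩, rfl⟩ := Submodule.Quotient.mk_surjective _ y
    rw [LinearMap.mem_ker] at hy
    refine ⟨Submodule.Quotient.mk ⟨C.proj y, by rw [LinearMap.mem_ker, ← C.proj_comm, hy, map_zero]⟩,
      (Submodule.Quotient.eq _).mpr ⟨-C.h y, ?_⟩⟩
    have h := C.homotopy y
    rw [hy, map_zero, add_zero] at h
    rw [map_neg, h, neg_sub]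
    rfl

theorem isQuasiIso_proj (C : Contraction 𝓜 dM 𝓝 d) : IsQuasiIso d dM C.proj := by
  refine ⟨LinearMap.ext C.proj_comm, ?_, ?_⟩
  · rw [injective_iff_map_eq_zero]
    intro y hy
    obtain ⟨⟨y, hy'⟩, rfl⟩ := Submodule.Quotient.mk_surjective _ y
    obtain ⟨w, hw⟩ := (Submodule.Quotient.mk_eq_zero _).mp hy
    have hw' : dM w = C.proj y := hw
    rw [LinearMap.mem_ker] at hy'
    have h := C.homotopy y
    rw [hy', map_zero, add_zero, ← hw', C.incl_comm] at h
    refine (Submodule.Quotient.mk_eq_zero _).mpr ⟨C.incl w + C.h y, ?_⟩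
    rw [map_add, h, add_sub_cancel]
    rfl
  · intro x
    obtain ⟨⟨x, hx⟩, rfl⟩ := Submodule.Quotient.mk_surjective _ x
    rw [LinearMap.mem_ker] at hx
    refine ⟨Submodule.Quotient.mk ⟨C.incl x, by rw [LinearMap.mem_ker, ← C.incl_comm, hx, map_zero]⟩,
      congrArg Submodule.Quotient.mk (Subtype.ext (C.proj_incl x))⟩

/-- The contraction for the differentials with the opposite sign, as for suspensions. -/
def neg (C : Contraction 𝓜 dM 𝓝 d) : Contraction 𝓜 (-dM) 𝓝 (-d) where
  incl := C.incl
  proj := C.proj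
  h := -C.h
  incl_mem := C.incl_mem
  proj_mem := C.proj_mem
  h_mem i x hx := neg_mem (C.h_mem i x hx)
  incl_comm x := by simp [C.incl_comm]
  proj_comm x := by simp [C.proj_comm]
  proj_incl := C.proj_incl
  homotopy x := by simpa using C.homotopy x
  proj_h x := by simp [C.proj_h]
  h_incl x := by simp [C.h_incl]
  h_h x := by simp [C.h_h]

/-- Transport of a contraction along an isomorphism of chain complexes. -/
def congr (C : Contraction 𝓜 dM 𝓝 d) {N' : Type*} [AddCommGroup N'] [Module F N']
    {𝓝' : ℤ → Submodule F N'} {d' : N' →ₗ[F] N'} (Φ : N' ≃ₗ[F] N)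
    (hΦ : ∀ i x, Φ x ∈ 𝓝 i ↔ x ∈ 𝓝' i) (hd : ∀ x, Φ (d' x) = d (Φ x)) :
    Contraction 𝓜 dM 𝓝' d' where
  incl := Φ.symm.toLinearMap ∘ₗ C.incl
  proj := C.proj ∘ₗ Φ.toLinearMap
  h := Φ.symm.toLinearMap ∘ₗ C.h ∘ₗ Φ.toLinearMap
  incl_mem i x hx := by simpa [← hΦ] using C.incl_mem i x hx
  proj_mem i x hx := C.proj_mem i _ ((hΦ i x).mpr hx)
  h_mem i x hx := by simpa [← hΦ] using C.h_mem i _ ((hΦ i x).mpr hx)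
  incl_comm x := Φ.injective (by simp [hd, C.incl_comm])
  proj_comm x := by simp [hd, C.proj_comm]
  proj_incl x := by simp [C.proj_incl]
  homotopy x := Φ.injective (by simpa [hd] using C.homotopy (Φ x))
  proj_h x := by simp [C.proj_h]
  h_incl x := by simp [C.h_incl]
  h_h x := by simp [C.h_h]

end Contraction

/-! ### The adjoint of the universal solution -/

section Straighten

open GSym

variable {F : Type*} [Field F] {L : Type*} [AddCommGroup L] [Module F L]
  {H : Type*} [AddCommGroup H] [Module F H] {𝓗 : ℤ → Submodule F H}
  {𝓛 : ℤ → Submodule F L}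

/-- The morphism of coalgebras cogenerated by `f` is compatible with the differentials if it is so
after projection onto the cogenerators. -/
theorem GSym.isDGCoalgHom_cohom [CharZero F] {V : Type*} [AddCommGroup V] [Module F V]
    {𝒱 : ℤ → Submodule F V} [DirectSum.Decomposition 𝒱] {W : Type*} [AddCommGroup W] [Module F W]
    {𝒲 : ℤ → Submodule F W} [DirectSum.Decomposition 𝒲] {g : GSym 𝒱 →ₗ[F] V}
    {g' : GSym 𝒲 →ₗ[F] W} (hg : IsCodifferential (coder g)) (hg' : IsCodifferential (coder g'))
    {f : GSym 𝒱 →ₗ[F] W} (hf : ∀ n, ∀ c ∈ degree 𝒱 n, f c ∈ 𝒲 n) (hf1 : f 1 = 0)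
    (h : ∀ c, f (coder g c) = g' (cohom 𝒲 f c)) :
    IsDGCoalgHom (coder g) (coder g') (cohom 𝒲 f) where
  source := hg
  target := hg'
  mem n c hc := cohom_mem_degree hf hc
  comul := comul_cohom hf hf1
  counit := counit_cohom f
  one := cohom_one f
  comm := comp_eq_comp_of_pr hg.comul hg'.comul (comul_cohom hf hf1) (counit_cohom f)
    (fun _ _ => cohom_mem_degree hf) (counit_coder g) (counit_coder g') fun c => by
      rw [pr_cohom hf1, pr_coder, h]

theorem GSym.zero_cup {V : Type*} [AddCommGroup V] [Module F V] {𝒱 : ℤ → Submodule F V}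
    [DirectSum.Decomposition 𝒱] (a b : GSym 𝒱 →ₗ[F] L) :
    cup (0 : L →ₗ[F] L →ₗ[F] L) a b = 0 := by
  rw [cup, show TensorProduct.lift (0 : L →ₗ[F] L →ₗ[F] L) = 0 from
    TensorProduct.ext' fun _ _ => by simp, LinearMap.zero_comp]

theorem GSym.coder_zero {V : Type*} [AddCommGroup V] [Module F V] {𝒱 : ℤ → Submodule F V}
    [DirectSum.Decomposition 𝒱] : coder (0 : GSym 𝒱 →ₗ[F] V) = 0 := by
  simp [coder, conv]

section Adjoint

variable [DirectSum.Decomposition 𝓗] {d : L →ₗ[F] L} (c : Contraction 𝓗 0 𝓛 d) {B : L →ₗ[F] L →ₗ[F] L}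

theorem tau_mem_shift (hB : ∀ i j, ∀ x ∈ 𝓛 i, ∀ y ∈ 𝓛 j, B x y ∈ 𝓛 (i + j)) (n : ℤ)
    (x : GSym (shift 𝓗)) (hx : x ∈ degree (shift 𝓗) n) : tau c B x ∈ shift 𝓛 n :=
  tau_mem c hB n x hx

theorem pr_tauBar (x : GSym (shift 𝓗)) : pr (shift 𝓛) (tauBar c B x) = tau c B x :=
  pr_cohom (tau_one c B) x

theorem tauBar_mem (hB : ∀ i j, ∀ x ∈ 𝓛 i, ∀ y ∈ 𝓛 j, B x y ∈ 𝓛 (i + j)) (n : ℤ)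
    (x : GSym (shift 𝓗)) (hx : x ∈ degree (shift 𝓗) n) : tauBar c B x ∈ degree (shift 𝓛) n :=
  cohom_mem_degree (tau_mem_shift c hB) hx

variable [DirectSum.Decomposition 𝓛]

theorem comul_tauBar [CharZero F] (hB : ∀ i j, ∀ x ∈ 𝓛 i, ∀ y ∈ 𝓛 j, B x y ∈ 𝓛 (i + j)) :
    comul (shift 𝓛) ∘ₗ tauBar c B =
      TensorProduct.map (tauBar c B) (tauBar c B) ∘ₗ comul (shift 𝓗) :=
  comul_cohom (tau_mem_shift c hB) (tau_one c B)

theorem cup_tauBar [CharZero F] (hB : ∀ i j, ∀ x ∈ 𝓛 i, ∀ y ∈ 𝓛 j, B x y ∈ 𝓛 (i + j))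
    (B' : L →ₗ[F] L →ₗ[F] L) (x : GSym (shift 𝓗)) :
    cup B' (pr (shift 𝓛)) (pr (shift 𝓛)) (tauBar c B x) = cup B' (tau c B) (tau c B) x := by
  have h := LinearMap.congr_fun (cup_comp (B := B') (a := pr (shift 𝓛)) (b := pr (shift 𝓛))
    (comul_tauBar c hB) (tauBar_mem c hB)) x
  rwa [show pr (shift 𝓛) ∘ₗ tauBar c B = tau c B from LinearMap.ext (pr_tauBar c)] at h

end Adjoint

namespace DGLie

variable [DirectSum.Decomposition 𝓛] (K : DGLie 𝓛) (c : Contraction 𝓗 0 𝓛 K.d)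

/-- For degree reasons, `[τ, τ]` vanishes on the image of `𝒟`, and `d [τ, τ] = 0`. Therefore both
`τ 𝒟` and `-d τ + 1/2 [τ, τ]` equal `1/2 incl proj [τ, τ]`. -/
theorem isDGCoalgHom_tauBar [CharZero F] [DirectSum.Decomposition 𝓗] (h𝓛 : Concentrated 𝓛) (h𝓗 : Concentrated 𝓗) :
    IsDGCoalgHom (calD c K.bracket) K.ceDiff (tauBar c K.bracket) := by
  have hτ := tau_mem c K.bracket_mem
  have hcup : ∀ n, ∀ x ∈ degree (shift 𝓗) n,
      cup K.bracket (tau c K.bracket) (tau c K.bracket) x ∈ 𝓛 (n - 2) := fun n x hx =>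
    cup_mem K.bracket_mem hτ hτ hx
  have hpos : ∀ i, 0 < i → shift 𝓗 i = ⊥ := fun i => h𝓗.shift_eq_bot
  set g : GSym (shift 𝓗) →ₗ[F] H :=
    (2⁻¹ : F) • c.proj ∘ₗ cup K.bracket (tau c K.bracket) (tau c K.bracket) with hgdef
  have hg : ∀ n, ∀ x ∈ degree (shift 𝓗) n, g x ∈ shift 𝓗 (n - 1) := fun n x hx => by
    have := c.proj_mem _ _ (hcup n x hx)
    rw [show n - 2 = n - 1 - 1 by omega] at this
    exact Submodule.smul_mem _ _ this
  have hg1 : g 1 = 0 := by simp [hgdef, cup_one (tau_one c K.bracket)]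
  have hgcoder : ∀ n, ∀ x ∈ degree (shift 𝓗) n, coder g x ∈ degree (shift 𝓗) (n - 1) :=
    fun n x hx => coder_mem_degree hg hx
  have hgg : g ∘ₗ coder g = 0 := eq_zero_of_degree (𝓛 := 𝓗) hpos h𝓗 fun n x hx => by
    have := hg _ _ (hgcoder n x hx)
    change _ ∈ 𝓗 (n - 1 - 1 - 1) at this
    rwa [show n - 1 - 1 - 1 = n - 3 by omega] at this
  have hcupcoder : cup K.bracket (tau c K.bracket) (tau c K.bracket) ∘ₗ coder g = 0 :=
    eq_zero_of_degree hpos h𝓛 fun n x hx => by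
      have := hcup _ _ (hgcoder n x hx)
      rwa [show n - 1 - 2 = n - 3 by omega] at this
  have hdcup : K.d ∘ₗ cup K.bracket (tau c K.bracket) (tau c K.bracket) = 0 :=
    eq_zero_of_degree hpos h𝓛 fun n x hx => by
      have := K.d_mem _ _ (hcup n x hx)
      rwa [show n - 2 - 1 = n - 3 by omega] at this
  rw [calD_eq, ← hgdef]
  refine isDGCoalgHom_cohom (isCodifferential_coder hg hg1 (LinearMap.congr_fun hgg))
    (K.isCodifferential_ceDiff h𝓛) (tau_mem_shift c K.bracket_mem) (tau_one c K.bracket)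
    fun x => ?_
  have h1 := LinearMap.congr_fun (tau_eq c K.bracket) (coder g x)
  have h2 := LinearMap.congr_fun hcupcoder x
  simp only [LinearMap.comp_apply, LinearMap.zero_apply, LinearMap.add_apply,
    LinearMap.smul_apply] at h1 h2
  rw [h2, map_zero, smul_zero, add_zero, pr_coder] at h1
  rw [h1]
  have h3 : K.ceGen (tauBar c K.bracket x) = -K.d (tau c K.bracket x) +
      (2⁻¹ : F) • cup K.bracket (tau c K.bracket) (tau c K.bracket) x := by
    rw [ceGen, LinearMap.add_apply, LinearMap.smul_apply, cup_tauBar c K.bracket_mem,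
      LinearMap.neg_apply, LinearMap.comp_apply, pr_tauBar]
  refine Eq.trans ?_ h3.symm
  set y := cup K.bracket (tau c K.bracket) (tau c K.bracket) x with hy
  have h4 : tau c K.bracket x = c.incl (pr (shift 𝓗) x) + (2⁻¹ : F) • c.h y :=
    LinearMap.congr_fun (tau_eq c K.bracket) x
  have h5 : K.d y = 0 := LinearMap.congr_fun hdcup x
  have h6 : K.d (c.h y) = y - c.incl (c.proj y) := by
    have := c.homotopy y
    rwa [h5, map_zero, add_zero] at this
  have h7 : g x = (2⁻¹ : F) • c.proj y := rfl
  rw [h4, map_add, ← c.incl_comm, LinearMap.zero_apply, map_zero, map_smul, h6, h7, map_smul]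
  module

/-! ### Straightening the differential of the classifying coalgebra -/

/-- The corestriction `pr - 1/2 h [pr, pr]` of the automorphism `straighten`. -/
def straightenGen : GSym (shift 𝓛) →ₗ[F] L :=
  pr (shift 𝓛) - (2⁻¹ : F) • c.h ∘ₗ cup K.bracket (pr (shift 𝓛)) (pr (shift 𝓛))

/-- The automorphism of the coalgebra `S^c[sK]` cogenerated by `pr - 1/2 h [pr, pr]`. -/
def straighten : GSym (shift 𝓛) →ₗ[F] GSym (shift 𝓛) := cohom (shift 𝓛) (K.straightenGen c)

theorem straightenGen_mem (n : ℤ) (x : GSym (shift 𝓛)) (hx : x ∈ degree (shift 𝓛) n) :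
    K.straightenGen c x ∈ shift 𝓛 n := by
  have h := c.h_mem _ _ (cup_mem K.bracket_mem (fun _ _ => pr_mem) (fun _ _ => pr_mem) hx)
  rw [show n - 2 + 1 = n - 1 by omega] at h
  exact sub_mem (pr_mem hx) (Submodule.smul_mem _ _ h)

theorem straightenGen_one : K.straightenGen c 1 = 0 := by
  simp [straightenGen, cup_one]

theorem straightenGen_sub_pr : K.straightenGen c - pr (shift 𝓛) ∈ vanishingBelow (shift 𝓛) L 2 := by
  intro m hm x hx
  have := cup_mem_vanishingBelow (B := K.bracket) (𝒱 := shift 𝓛) (pr_one) (pr_one) m hm x hx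
  simp [straightenGen, this]

theorem straighten_mem {n : ℤ} {x : GSym (shift 𝓛)} (hx : x ∈ degree (shift 𝓛) n) :
    K.straighten c x ∈ degree (shift 𝓛) n :=
  cohom_mem_degree (K.straightenGen_mem c) hx

theorem comul_straighten [CharZero F] : comul (shift 𝓛) ∘ₗ K.straighten c =
    TensorProduct.map (K.straighten c) (K.straighten c) ∘ₗ comul (shift 𝓛) :=
  comul_cohom (K.straightenGen_mem c) (K.straightenGen_one c)

theorem pr_straighten (x : GSym (shift 𝓛)) :
    pr (shift 𝓛) (K.straighten c x) = K.straightenGen c x :=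
  pr_cohom (K.straightenGen_one c) x

/-- `straighten` as a linear automorphism. -/
def straightenEquiv [CharZero F] : GSym (shift 𝓛) ≃ₗ[F] GSym (shift 𝓛) :=
  LinearEquiv.ofBijective (K.straighten c)
    ⟨cohom_injective (K.straightenGen_one c) (K.straightenGen_sub_pr c), fun y => by
      obtain ⟨x, _, hx⟩ := exists_cohom_eq (K.straightenGen_one c) (K.straightenGen_sub_pr c)
        (N := ⊤) (fun _ _ => Submodule.mem_top) (y := y) Submodule.mem_top
      exact ⟨x, hx⟩⟩

theorem straighten_mem_iff [CharZero F] (n : ℤ) (x : GSym (shift 𝓛)) :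
    K.straightenEquiv c x ∈ degree (shift 𝓛) n ↔ x ∈ degree (shift 𝓛) n := by
  refine ⟨fun hx => ?_, K.straighten_mem c⟩
  obtain ⟨y, hy, h⟩ := exists_cohom_eq (K.straightenGen_one c) (K.straightenGen_sub_pr c)
    (N := degree (shift 𝓛) n) (fun _ => K.straighten_mem c) hx
  rwa [← (K.straightenEquiv c).injective h]

variable {K}

/-- If the bracket takes values in `d h L`, then `straighten` carries the differential of the
classifying coalgebra to its linear part: `d h [pr, pr] = [pr, pr]` turns `-d pr + 1/2 [pr, pr]` into
`-d (pr - 1/2 h [pr, pr])`, and `[pr, pr]` vanishes on the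
image of the differential for degree reasons. -/
theorem straighten_ceDiff [CharZero F] (h𝓛 : Concentrated 𝓛)
    (hb : ∀ x y, K.d (c.h (K.bracket x y)) = K.bracket x y) (x : GSym (shift 𝓛)) :
    K.straighten c (K.ceDiff x) = c.symDiff (K.straighten c x) := by
  refine LinearMap.congr_fun (f := K.straighten c ∘ₗ K.ceDiff) (g := c.symDiff ∘ₗ K.straighten c)
    (comp_eq_comp_of_pr (K.isCodifferential_ceDiff h𝓛).comul
    (comul_coder fun n x hx => neg_mem (K.d_mem _ _ (pr_mem hx))) (K.comul_straighten c) (counit_cohom _)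
    (fun _ _ => K.straighten_mem c) (counit_coder _) (counit_coder _) fun x => ?_) x
  have hcup : cup K.bracket (pr (shift 𝓛)) (pr (shift 𝓛)) ∘ₗ K.ceDiff = 0 :=
    eq_zero_of_degree (fun i => h𝓛.shift_eq_bot) h𝓛 fun n x hx => by
      have := cup_mem K.bracket_mem (fun _ _ => pr_mem) (fun _ _ => pr_mem)
        (coder_mem_degree K.ceGen_mem hx)
      rwa [show n + -1 - 2 = n - 3 by omega] at this
  have hcup' := LinearMap.congr_fun hcup x
  rw [LinearMap.comp_apply, LinearMap.zero_apply] at hcup'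
  have hdh : K.d (c.h (cup K.bracket (pr (shift 𝓛)) (pr (shift 𝓛)) x)) =
      cup K.bracket (pr (shift 𝓛)) (pr (shift 𝓛)) x := by
    have h := cup_compr₂ (B := K.bracket) (a := pr (shift 𝓛)) (b := pr (shift 𝓛)) (K.d ∘ₗ c.h)
    rw [show K.bracket.compr₂ (K.d ∘ₗ c.h) = K.bracket from LinearMap.ext₂ hb] at h
    exact (LinearMap.congr_fun h x).symm
  have e : pr (shift 𝓛) (c.symDiff (K.straighten c x)) = -K.d (K.straightenGen c x) := by
    rw [Contraction.symDiff, pr_coder, LinearMap.comp_apply, pr_straighten, LinearMap.neg_apply]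
  rw [e, pr_straighten, straightenGen, LinearMap.sub_apply, LinearMap.sub_apply,
    LinearMap.smul_apply, LinearMap.smul_apply, LinearMap.comp_apply, LinearMap.comp_apply, hcup',
    map_zero, smul_zero, sub_zero, map_sub, map_smul, hdh, ceDiff_eq, pr_coder, ceGen]
  simp only [LinearMap.add_apply, LinearMap.neg_apply, LinearMap.comp_apply, LinearMap.smul_apply]
  abel

variable [DirectSum.Decomposition 𝓗]

/-- `straighten` carries the adjoint of `τ` to the linear map induced by the inclusion; this is
the fixed point equation for `τ`. -/
theorem straighten_tauBar [CharZero F] (x : GSym (shift 𝓗)) :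
    K.straighten c (tauBar c K.bracket x) = c.symIncl x := by
  have hm := comul_map (𝒱 := shift 𝓗) (𝒲 := shift 𝓛) c.incl_mem_shift
  refine LinearMap.congr_fun (f := K.straighten c ∘ₗ tauBar c K.bracket) (g := c.symIncl)
    (coalgHom_ext ?_ hm (fun x => ?_) fun x => ?_) x
  · rw [← LinearMap.comp_assoc, K.comul_straighten, LinearMap.comp_assoc,
      comul_tauBar c K.bracket_mem, ← LinearMap.comp_assoc, ← TensorProduct.map_comp]
  · refine ((counit_cohom _ _).trans (counit_cohom _ _)).trans (counit_map _ x).symm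
  · have hτ := LinearMap.congr_fun (tau_eq c K.bracket) x
    rw [LinearMap.comp_apply, pr_straighten, straightenGen, LinearMap.sub_apply,
      LinearMap.smul_apply, LinearMap.comp_apply, cup_tauBar c K.bracket_mem, pr_tauBar, hτ]
    refine Eq.trans ?_ (pr_map (𝒱 := shift 𝓗) (𝒲 := shift 𝓛) c.incl_mem_shift x).symm
    exact add_sub_cancel_right _ _

theorem symProj_straighten [CharZero F] (x : GSym (shift 𝓛)) :
    symProj c (K.straighten c x) = symProj c x := by
  have hm := comul_map (𝒱 := shift 𝓛) (𝒲 := shift 𝓗) c.proj_mem_shift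
  refine LinearMap.congr_fun (f := symProj c ∘ₗ K.straighten c) (g := symProj c)
    (coalgHom_ext ?_ hm (fun x => ?_) fun x => ?_) x
  · rw [← LinearMap.comp_assoc, c.symProj_eq, hm, LinearMap.comp_assoc, K.comul_straighten,
      ← LinearMap.comp_assoc, ← TensorProduct.map_comp]
  · exact ((counit_map c.proj_mem_shift _).trans (counit_cohom _ _)).trans
      (counit_map c.proj_mem_shift x).symm
  · refine (pr_map (𝒱 := shift 𝓛) (𝒲 := shift 𝓗) c.proj_mem_shift _).trans
      (Eq.trans ?_ (pr_map (𝒱 := shift 𝓛) (𝒲 := shift 𝓗) c.proj_mem_shift x).symm)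
    rw [pr_straighten, straightenGen]
    simp [c.proj_h]

/-- The contraction of the classifying coalgebra: that of the symmetric coalgebra with the linear
part of the differential, transported along `straighten`. -/
def ceContraction [CharZero F] (h𝓛 : Concentrated 𝓛)
    (hb : ∀ x y, K.d (c.h (K.bracket x y)) = K.bracket x y) :
    Contraction (degree (shift 𝓗)) 0 (degree (shift 𝓛)) K.ceDiff :=
  (c.sym K.d_mem).congr (K.straightenEquiv c) (K.straighten_mem_iff c)
    (straighten_ceDiff c h𝓛 hb)

theorem ceContraction_incl [CharZero F] (h𝓛 : Concentrated 𝓛)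
    (hb : ∀ x y, K.d (c.h (K.bracket x y)) = K.bracket x y) :
    (ceContraction c h𝓛 hb).incl = tauBar c K.bracket :=
  LinearMap.ext fun x => (K.straightenEquiv c).symm_apply_eq.mpr (straighten_tauBar c x).symm

theorem ceContraction_proj [CharZero F] (h𝓛 : Concentrated 𝓛)
    (hb : ∀ x y, K.d (c.h (K.bracket x y)) = K.bracket x y) :
    (ceContraction c h𝓛 hb).proj = symProj c :=
  LinearMap.ext (symProj_straighten c)

theorem isDGCoalgHom_tauBar_zero [CharZero F] (h𝓛 : Concentrated 𝓛)
    (hb : ∀ x y, K.d (c.h (K.bracket x y)) = K.bracket x y) :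
    IsDGCoalgHom 0 K.ceDiff (tauBar c K.bracket) where
  source := isCodifferential_zero
  target := K.isCodifferential_ceDiff h𝓛
  mem := tauBar_mem c K.bracket_mem
  comul := comul_tauBar c K.bracket_mem
  counit := counit_cohom _
  one := cohom_one _
  comm := by
    rw [← ceContraction_incl c h𝓛 hb]
    exact LinearMap.ext (ceContraction c h𝓛 hb).incl_comm

theorem isDGCoalgHom_symProj [CharZero F] (h𝓛 : Concentrated 𝓛)
    (hb : ∀ x y, K.d (c.h (K.bracket x y)) = K.bracket x y) :
    IsDGCoalgHom K.ceDiff 0 (symProj c) where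
  source := K.isCodifferential_ceDiff h𝓛
  target := isCodifferential_zero
  mem _ _ hx := map_mem_degree c.proj_mem_shift hx
  comul := comul_map c.proj_mem_shift
  counit := counit_map c.proj_mem_shift
  one := c.symProj_one
  comm := by
    rw [← ceContraction_proj c h𝓛 hb]
    exact LinearMap.ext (ceContraction c h𝓛 hb).proj_comm

end DGLie

end Straighten

/-! ### Formality -/

section Formal

open GSym

variable {F : Type*} [Field F] {L : Type*} [AddCommGroup L] [Module F L]
  {𝓛 : ℤ → Submodule F L} [DirectSum.Decomposition 𝓛]

namespace DGLie

variable {K : DGLie 𝓛}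

theorem homologyBracket_eq_zero (hb : ∀ x y, K.bracket x y ∈ LinearMap.range K.d) :
    K.homologyBracket = 0 := by
  refine LinearMap.ext₂ fun x y => ?_
  obtain ⟨x, rfl⟩ := Submodule.Quotient.mk_surjective _ x
  obtain ⟨y, rfl⟩ := Submodule.Quotient.mk_surjective _ y
  exact (Submodule.Quotient.mk_eq_zero _).mpr (hb x y)

theorem ceDiff_homologyLie (hb : ∀ x y, K.bracket x y ∈ LinearMap.range K.d) :
    K.homologyLie.ceDiff = 0 := by
  have hB : K.homologyLie.bracket = 0 := homologyBracket_eq_zero hb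
  have h : K.homologyLie.ceGen = 0 := by
    rw [ceGen, hB, show K.homologyLie.d = 0 from rfl]
    rw [GSym.zero_cup]
    simp
  rw [ceDiff_eq, h, coder_zero]

/-- A differential graded Lie algebra in degrees `-1` and `-2` is formal if, relative to a
contraction onto its homology, its bracket takes values in `d h L`. -/
theorem lInftyEquivalent_homologyLie [CharZero F] (c : Contraction K.homologyGrading 0 𝓛 K.d)
    (h𝓛 : Concentrated 𝓛) (hb : ∀ x y, K.d (c.h (K.bracket x y)) = K.bracket x y) :
    LInftyEquivalent K K.homologyLie := by
  have h0 : K.homologyLie.ceDiff = 0 := ceDiff_homologyLie fun x y => ⟨_, hb x y⟩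
  refine ⟨⟨symProj c, ?_, ?_⟩, ⟨tauBar c K.bracket, ?_, ?_⟩⟩
  · rw [h0]
    exact isDGCoalgHom_symProj c h𝓛 hb
  · rw [show pr (shift K.homologyGrading) ∘ₗ symProj c ∘ₗ ι (shift 𝓛) = c.proj from
      LinearMap.ext fun x => (pr_map c.proj_mem_shift _).trans (congrArg c.proj (pr_ι x))]
    exact c.neg.isQuasiIso_proj
  · rw [h0]
    exact isDGCoalgHom_tauBar_zero c h𝓛 hb
  · have h : pr (shift 𝓛) ∘ₗ tauBar c K.bracket ∘ₗ ι (shift K.homologyGrading) = c.incl := by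
      refine LinearMap.ext fun x => ?_
      rw [LinearMap.comp_apply, LinearMap.comp_apply, pr_tauBar,
        tau_of_mem c K.bracket (ι_mem_length x), tauTerm, LinearMap.comp_apply, pr_ι]
    rw [h]
    exact c.neg.isQuasiIso_incl

end DGLie

end Formal

end DGL

end

theorem proposition6p6 {F : Type*} [Field F] [CharZero F] {L : Type*} [AddCommGroup L]
    [Module F L] (𝓛 : ℤ → Submodule F L) [DirectSum.Decomposition 𝓛] (K : DGL.DGLie 𝓛)
    (hK : DGL.DGLie.Concentrated 𝓛) (c : DGL.Contraction K.homologyGrading 0 𝓛 K.d) :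
    -- `Ka` is the reduced Lie algebra, `Ka.ceDiff` is the differential `d + ∂_B` and `K.ceDiff` is
    -- the differential `d + ∂`, both on `S^c[V]` with `V = sK`
    let Ka : DGL.DGLie 𝓛 := K.reduced hK c
    let τbar : DGL.GSym (DGL.shift K.homologyGrading) →ₗ[F] DGL.GSym (DGL.shift 𝓛) :=
      DGL.tauBar c Ka.bracket
    let Sπ : DGL.GSym (DGL.shift 𝓛) →ₗ[F] DGL.GSym (DGL.shift K.homologyGrading) :=
      DGL.symProj c
    let 𝒟 : DGL.GSym (DGL.shift K.homologyGrading) →ₗ[F]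
        DGL.GSym (DGL.shift K.homologyGrading) := DGL.calD c K.bracket
    -- `Ka` is formal
    DGL.DGLie.LInftyEquivalent Ka Ka.homologyLie ∧
    -- `τbar : S^c[v] → C[Ka]` is a quasi-isomorphism of differential graded coalgebras
    DGL.GSym.IsDGCoalgHom 0 Ka.ceDiff τbar ∧ DGL.IsQuasiIso 0 Ka.ceDiff τbar ∧
    -- `S^c[π] : C[Ka] → S^c[v]` is a quasi-isomorphism of differential graded coalgebras
    DGL.GSym.IsDGCoalgHom Ka.ceDiff 0 Sπ ∧ DGL.IsQuasiIso Ka.ceDiff 0 Sπ ∧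
    -- `S^c[π] ∘ τbar = Id`, and the two maps are part of a contraction
    Sπ ∘ₗ τbar = LinearMap.id ∧
    (∃ C : DGL.Contraction (DGL.GSym.degree (DGL.shift K.homologyGrading)) 0
        (DGL.GSym.degree (DGL.shift 𝓛)) Ka.ceDiff, C.incl = τbar ∧ C.proj = Sπ) ∧
    -- `τbar : S^c_𝒟[v] → C[K]` is a morphism of differential graded coalgebras
    DGL.GSym.IsDGCoalgHom 𝒟 K.ceDiff τbar := by
  -- the reduced bracket is `d h` of the given one, and `h d h = h`
  have hb : ∀ x y, (K.reduced hK c).d (c.h ((K.reduced hK c).bracket x y)) =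
      (K.reduced hK c).bracket x y := fun x y => congrArg K.d (c.h_d_h (K.bracket x y))
  have hτ : DGL.tauBar c (K.reduced hK c).bracket = DGL.tauBar c K.bracket :=
    congrArg (DGL.GSym.cohom (DGL.shift 𝓛)) (DGL.tau_compr₂ c K.bracket)
  let C := DGL.DGLie.ceContraction (K := K.reduced hK c) c hK hb
  have hi : C.incl = DGL.tauBar c (K.reduced hK c).bracket :=
    DGL.DGLie.ceContraction_incl (K := K.reduced hK c) c hK hb
  have hp : C.proj = DGL.symProj c := DGL.DGLie.ceContraction_proj (K := K.reduced hK c) c hK hb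
  refine ⟨DGL.DGLie.lInftyEquivalent_homologyLie (K := K.reduced hK c) c hK hb,
    DGL.DGLie.isDGCoalgHom_tauBar_zero (K := K.reduced hK c) c hK hb, hi ▸ C.isQuasiIso_incl,
    DGL.DGLie.isDGCoalgHom_symProj (K := K.reduced hK c) c hK hb, hp ▸ C.isQuasiIso_proj,
    hi ▸ hp ▸ LinearMap.ext C.proj_incl, ⟨C, hi, hp⟩, ?_⟩
  rw [hτ]
  exact K.isDGCoalgHom_tauBar c hK (K.homologyGrading_concentrated hK)
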